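/- **Setting.** $M\ge 1$ clients minimize $F=\frac1M\sum_{m=1}^M F_m$ over $\mathbb R^n$. Each $F_m$ is differentiable with $L$-Lipschitz gradient ($L>0$). Client $m$ can draw stochastic gradients $g_m(x;\xi)$, $\xi\sim\mathcal D_m$, with $\mathbb E\,g_m(x;\xi)=\nabla F_m(x)$ and $\mathbb E\|g_m(x;\xi)-\nabla F_m(x)\|^2\le\sigma^2$; all samples are independent. The network is given by $W\in\mathbb R^{M\times M}$ with $W=W^\top$, $-I\preceq W\preceq I$, $W\mathbf 1=\mathbf 1$, whose second largest singular value is at most $\sigma_2<1$ (for $M=1$ it is read as $0$). All clients start at the same $x^0$. Let $\Delta\ge F(x^0)-\inf F$, and $G^2\ge\frac1M\sum_m\|\nabla F_m(x^0)\|^2$; no bound on $G$ is assumed, and it enters only through a logarithm. **Acc-GA-MSGD** for local functions $h_m$ with stochastic gradients $g^h_m$, parameters $T,K\in\mathbb N$, step sizes $\tau_1^k,\tau_2>0$ and $\beta\ge0$: start from given $x_m^{0,0}$ and $\zeta_m^0=\widetilde\zeta_m^0=0$; for $t=0,\dots,T$ perform $K$ local steps $x_m^{t,k+1}=x_m^{t,k}-\tau_1^k\big[\frac1M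 g^h_m(x_m^{t,k};\xi)+\widetilde\zeta_m^t\big]$ with fresh samples, set $x_m^{t+1,0}=x_m^{t,K}$, $\zeta_m^{t+1}=\widetilde\zeta_m^t+\tau_2\big(x_m^{t+1,0}-\sum_jW_{mj}x_j^{t+1,0}\big)$ and $\widetilde\zeta_m^{t+1}=\zeta_m^{t+1}+\beta(\zeta_m^{t+1}-\zeta_m^t)$; output $x_m^{T,K}$. It costs $T+1$ communication rounds and $(T+1)K$ samples per client. **Catalyst with Acc-GA-MSGD.** Put $y_m^0=y_m^1=x_m^0=x^0$. For $s=1,\dots,S$, apply Acc-GA-MSGD, with parameters that may depend on $s$, to the local functions $F_m^s(x)=F_m(x)+L\|x-y_m^s\|^2$ (stochastic gradients $g_m(x;\xi)+2L(x-y_m^s)$) from the initial points $x_m^{s-1}+c\,(y_m^s-y_m^{s-1})$; call the output $x_m^s$, and set $y_m^{s+1}=x_m^s+\beta_s(x_m^s-x_m^{s-1})$. Here $\alpha_s>0$, $\alpha_s^2=(1-\alpha_s)\alpha_{s-1}^2+q\alpha_s$, $\beta_s=\frac{\alpha_{s-1}(1-\alpha_{s-1})}{\alpha_{s-1}^2+\alpha_s}$,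 with $q=\frac{\mu}{\mu+2L}$, $\alpha_0=\sqrt q$, $c=\frac{2L}{2L+\mu}$ in (SC); $q=0$, $\alpha_0=1$, $c=1$ in (C); and $\beta_s=0$, $c=0$ in (NC). Write $\bar x^s=\frac1M\sum_mx_m^s$ and $F^s=\frac1M\sum_mF_m^s$. *Communication* and *samples* are the total number of communication rounds and the number of stochastic gradients per client over the $S$ rounds. **Statement.** In each case below the number of rounds $S$ and the parameters $(T_s,K_s,\tau_{1,s}^k,\tau_{2,s},\beta_s')$ of the inner calls can be chosen, depending only on the constants $M,L,\sigma,\sigma_2,\Delta,G,\varepsilon$ (and $\mu$, resp. $\gamma,R$), such that for every problem as above the following holds. $C>0$ and $e\in\mathbb N$ are absolute constants, except that in (C) they may depend on $\gamma$. * **(SC)** Every $F_m$ is $\mu$-strongly convex, $0<\mu\le L$, $\kappa=L/\mu$, $\varepsilon>0$. Then $\mathbb E[F^s(\bar x^s)-\min F^s]\le\frac29\big(1-0.9\sqrt q\big)^s\Delta$ for $1\le s\le S$, $\mathbb E F(\bar x^S)-F^*\le\varepsilon$, and with $\Lambda=2+M+\kappa+\frac1{1-\sigma_2}+\frac{\Delta+G^2/L}{\varepsilon}$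 - communication $\le C\sqrt{\frac{\kappa}{1-\sigma_2}}\,(\log\Lambda)^e$, - samples $\le C\Big(\sqrt{\frac{\kappa}{1-\sigma_2}}+\frac{\sqrt\kappa\,\sigma^2}{\mu(1-\sigma_2)^3\varepsilon}\Big)(\log\Lambda)^e$. * **(C)** Every $F_m$ is convex, $F$ has a minimizer $x^*$ with $\|x^0-x^*\|\le R$, $\gamma\in(0,1]$, $\varepsilon>0$. Then $\mathbb E[F^s(\bar x^s)-\min F^s]\le\frac{2\Delta}{9(s+1)^{4+\gamma}}$ for $1\le s\le S$, $\mathbb E F(\bar x^S)-F^*\le\varepsilon$, and with $B=LR^2+\Delta$, $\Lambda=2+M+\frac1{1-\sigma_2}+\frac{B+G^2/L}{\varepsilon}$ - communication $\le C\sqrt{\frac{B}{(1-\sigma_2)\varepsilon}}\,(\log\Lambda)^e$, - samples $\le C\Big(\sqrt{\frac{B}{(1-\sigma_2)\varepsilon}}+\frac{B^{2.5+\gamma/2}\sigma^2}{L\Delta(1-\sigma_2)^3\varepsilon^{2.5+\gamma/2}}\Big)(\log\Lambda)^e$ (if $\Delta=0$, the second term is read as $0$). * **(NC)** No convexity, $0<\varepsilon^2\le2L\Delta$.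 Then $S\ge1$, $\mathbb E[F^s(\bar x^s)-\min F^s]\le\Delta/S$ for $1\le s\le S$, $\frac1S\sum_{s=1}^S\mathbb E\|\nabla F(\bar x^s)\|^2\le\varepsilon^2$, and with $\Lambda=2+M+\frac1{1-\sigma_2}+\frac{L\Delta+G^2}{\varepsilon^2}$ - communication $\le C\,\frac{L\Delta}{\sqrt{1-\sigma_2}\,\varepsilon^2}\,(\log\Lambda)^e$, - samples $\le C\Big(\frac{L\Delta}{\sqrt{1-\sigma_2}\,\varepsilon^2}+\frac{L\Delta\,\sigma^2}{(1-\sigma_2)^3\varepsilon^4}\Big)(\log\Lambda)^e$. Thus the communication complexities are $\widetilde O(\sqrt{\kappa/(1-\sigma_2)})$, $\widetilde O(1/\sqrt{(1-\sigma_2)\varepsilon})$ and $\widetilde O(1/(\sqrt{1-\sigma_2}\,\varepsilon^2))$, and the sample complexities are $\widetilde O\big(\sqrt{\frac{\kappa}{1-\sigma_2}}+\frac{\sqrt\kappa\sigma^2}{\mu(1-\sigma_2)^3\varepsilon}\big)$, $\widetilde O\big(\frac1{\sqrt{(1-\sigma_2)\varepsilon}}+\frac{\sigma^2}{(1-\sigma_2)^3\varepsilon^{2.5+\gamma/2}}\big)$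 and $\widetilde O\big(\frac1{\sqrt{1-\sigma_2}\varepsilon^2}+\frac{\sigma^2}{(1-\sigma_2)^3\varepsilon^4}\big)$. -/

import Mathlib

open MeasureTheory ProbabilityTheory

noncomputable section

namespace DecOpt

/-- The decision space `ℝⁿ` with its Euclidean norm. -/
abbrev Vec (n : ℕ) := EuclideanSpace ℝ (Fin n)

/-- The average `(1/M) ∑ₘ xₘ` of the clients' variables. -/
def avg {M n : ℕ} (x : Fin M → Vec n) : Vec n := (1 / (M : ℝ)) • ∑ m, x m

/-- `f` is `μ`-strongly convex (first-order form, for differentiable `f`). -/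
def StronglyConvexWith {n : ℕ} (μ : ℝ) (f : Vec n → ℝ) : Prop :=
  ∀ x y : Vec n, f x + inner ℝ (gradient f x) (y - x) + μ / 2 * ‖y - x‖ ^ 2 ≤ f y

/-- `f` is differentiable and its gradient is `L`-Lipschitz. -/
def SmoothWith {n : ℕ} (L : ℝ) (f : Vec n → ℝ) : Prop :=
  Differentiable ℝ f ∧ ∀ x y : Vec n, ‖gradient f x - gradient f y‖ ≤ L * ‖x - y‖

/-- The second largest singular value of a square matrix
(it is `0` for a `1 × 1` matrix; Mathlib numbers singular values from `0`). -/
def secondSingularValue {M : ℕ} (W : Matrix (Fin M) (Fin M) ℝ) : ℝ :=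
  (Matrix.toEuclideanLin W).singularValues 1

/-- A gossip matrix: `W = Wᵀ`, `-I ⪯ W ⪯ I`, `W 1 = 1`, and its second largest singular value
is at most `σ₂`. -/
structure IsGossip {M : ℕ} (W : Matrix (Fin M) (Fin M) ℝ) (σ₂ : ℝ) : Prop where
  symm : W.transpose = W
  le_one : (1 - W).PosSemidef
  neg_one_le : (1 + W).PosSemidef
  mulVec_one : W.mulVec (fun _ => 1) = fun _ => 1
  second_le : secondSingularValue W ≤ σ₂

/-- A decentralized stochastic problem with `M` clients: local objectives `F m`, stochastic
gradients `g m x z` where the sample `z` has law `D m`, a gossip matrix `W`, and a common starting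
point `x0`. -/
structure Problem (M n : ℕ) (Ξ : Type*) [MeasurableSpace Ξ] where
  F : Fin M → Vec n → ℝ
  g : Fin M → Vec n → Ξ → Vec n
  D : Fin M → Measure Ξ
  W : Matrix (Fin M) (Fin M) ℝ
  x0 : Vec n

section
variable {M n : ℕ} {Ξ : Type*} [MeasurableSpace Ξ]

/-- The global objective `F = (1/M) ∑ₘ Fₘ`. -/
def Problem.obj (p : Problem M n Ξ) (x : Vec n) : ℝ := (1 / (M : ℝ)) * ∑ m, p.F m x

/-- The regularised objective `(1/M) ∑ₘ (Fₘ(x) + L ‖x - yₘ‖²)` with prox centres `yₘ`. -/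
def Problem.subObj (p : Problem M n Ξ) (L : ℝ) (y : Fin M → Vec n) (x : Vec n) : ℝ :=
  (1 / (M : ℝ)) * ∑ m, (p.F m x + L * ‖x - y m‖ ^ 2)

/-- The standing assumptions: every `Fₘ` is `L`-smooth, the stochastic gradients are unbiased with
variance at most `σ²`, and `W` is a gossip matrix with parameter `σ₂`. -/
structure Problem.Standing (p : Problem M n Ξ) (L σ σ₂ : ℝ) : Prop where
  smooth : ∀ m, SmoothWith L (p.F m)
  prob : ∀ m, IsProbabilityMeasure (p.D m)
  meas : ∀ m, Measurable (Function.uncurry (p.g m))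
  integrable : ∀ m x, Integrable (p.g m x) (p.D m)
  unbiased : ∀ m x, ∫ z, p.g m x z ∂(p.D m) = gradient (p.F m) x
  variance : ∀ m x,
    ∫⁻ z, ‖p.g m x z - gradient (p.F m) x‖ₑ ^ 2 ∂(p.D m) ≤ ENNReal.ofReal (σ ^ 2)
  gossip : IsGossip p.W σ₂

end

/-- `ξ s t k m` is the sample drawn by client `m` at local step `k` of outer iteration `t` of the
inner algorithm in Catalyst round `s`. All samples are independent, those of client `m` have
law `D m`. -/
structure IsSampling {M : ℕ} {Ξ Ω : Type*} [MeasurableSpace Ξ] [MeasurableSpace Ω]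
    (P : Measure Ω) (D : Fin M → Measure Ξ) (ξ : ℕ → ℕ → ℕ → Fin M → Ω → Ξ) : Prop where
  meas : ∀ s t k m, Measurable (ξ s t k m)
  law : ∀ s t k m, P.map (ξ s t k m) = D m
  indep : iIndepFun
    (fun i : ℕ × ℕ × ℕ × Fin M => ξ i.1 i.2.1 i.2.2.1 i.2.2.2) P

/-! ### Acc-GA-MSGD -/

/-- Parameters of one call of Acc-GA-MSGD: the outer loop is `t = 0, …, T`, each outer iteration
makes `K` local steps with step sizes `τ₁ 0, …, τ₁ (K - 1)`; `τ₂` is the dual step size and `β` the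
dual momentum. -/
structure AccParams where
  T : ℕ
  K : ℕ
  τ₁ : ℕ → ℝ
  τ₂ : ℝ
  β : ℝ
  τ₁_pos : ∀ k, 0 < τ₁ k
  τ₂_pos : 0 < τ₂
  β_nonneg : 0 ≤ β

/-- Each of the `T + 1` outer iterations uses one round of communication with the neighbours. -/
def AccParams.comm (a : AccParams) : ℕ := a.T + 1

/-- The number of stochastic gradients used by each client. -/
def AccParams.samples (a : AccParams) : ℕ := (a.T + 1) * a.K

/-- The local stochastic gradient steps `xₘ ← xₘ - τ k • ((1/M) hₘ(xₘ; ξₘ) + ζₘ)`; no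
communication. -/
def localSteps {M n : ℕ} {Ξ : Type*} (h : Fin M → Vec n → Ξ → Vec n) (τ : ℕ → ℝ)
    (ζ : Fin M → Vec n) (ξ : ℕ → Fin M → Ξ) (x : Fin M → Vec n) : ℕ → Fin M → Vec n
  | 0 => x
  | k + 1 => fun m =>
      localSteps h τ ζ ξ x k m
        - τ k • ((1 / (M : ℝ)) • h m (localSteps h τ ζ ξ x k m) (ξ k m) + ζ m)

/-- State of Acc-GA-MSGD before an outer iteration: primal variables `x`, dual variables `ζ`, and
the extrapolated dual variables `ζt`. -/
structure AccState (M n : ℕ) where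
  x : Fin M → Vec n
  ζ : Fin M → Vec n
  ζt : Fin M → Vec n

/-- State of Acc-GA-MSGD after `t` outer iterations, started at `x` with dual variables `0`. The
dual step uses `(I - W) X`. -/
def accState {M n : ℕ} {Ξ : Type*} (W : Matrix (Fin M) (Fin M) ℝ)
    (h : Fin M → Vec n → Ξ → Vec n) (a : AccParams) (ξ : ℕ → ℕ → Fin M → Ξ)
    (x : Fin M → Vec n) : ℕ → AccState M n
  | 0 => ⟨x, 0, 0⟩
  | t + 1 =>
      let st := accState W h a ξ x t
      let x' := localSteps h a.τ₁ st.ζt (ξ t) st.x a.K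
      let ζ' : Fin M → Vec n := fun m => st.ζt m + a.τ₂ • (x' m - ∑ j, W m j • x' j)
      ⟨x', ζ', fun m => ζ' m + a.β • (ζ' m - st.ζ m)⟩

/-- The output of Acc-GA-MSGD, after the outer iterations `t = 0, …, T`. -/
def accGaMsgd {M n : ℕ} {Ξ : Type*} (W : Matrix (Fin M) (Fin M) ℝ)
    (h : Fin M → Vec n → Ξ → Vec n) (a : AccParams) (ξ : ℕ → ℕ → Fin M → Ξ)
    (x : Fin M → Vec n) : Fin M → Vec n :=
  (accState W h a ξ x (a.T + 1)).x

/-! ### Decentralized Catalyst -/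

/-- The three variants of Catalyst. -/
inductive Regime where
  | stronglyConvex (μ : ℝ)
  | convex
  | nonconvex

/-- The positive root `b` of `b² = (1 - b) a² + q b`. -/
def nextAlpha (q a : ℝ) : ℝ := (q - a ^ 2 + √((q - a ^ 2) ^ 2 + 4 * a ^ 2)) / 2

theorem nextAlpha_eq (q a : ℝ) :
    nextAlpha q a ^ 2 = (1 - nextAlpha q a) * a ^ 2 + q * nextAlpha q a := by
  have h : √((q - a ^ 2) ^ 2 + 4 * a ^ 2) ^ 2 = (q - a ^ 2) ^ 2 + 4 * a ^ 2 :=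
    Real.sq_sqrt (by positivity)
  unfold nextAlpha
  linear_combination h / 4

theorem nextAlpha_pos (q : ℝ) {a : ℝ} (ha : a ≠ 0) : 0 < nextAlpha q a := by
  have h : |q - a ^ 2| < √((q - a ^ 2) ^ 2 + 4 * a ^ 2) := by
    rw [← Real.sqrt_sq_eq_abs]
    apply Real.sqrt_lt_sqrt (sq_nonneg _)
    have := sq_pos_of_ne_zero ha
    linarith
  have := neg_abs_le (q - a ^ 2)
  unfold nextAlpha
  linarith

/-- The sequence `α₀, α₁, …` with `αₛ² = (1 - αₛ) αₛ₋₁² + q αₛ`. -/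
def alphaSeq (q α₀ : ℝ) : ℕ → ℝ
  | 0 => α₀
  | s + 1 => nextAlpha q (alphaSeq q α₀ s)

/-- `βₛ = αₛ₋₁ (1 - αₛ₋₁) / (αₛ₋₁² + αₛ)`, for `s ≥ 1`. -/
def betaSeq (q α₀ : ℝ) (s : ℕ) : ℝ :=
  alphaSeq q α₀ (s - 1) * (1 - alphaSeq q α₀ (s - 1))
    / (alphaSeq q α₀ (s - 1) ^ 2 + alphaSeq q α₀ s)

/-- The momentum `βₛ` of Catalyst: `q = μ / (μ + 2L)`, `α₀ = √q` if strongly convex; `q = 0`,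
`α₀ = 1` if convex; no momentum if nonconvex. -/
def Regime.beta (L : ℝ) : Regime → ℕ → ℝ
  | .stronglyConvex μ, s => betaSeq (μ / (μ + 2 * L)) √(μ / (μ + 2 * L)) s
  | .convex, s => betaSeq 0 1 s
  | .nonconvex, _ => 0

/-- The coefficient `c` of the warm start `xˢ⁻¹ + c (yˢ - yˢ⁻¹)` of round `s`. -/
def Regime.warm (L : ℝ) : Regime → ℝ
  | .stronglyConvex μ => 2 * L / (2 * L + μ)
  | .convex => 1
  | .nonconvex => 0

/-- State of Catalyst after round `s`: iterate `x = xˢ`, prox centre `y = yˢ` used in that round,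
and prox centre `yNext = yˢ⁺¹` of the next round. -/
structure CatalystState (M n : ℕ) where
  x : Fin M → Vec n
  y : Fin M → Vec n
  yNext : Fin M → Vec n

/-- Decentralized Catalyst with Acc-GA-MSGD as inner algorithm: round `s ≥ 1` runs Acc-GA-MSGD with
parameters `par s` on the local functions `Fₘ(x) + L ‖x - yₘˢ‖²`, whose stochastic gradients are
`gₘ(x; z) + 2L (x - yₘˢ)`. It starts from `y⁰ = y¹ = x⁰` at every client. -/
def Problem.catalyst {M n : ℕ} {Ξ : Type*} [MeasurableSpace Ξ] (p : Problem M n Ξ) (L : ℝ)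
    (r : Regime) (par : ℕ → AccParams) (ξ : ℕ → ℕ → ℕ → Fin M → Ξ) : ℕ → CatalystState M n
  | 0 => ⟨fun _ => p.x0, fun _ => p.x0, fun _ => p.x0⟩
  | s + 1 =>
      let st := Problem.catalyst p L r par ξ s
      let x' := accGaMsgd p.W (fun m x z => p.g m x z + (2 * L) • (x - st.yNext m))
        (par (s + 1)) (ξ (s + 1)) (fun m => st.x m + r.warm L • (st.yNext m - st.y m))
      ⟨x', st.yNext, fun m => x' m + r.beta L (s + 1) • (x' m - st.x m)⟩

/-- Communication rounds used by `S` rounds of Catalyst. -/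
def commCost (S : ℕ) (par : ℕ → AccParams) : ℕ := ∑ s ∈ Finset.Icc 1 S, (par s).comm

/-- Stochastic gradients used by each client in `S` rounds of Catalyst. -/
def sampleCost (S : ℕ) (par : ℕ → AccParams) : ℕ := ∑ s ∈ Finset.Icc 1 S, (par s).samples

section
variable {M n : ℕ} {Ξ Ω : Type*} [MeasurableSpace Ξ] [MeasurableSpace Ω]

/-- The random state of Catalyst after round `s`, on the probability space of the samples. -/
def Problem.run (p : Problem M n Ξ) (L : ℝ) (r : Regime) (par : ℕ → AccParams)
    (ξ : ℕ → ℕ → ℕ → Fin M → Ω → Ξ) (s : ℕ) (ω : Ω) : CatalystState M n :=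
  p.catalyst L r par (fun s t k m => ξ s t k m ω) s

/-- The average `x̄ˢ` of the clients' iterates after round `s`. -/
def Problem.xbar (p : Problem M n Ξ) (L : ℝ) (r : Regime) (par : ℕ → AccParams)
    (ξ : ℕ → ℕ → ℕ → Fin M → Ω → Ξ) (s : ℕ) (ω : Ω) : Vec n :=
  avg (p.run L r par ξ s ω).x

/-- `𝔼 F(x̄ˢ) - F*`, as the integral of the nonnegative function `F(x̄ˢ) - F*`. -/
def Problem.expGap (p : Problem M n Ξ) (P : Measure Ω) (L : ℝ) (r : Regime) (par : ℕ → AccParams)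
    (ξ : ℕ → ℕ → ℕ → Fin M → Ω → Ξ) (s : ℕ) : ENNReal :=
  ∫⁻ ω, ENNReal.ofReal (p.obj (p.xbar L r par ξ s ω) - ⨅ z, p.obj z) ∂P

/-- `𝔼 [Fˢ(x̄ˢ) - min Fˢ]`, where `Fˢ` is the (random) objective of the subproblem of round `s`. -/
def Problem.expSubGap (p : Problem M n Ξ) (P : Measure Ω) (L : ℝ) (r : Regime)
    (par : ℕ → AccParams) (ξ : ℕ → ℕ → ℕ → Fin M → Ω → Ξ) (s : ℕ) : ENNReal :=
  ∫⁻ ω, ENNReal.ofReal (p.subObj L (p.run L r par ξ s ω).y (p.xbar L r par ξ s ω)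
    - ⨅ z, p.subObj L (p.run L r par ξ s ω).y z) ∂P

/-- `𝔼 ‖∇F(x̄ˢ)‖²`. -/
def Problem.expGradSq (p : Problem M n Ξ) (P : Measure Ω) (L : ℝ) (r : Regime)
    (par : ℕ → AccParams) (ξ : ℕ → ℕ → ℕ → Fin M → Ω → Ξ) (s : ℕ) : ENNReal :=
  ∫⁻ ω, ‖gradient p.obj (p.xbar L r par ξ s ω)‖ₑ ^ 2 ∂P

/-- The mean square of the local gradients at the starting point is at most `G²`. -/
def Problem.InitGradBound (p : Problem M n Ξ) (G : ℝ) : Prop :=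
  (1 / (M : ℝ)) * ∑ m, ‖gradient (p.F m) p.x0‖ ^ 2 ≤ G ^ 2

/-- `F(x⁰) - inf F ≤ Δ` (in particular `F` is bounded below). -/
def Problem.InitGapBound (p : Problem M n Ξ) (Δ : ℝ) : Prop :=
  ∀ z, p.obj p.x0 - p.obj z ≤ Δ

/-- `F` has a minimizer at distance at most `R` from `x⁰`. -/
def Problem.InitDistBound (p : Problem M n Ξ) (R : ℝ) : Prop :=
  ∃ x, (∀ z, p.obj x ≤ p.obj z) ∧ ‖p.x0 - x‖ ≤ R

end

end DecOpt

end

/-! Adding L‖x − y‖² to an L-smooth function, convex or not, makes it L-strongly convex and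
3L-smooth. Every Catalyst subproblem is therefore well conditioned, and its consensus form (one copy
of the variable per client, all copies equal) has a well conditioned dual: the negative dual
function has curvature between 1/(9L) and 3/L (`dual_bregman`).

Measured in the metric of the pseudo-inverse of I − W, the update by (I − W)X is a gradient step on
this dual. The spectral gap costs a factor of order 1/(1 − σ₂) in the condition number, so
Nesterov's momentum gains a constant factor every 1/√(1 − σ₂) communication rounds, up to constants
(`accelerated_step`, `exists_dual_potential`). The dual gradient requires the local minimizers,
which K local stochastic steps only approximate. A small constant step size keeps their noise floor
below the tolerance, and the starting error of each local phase stays bounded during the whole call,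
so one fixed K, logarithmic in the error ratio, suffices (`upperMean_localSteps`,
`upperMean_accGaMsgd`, `exists_accParams`).

Across rounds, the minimizer of a subproblem depends on the prox centres only through their average.
The averaged iterates thus follow a centralized inexact proximal point method, accelerated in the
two convex cases. Potential arguments (`catalyst_step_strongly_convex`, `catalyst_step_convex`,
`sum_norm_step_sq_le`) show that tolerances which are geometric, of order (s + 1)^(-(4 + γ)), or
constant, respectively, preserve its rate.

No bound on the heterogeneity of the clients is available, so the accuracy of a round needs a bound
on its starting error, hence on the distance of the earlier iterates from x⁰; that distance is
bounded by the potential, provided the earlier rounds were accurate. The strong induction in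
`upperMean_errSq` resolves this circularity, with crude bounds that enter the cost only through
logarithms. The complexities follow by multiplying the number of rounds by the cost of the most
accurate call. -/

namespace DecOpt

open Filter Topology

/-! ### Smooth functions -/

section Smooth
variable {n : ℕ} {L : ℝ} {f : Vec n → ℝ}

theorem SmoothWith.hasDerivAt_line (hf : SmoothWith L f) (x d : Vec n) (t : ℝ) :
    HasDerivAt (fun t : ℝ => f (x + t • d)) (inner ℝ (gradient f (x + t • d)) d) t := by
  have h1 : HasDerivAt (fun t : ℝ => x + t • d) d t := by
    simpa using ((hasDerivAt_id t).smul_const d).const_add x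
  have h2 := (hf.1 (x + t • d)).hasFDerivAt.comp_hasDerivAt t h1
  rw [inner_gradient_left]
  exact h2

/-- The first-order Taylor expansion of a smooth function. -/
theorem SmoothWith.abs_sub_le (hf : SmoothWith L f) (x y : Vec n) :
    |f y - f x - inner ℝ (gradient f x) (y - x)| ≤ L / 2 * ‖y - x‖ ^ 2 := by
  set d := y - x with hd
  have hD : ∀ t : ℝ, 0 ≤ t →
      |inner ℝ (gradient f (x + t • d)) d - inner ℝ (gradient f x) d| ≤ L * t * ‖d‖ ^ 2 := by
    intro t ht
    rw [← inner_sub_left]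
    refine (abs_real_inner_le_norm _ _).trans ?_
    have h := hf.2 (x + t • d) x
    rw [add_sub_cancel_left, norm_smul, Real.norm_of_nonneg ht] at h
    calc _ ≤ L * (t * ‖d‖) * ‖d‖ := by gcongr
      _ = _ := by ring
  -- The signs s = ±1 give both sides of the estimate from one argument: the Taylor remainder minus
  -- L/2 ‖d‖² t² is antitone along the segment, and t = 0 is compared with t = 1.
  have key : ∀ s : ℝ, |s| = 1 → s * (f y - f x - inner ℝ (gradient f x) d) ≤ L / 2 * ‖d‖ ^ 2 := by
    intro s hs
    have hder : ∀ t : ℝ, HasDerivAt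
        (fun t : ℝ => s * (f (x + t • d) - t * inner ℝ (gradient f x) d) - L / 2 * ‖d‖ ^ 2 * t ^ 2)
        (s * (inner ℝ (gradient f (x + t • d)) d - inner ℝ (gradient f x) d)
          - L * t * ‖d‖ ^ 2) t := by
      intro t
      have h1 := hf.hasDerivAt_line x d t
      have h2 := (hasDerivAt_id t).mul_const (inner ℝ (gradient f x) d)
      have h3 := ((hasDerivAt_id t).pow 2).const_mul (L / 2 * ‖d‖ ^ 2)
      have h4 : HasDerivAt (fun t : ℝ => s * (f (x + t • d) - t * inner ℝ (gradient f x) d)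
          - L / 2 * ‖d‖ ^ 2 * t ^ 2) _ t := ((h1.sub h2).const_mul s).sub h3
      refine h4.congr_deriv ?_
      simp only [id, one_mul, Nat.cast_ofNat, Nat.add_one_sub_one, pow_one, mul_one]
      ring
    have hanti : AntitoneOn (fun t : ℝ => s * (f (x + t • d) - t * inner ℝ (gradient f x) d)
        - L / 2 * ‖d‖ ^ 2 * t ^ 2) (Set.Ici 0) := by
      refine antitoneOn_of_deriv_nonpos (convex_Ici 0)
        (fun t _ => (hder t).continuousAt.continuousWithinAt)
        (fun t _ => (hder t).differentiableAt.differentiableWithinAt) ?_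
      intro t ht
      rw [interior_Ici] at ht
      rw [(hder t).deriv]
      have h1 := hD t (le_of_lt ht)
      have h2 : s * (inner ℝ (gradient f (x + t • d)) d - inner ℝ (gradient f x) d)
          ≤ |inner ℝ (gradient f (x + t • d)) d - inner ℝ (gradient f x) d| := by
        refine (le_abs_self _).trans ?_
        rw [abs_mul, hs, one_mul]
      linarith
    have h := hanti (Set.mem_Ici.2 le_rfl) (Set.mem_Ici.2 zero_le_one) zero_le_one
    simp only [one_smul, zero_smul, add_zero] at h
    have hy : x + d = y := by rw [hd]; abel
    rw [hy] at h
    linarith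
  rw [abs_le]
  have h1 := key 1 (by simp)
  have h2 := key (-1) (by simp)
  constructor <;> linarith

theorem SmoothWith.le (hf : SmoothWith L f) (x y : Vec n) :
    f y ≤ f x + inner ℝ (gradient f x) (y - x) + L / 2 * ‖y - x‖ ^ 2 := by
  have := (abs_le.1 (hf.abs_sub_le x y)).2
  linarith

theorem SmoothWith.ge (hf : SmoothWith L f) (x y : Vec n) :
    f x + inner ℝ (gradient f x) (y - x) - L / 2 * ‖y - x‖ ^ 2 ≤ f y := by
  have := (abs_le.1 (hf.abs_sub_le x y)).1
  linarith

theorem SmoothWith.continuous_gradient (hf : SmoothWith L f) : Continuous (gradient f) := by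
  have : LipschitzWith L.toNNReal (gradient f) := by
    refine LipschitzWith.of_dist_le_mul fun x y => ?_
    rw [dist_eq_norm, dist_eq_norm]
    refine (hf.2 x y).trans ?_
    gcongr
    exact Real.le_coe_toNNReal L
  exact this.continuous

/-- Differentiable convex functions lie above their tangents. -/
theorem convex_first_order (hf : SmoothWith L f) (hc : ConvexOn ℝ Set.univ f) (x y : Vec n) :
    f x + inner ℝ (gradient f x) (y - x) ≤ f y := by
  have h1 := hf.hasDerivAt_line x (y - x) 0
  rw [zero_smul, add_zero] at h1
  have h2 := h1.tendsto_slope_zero_right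
  have : inner ℝ (gradient f x) (y - x) ≤ f y - f x := by
    refine le_of_tendsto h2 ?_
    have : Set.Ioc (0 : ℝ) 1 ∈ 𝓝[>] (0 : ℝ) := Ioc_mem_nhdsGT zero_lt_one
    filter_upwards [this] with t ht
    have h3 := hc.2 (Set.mem_univ x) (Set.mem_univ y) (sub_nonneg.2 ht.2) ht.1.le (by ring)
    have h4 : (1 - t) • x + t • y = x + t • (y - x) := by module
    rw [h4] at h3
    simp only [smul_eq_mul, zero_add, zero_smul, add_zero] at h3 ⊢
    rw [inv_mul_le_iff₀ ht.1]
    linarith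
  linarith

/-! ### The resolvent -/

/-- The equation is a fixed point problem for x ↦ (b − ∇f(x)) / (2L), a contraction with factor 1/2
because ∇f is L-Lipschitz. Convexity plays no role. -/
theorem SmoothWith.exists_resolvent (hL : 0 < L) (hf : SmoothWith L f) :
    Function.Surjective (fun x => gradient f x + (2 * L) • x) := by
  intro b
  let T : Vec n → Vec n := fun x => (1 / (2 * L)) • (b - gradient f x)
  have hT : ContractingWith (1 / 2 : NNReal) T := by
    refine ⟨by rw [← NNReal.coe_lt_coe]; norm_num, LipschitzWith.of_dist_le_mul fun x y => ?_⟩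
    rw [dist_eq_norm, dist_eq_norm, ← smul_sub, norm_smul, Real.norm_of_nonneg (by positivity),
      sub_sub_sub_cancel_left, norm_sub_rev]
    have := hf.2 x y
    calc 1 / (2 * L) * ‖gradient f x - gradient f y‖ ≤ 1 / (2 * L) * (L * ‖x - y‖) := by gcongr
      _ = _ := by push_cast; field_simp
  have hfix := hT.fixedPoint_isFixedPt
  refine ⟨ContractingWith.fixedPoint T hT, ?_⟩
  have h : (1 / (2 * L)) • (b - gradient f (ContractingWith.fixedPoint T hT))
      = ContractingWith.fixedPoint T hT := hfix
  have h2 : (2 * L) • ContractingWith.fixedPoint T hT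
      = b - gradient f (ContractingWith.fixedPoint T hT) := by
    conv_lhs => rw [← h]
    rw [smul_smul]
    field_simp
    simp
  simp only [h2]
  abel

/-- The resolvent `(∇f + 2L)⁻¹`: `resolvent L f (2L y - ζ)` minimizes
`f x + L ‖x - y‖² + ⟨ζ, x⟩`. -/
noncomputable def resolvent (L : ℝ) (f : Vec n → ℝ) : Vec n → Vec n :=
  Function.invFun (fun x => gradient f x + (2 * L) • x)

theorem SmoothWith.resolvent_eq (hL : 0 < L) (hf : SmoothWith L f) (b : Vec n) :
    gradient f (resolvent L f b) + (2 * L) • resolvent L f b = b :=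
  Function.rightInverse_invFun (hf.exists_resolvent hL) b

/-- The linear part expands by 2L and the gradient can take back at most L. -/
theorem SmoothWith.norm_sub_le_regularized (hL : 0 < L) (hf : SmoothWith L f) (x y : Vec n) :
    L * ‖x - y‖ ≤ ‖(gradient f x + (2 * L) • x) - (gradient f y + (2 * L) • y)‖ := by
  have h1 : (gradient f x + (2 * L) • x) - (gradient f y + (2 * L) • y)
      = (2 * L) • (x - y) - (gradient f y - gradient f x) := by module
  have h2 := norm_sub_norm_le ((2 * L) • (x - y)) (gradient f y - gradient f x)
  have h3 := hf.2 y x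
  rw [norm_smul, Real.norm_of_nonneg (by positivity)] at h2
  rw [h1]
  rw [norm_sub_rev y x] at h3
  linarith

theorem SmoothWith.norm_regularized_le (hL : 0 < L) (hf : SmoothWith L f) (x y : Vec n) :
    ‖(gradient f x + (2 * L) • x) - (gradient f y + (2 * L) • y)‖ ≤ 3 * L * ‖x - y‖ := by
  have h1 : (gradient f x + (2 * L) • x) - (gradient f y + (2 * L) • y)
      = (2 * L) • (x - y) + (gradient f x - gradient f y) := by module
  have h2 := norm_add_le ((2 * L) • (x - y)) (gradient f x - gradient f y)
  have h3 := hf.2 x y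
  rw [norm_smul, Real.norm_of_nonneg (by positivity)] at h2
  rw [h1]
  linarith

theorem SmoothWith.resolvent_of_eq (hL : 0 < L) (hf : SmoothWith L f) {x b : Vec n}
    (h : gradient f x + (2 * L) • x = b) : resolvent L f b = x := by
  have h1 := hf.norm_sub_le_regularized hL (resolvent L f b) x
  rw [hf.resolvent_eq hL b, h, sub_self, norm_zero] at h1
  have h2 : ‖resolvent L f b - x‖ ≤ 0 := by nlinarith [norm_nonneg (resolvent L f b - x)]
  exact sub_eq_zero.1 (norm_le_zero_iff.1 h2)

theorem SmoothWith.norm_resolvent_sub_le (hL : 0 < L) (hf : SmoothWith L f) (a b : Vec n) :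
    L * ‖resolvent L f a - resolvent L f b‖ ≤ ‖a - b‖ := by
  have := hf.norm_sub_le_regularized hL (resolvent L f a) (resolvent L f b)
  rwa [hf.resolvent_eq hL, hf.resolvent_eq hL] at this

theorem SmoothWith.norm_le_resolvent_sub (hL : 0 < L) (hf : SmoothWith L f) (a b : Vec n) :
    ‖a - b‖ ≤ 3 * L * ‖resolvent L f a - resolvent L f b‖ := by
  have := hf.norm_regularized_le hL (resolvent L f a) (resolvent L f b)
  rwa [hf.resolvent_eq hL, hf.resolvent_eq hL] at this

theorem SmoothWith.norm_sub_resolvent_le (hL : 0 < L) (hf : SmoothWith L f) (x b : Vec n) :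
    L * ‖x - resolvent L f b‖ ≤ ‖gradient f x + (2 * L) • x - b‖ := by
  have := hf.norm_sub_le_regularized hL x (resolvent L f b)
  rwa [hf.resolvent_eq hL] at this

theorem SmoothWith.continuous_resolvent (hL : 0 < L) (hf : SmoothWith L f) :
    Continuous (resolvent L f) := by
  have : LipschitzWith (1 / L).toNNReal (resolvent L f) := by
    refine LipschitzWith.of_dist_le_mul fun x y => ?_
    rw [dist_eq_norm, dist_eq_norm, Real.coe_toNNReal _ (by positivity), div_mul_eq_mul_div,
      one_mul, le_div_iff₀ hL, mul_comm]
    exact hf.norm_resolvent_sub_le hL x y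
  exact this.continuous

/-- One exact gradient step on the regularised function contracts towards its minimizer. -/
theorem SmoothWith.gradient_step_contracts (hL : 0 < L) (hf : SmoothWith L f) {η : ℝ}
    (hη : 0 ≤ η) (hη' : η * (9 * L) ≤ 1) (x y : Vec n) :
    ‖(x - y) - η • ((gradient f x + (2 * L) • x) - (gradient f y + (2 * L) • y))‖ ^ 2
      ≤ (1 - η * L) * ‖x - y‖ ^ 2 := by
  set G := (gradient f x + (2 * L) • x) - (gradient f y + (2 * L) • y) with hG
  have h1 := hf.norm_regularized_le hL x y
  rw [← hG] at h1
  have h2 : L * ‖x - y‖ ^ 2 ≤ inner ℝ (x - y) G := by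
    have e : G = (2 * L) • (x - y) + (gradient f x - gradient f y) := by rw [hG]; module
    rw [e, inner_add_right, inner_smul_right, real_inner_self_eq_norm_sq]
    have h3 := (abs_le.1 (abs_real_inner_le_norm (x - y) (gradient f x - gradient f y))).1
    have h4 := mul_le_mul_of_nonneg_left (hf.2 x y) (norm_nonneg (x - y))
    nlinarith
  have h3 : ‖G‖ ^ 2 ≤ 9 * L ^ 2 * ‖x - y‖ ^ 2 := by
    have := pow_le_pow_left₀ (norm_nonneg _) h1 2
    nlinarith
  rw [norm_sub_sq_real, inner_smul_right, norm_smul, mul_pow, Real.norm_eq_abs, sq_abs]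
  -- Strong monotonicity contributes −2ηL and the 3L-Lipschitz bound contributes 9η²L²; the
  -- condition 9ηL ≤ 1 makes the latter at most ηL, which leaves 1 − ηL.
  have h4 : η ^ 2 * ‖G‖ ^ 2 ≤ η * L * ‖x - y‖ ^ 2 := by
    calc η ^ 2 * ‖G‖ ^ 2 ≤ η ^ 2 * (9 * L ^ 2 * ‖x - y‖ ^ 2) := by gcongr
      _ = η * (9 * L) * (η * L * ‖x - y‖ ^ 2) := by ring
      _ ≤ 1 * (η * L * ‖x - y‖ ^ 2) := by gcongr
      _ = _ := one_mul _
  have h5 := mul_le_mul_of_nonneg_left h2 hη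
  nlinarith

/-- The regularised function `f + L ‖· - y‖²` lies between two paraboloids at the resolvent. -/
theorem SmoothWith.regularized_bregman (hf : SmoothWith L f) (y x x' : Vec n) :
    L / 2 * ‖x' - x‖ ^ 2 ≤ f x' + L * ‖x' - y‖ ^ 2 - (f x + L * ‖x - y‖ ^ 2)
        - inner ℝ (gradient f x + (2 * L) • (x - y)) (x' - x) ∧
      f x' + L * ‖x' - y‖ ^ 2 - (f x + L * ‖x - y‖ ^ 2)
        - inner ℝ (gradient f x + (2 * L) • (x - y)) (x' - x) ≤ 3 * L / 2 * ‖x' - x‖ ^ 2 := by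
  have h1 := hf.le x x'
  have h2 := hf.ge x x'
  have e : x' - y = (x' - x) + (x - y) := by abel
  rw [e, norm_add_sq_real, inner_add_left, inner_smul_left, real_inner_comm (x - y) (x' - x)]
  simp only [conj_trivial]
  constructor <;> nlinarith

end Smooth

end DecOpt

namespace DecOpt

open Matrix

/-! ### The gossip matrix -/

section Gossip
variable {M : ℕ} {W : Matrix (Fin M) (Fin M) ℝ} {σ₂ : ℝ}

theorem IsGossip.dotProduct_mulVec_comm (hW : IsGossip W σ₂) (v w : Fin M → ℝ) :
    v ⬝ᵥ W *ᵥ w = W *ᵥ v ⬝ᵥ w := by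
  rw [dotProduct_mulVec, ← mulVec_transpose, hW.symm]

theorem IsGossip.sum_mulVec (hW : IsGossip W σ₂) (v : Fin M → ℝ) :
    ∑ m, (W *ᵥ v) m = ∑ m, v m := by
  have h := hW.dotProduct_mulVec_comm (fun _ => 1) v
  rw [hW.mulVec_one] at h
  simpa [dotProduct] using h

theorem dotProduct_self_nonneg (v : Fin M → ℝ) : 0 ≤ v ⬝ᵥ v :=
  Finset.sum_nonneg fun i _ => mul_self_nonneg (v i)

theorem toEuclideanLin_inner (A : Matrix (Fin M) (Fin M) ℝ) (v w : EuclideanSpace ℝ (Fin M)) :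
    inner ℝ (toEuclideanLin A v) (toEuclideanLin A w)
      = A *ᵥ v.ofLp ⬝ᵥ A *ᵥ w.ofLp := by
  rw [EuclideanSpace.inner_eq_star_dotProduct, dotProduct_comm]
  simp [toLpLin_apply]

/-- `W` contracts the vectors of mean zero. -/
theorem IsGossip.mulVec_contracts (hW : IsGossip W σ₂) (h0 : 0 ≤ σ₂) (h1 : σ₂ < 1)
    {v : Fin M → ℝ} (hv : ∑ m, v m = 0) :
    W *ᵥ v ⬝ᵥ W *ᵥ v ≤ σ₂ ^ 2 * (v ⬝ᵥ v) := by
  classical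
  -- For M ≤ 1 there is no eigenvalue with index 1 to appeal to, but a vector of mean zero vanishes.
  by_cases hM : M ≤ 1
  · have : v = 0 := by
      interval_cases M
      · exact Subsingleton.elim _ _
      · ext i
        have hi : i = 0 := Subsingleton.elim _ _
        simpa [hi] using hv
    simp [this]
  have hn : Module.finrank ℝ (EuclideanSpace ℝ (Fin M)) = M := by simp
  have hM0 : 0 < M := by omega
  set T := toEuclideanLin W with hT
  set b := T.isSymmetric_adjoint_comp_self.eigenvectorBasis hn with hb
  set ev := T.isSymmetric_adjoint_comp_self.eigenvalues hn with hev
  have hev0 : ∀ i, 0 ≤ ev i := T.isPositive_adjoint_comp_self.nonneg_eigenvalues hn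
  have hev1 : ∀ i : Fin M, i ≠ ⟨0, hM0⟩ → ev i ≤ σ₂ ^ 2 := by
    intro i hi
    have h2 : ev i ≤ ev ⟨1, by omega⟩ := by
      apply T.isSymmetric_adjoint_comp_self.eigenvalues_antitone hn
      rw [Fin.le_def]
      have : i.1 ≠ 0 := fun h => hi (Fin.ext h)
      simp only
      omega
    refine h2.trans ?_
    rw [hev, ← T.sq_singularValues_of_lt hn]
    exact pow_le_pow_left₀ (T.singularValues_nonneg 1) hW.second_le 2
  have hTT : ∀ x, inner ℝ (T x) (T x) = ∑ i, ev i * (b.repr x i) ^ 2 := by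
    intro x
    have e1 : inner ℝ (T x) (T x) = inner ℝ x ((T.adjoint ∘ₗ T) x) := by
      rw [LinearMap.comp_apply, LinearMap.adjoint_inner_right]
    rw [e1, ← b.repr.inner_map_map, PiLp.inner_apply]
    refine Finset.sum_congr rfl fun i _ => ?_
    rw [T.isSymmetric_adjoint_comp_self.eigenvectorBasis_apply_self_apply hn x i]
    simp only [RCLike.inner_apply, conj_trivial, RCLike.ofReal_real_eq_id, id]
    ring
  have hxx : ∀ x, inner ℝ x x = ∑ i, (b.repr x i) ^ 2 := by
    intro x
    rw [← b.repr.inner_map_map, PiLp.inner_apply]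
    refine Finset.sum_congr rfl fun i _ => ?_
    simp only [RCLike.inner_apply, conj_trivial]
    ring
  have hmain : ∀ x, b.repr x ⟨0, hM0⟩ = 0 → inner ℝ (T x) (T x) ≤ σ₂ ^ 2 * inner ℝ x x := by
    intro x hx
    rw [hTT, hxx, Finset.mul_sum]
    refine Finset.sum_le_sum fun i _ => ?_
    by_cases hi : i = ⟨0, hM0⟩
    · rw [hi, hx]; simp
    · exact mul_le_mul_of_nonneg_right (hev1 i hi) (sq_nonneg _)
  let one : EuclideanSpace ℝ (Fin M) := WithLp.toLp 2 (fun _ => 1)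
  let vv : EuclideanSpace ℝ (Fin M) := WithLp.toLp 2 v
  set p := b.repr vv ⟨0, hM0⟩ with hp
  set q := b.repr one ⟨0, hM0⟩ with hq
  -- The leading eigenvector of WᵀW is never identified with the constants. Instead a combination
  -- c·1 + d·v orthogonal to it is used; since W fixes 1 and preserves mean zero, the squared norms
  -- of the combination and of its image both split.
  have key : ∀ c d : ℝ, c * q + d * p = 0 →
      c ^ 2 * M + d ^ 2 * (W *ᵥ v ⬝ᵥ W *ᵥ v) ≤ σ₂ ^ 2 * (c ^ 2 * M + d ^ 2 * (v ⬝ᵥ v)) := by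
    intro c d hcd
    have h := hmain (c • one + d • vv) (by
      rw [map_add, map_smul, map_smul]
      simpa using hcd)
    rw [hT, toEuclideanLin_inner, EuclideanSpace.inner_eq_star_dotProduct] at h
    have e1 : (c • one + d • vv).ofLp = c • (fun _ => 1) + d • v := by
      ext i; simp [one, vv]
    have e2 : v ⬝ᵥ (fun _ => (1 : ℝ)) = 0 := by simpa [dotProduct] using hv
    have e3 : W *ᵥ v ⬝ᵥ (fun _ => (1 : ℝ)) = 0 := by
      have := hW.sum_mulVec v
      rw [hv] at this
      simpa [dotProduct] using this
    have e4 : (fun _ : Fin M => (1 : ℝ)) ⬝ᵥ (fun _ => (1 : ℝ)) = M := by simp [dotProduct]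
    rw [e1] at h
    simp only [mulVec_add, mulVec_smul, hW.mulVec_one, star_trivial, dotProduct_add,
      add_dotProduct, smul_dotProduct, dotProduct_smul, smul_eq_mul, e2, e3, e4,
      dotProduct_comm (fun _ : Fin M => (1 : ℝ)) v,
      dotProduct_comm (fun _ : Fin M => (1 : ℝ)) (W *ᵥ v)] at h
    linarith
  have hMpos : (0 : ℝ) < M := by exact_mod_cast hM0
  have hσ : σ₂ ^ 2 < 1 := by nlinarith
  -- If q = 0, the constants themselves would be contracted by σ₂ < 1, which is absurd. Otherwise c
  -- = −p, d = q is admissible, and the part along 1 can be dropped because σ₂² < 1.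
  by_cases hq0 : q = 0
  · have := key 1 0 (by rw [hq0]; ring)
    nlinarith
  · have h := key (-p) q (by ring)
    have h2 : 0 < q ^ 2 := by positivity
    have h3 : q ^ 2 * (W *ᵥ v ⬝ᵥ W *ᵥ v) ≤ q ^ 2 * (σ₂ ^ 2 * (v ⬝ᵥ v)) := by
      nlinarith [mul_nonneg (mul_nonneg (sq_nonneg p) hMpos.le) (sub_nonneg.2 hσ.le)]
    exact le_of_mul_le_mul_left h3 h2

theorem dotProduct_sq_le (v w : Fin M → ℝ) : (v ⬝ᵥ w) ^ 2 ≤ (v ⬝ᵥ v) * (w ⬝ᵥ w) := by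
  have := Finset.sum_mul_sq_le_sq_mul_sq Finset.univ v w
  simpa [dotProduct, sq] using this

/-- The spectral gap of `I - W` on the vectors of mean zero. -/
theorem IsGossip.gap (hW : IsGossip W σ₂) (h0 : 0 ≤ σ₂) (h1 : σ₂ < 1)
    {v : Fin M → ℝ} (hv : ∑ m, v m = 0) :
    (1 - σ₂) * (v ⬝ᵥ v) ≤ v ⬝ᵥ (1 - W) *ᵥ v := by
  have h2 := hW.mulVec_contracts h0 h1 hv
  have h3 := dotProduct_sq_le v (W *ᵥ v)
  have h4 : 0 ≤ v ⬝ᵥ v := dotProduct_self_nonneg v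
  have h5 : v ⬝ᵥ W *ᵥ v ≤ σ₂ * (v ⬝ᵥ v) := by
    refine abs_le_of_sq_le_sq' ?_ (by positivity) |>.2
    calc _ ≤ _ := h3
      _ ≤ (v ⬝ᵥ v) * (σ₂ ^ 2 * (v ⬝ᵥ v)) := by gcongr
      _ = _ := by ring
  rw [sub_mulVec, one_mulVec, dotProduct_sub]
  linarith

/-- The dual metric: a factor of the inverse of `I - W` on the vectors of mean zero. -/
theorem IsGossip.exists_dual_metric (hW : IsGossip W σ₂) (hM : 0 < M) (h0 : 0 ≤ σ₂)
    (h1 : σ₂ < 1) :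
    ∃ C : Matrix (Fin M) (Fin M) ℝ,
      (∀ ζ : Fin M → ℝ, ∑ m, ζ m = 0 → ∀ x, C *ᵥ ζ ⬝ᵥ C *ᵥ ((1 - W) *ᵥ x) = ζ ⬝ᵥ x) ∧
      (∀ ζ : Fin M → ℝ, ∑ m, ζ m = 0 → ζ ⬝ᵥ ζ ≤ 2 * (C *ᵥ ζ ⬝ᵥ C *ᵥ ζ)) ∧
      (∀ ζ : Fin M → ℝ, ∑ m, ζ m = 0 → (1 - σ₂) * (C *ᵥ ζ ⬝ᵥ C *ᵥ ζ) ≤ ζ ⬝ᵥ ζ) ∧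
      (∀ x : Fin M → ℝ, C *ᵥ ((1 - W) *ᵥ x) ⬝ᵥ C *ᵥ ((1 - W) *ᵥ x) ≤ 2 * (x ⬝ᵥ x)) := by
  classical
  have hMpos : (0 : ℝ) < M := by exact_mod_cast hM
  set Q : Matrix (Fin M) (Fin M) ℝ := 1 - W with hQ
  -- J projects onto the constants, the kernel of Q. Thus Q + J is invertible and its inverse acts
  -- as the pseudo-inverse of Q on vectors of mean zero.
  let J : Matrix (Fin M) (Fin M) ℝ := Matrix.of fun _ _ => 1 / (M : ℝ)
  have hJ : ∀ v : Fin M → ℝ, J *ᵥ v = fun _ => (1 / (M : ℝ)) * ∑ m, v m := by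
    intro v
    ext i
    simp [J, mulVec, dotProduct, Finset.mul_sum]
  have hQs : ∀ v : Fin M → ℝ, ∑ m, (Q *ᵥ v) m = 0 := by
    intro v
    simp only [hQ, sub_mulVec, one_mulVec, Pi.sub_apply, Finset.sum_sub_distrib, hW.sum_mulVec,
      sub_self]
  have hQsymm : ∀ v w : Fin M → ℝ, v ⬝ᵥ Q *ᵥ w = Q *ᵥ v ⬝ᵥ w := by
    intro v w
    simp only [hQ, sub_mulVec, one_mulVec, dotProduct_sub, sub_dotProduct,
      hW.dotProduct_mulVec_comm]
  have hQnn : ∀ v : Fin M → ℝ, 0 ≤ v ⬝ᵥ Q *ᵥ v := fun v => by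
    simpa using hW.le_one.dotProduct_mulVec_nonneg v
  have hA : (Q + J).PosDef := by
    refine PosDef.of_dotProduct_mulVec_pos ?_ ?_
    · refine hW.le_one.isHermitian.add ?_
      ext i j
      simp [J]
    · intro v hv
      rw [add_mulVec, dotProduct_add, hJ]
      have e : star v ⬝ᵥ (fun _ => (1 / (M : ℝ)) * ∑ m, v m) = (1 / (M : ℝ)) * (∑ m, v m) ^ 2 := by
        simp [dotProduct, ← Finset.sum_mul]
        ring
      rw [e, star_trivial]
      have h2 := hQnn v
      by_cases hs : ∑ m, v m = 0
      · have h3 := hW.gap h0 h1 hs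
        have h4 : 0 < v ⬝ᵥ v := by
          rcases (dotProduct_self_nonneg v).lt_or_eq with h | h
          · exact h
          · exact absurd (dotProduct_self_eq_zero.1 h.symm) hv
        have h5 : 0 < (1 - σ₂) * (v ⬝ᵥ v) := mul_pos (by linarith) h4
        rw [hs]
        simp only [← hQ] at h3
        linarith [show (1 / (M : ℝ)) * (0 : ℝ) ^ 2 = 0 by ring]
      · have : 0 < (1 / (M : ℝ)) * (∑ m, v m) ^ 2 := by positivity
        linarith
  have hAinv : ∀ v, (Q + J) *ᵥ ((Q + J)⁻¹ *ᵥ v) = v := by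
    intro v
    rw [mulVec_mulVec, Matrix.mul_nonsing_inv _ ((Matrix.isUnit_iff_isUnit_det _).1 hA.isUnit),
      one_mulVec]
  obtain ⟨C, hC⟩ : ∃ C : Matrix (Fin M) (Fin M) ℝ, (Q + J)⁻¹ = Cᴴ * C := by
    open scoped MatrixOrder Matrix.Norms.L2Operator in
    exact CStarAlgebra.nonneg_iff_eq_star_mul_self.mp hA.inv.posSemidef.nonneg
  have hCC : ∀ v w : Fin M → ℝ, C *ᵥ v ⬝ᵥ C *ᵥ w = (Q + J)⁻¹ *ᵥ v ⬝ᵥ w := by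
    intro v w
    rw [dotProduct_comm, dotProduct_comm _ w, hC, ← mulVec_mulVec, dotProduct_mulVec w,
      ← mulVec_transpose, conjTranspose_eq_transpose_of_trivial, transpose_transpose]
  have hw : ∀ ζ : Fin M → ℝ, ∑ m, ζ m = 0 →
      ∑ m, ((Q + J)⁻¹ *ᵥ ζ) m = 0 ∧ Q *ᵥ ((Q + J)⁻¹ *ᵥ ζ) = ζ := by
    intro ζ hζ
    have h2 := hAinv ζ
    rw [add_mulVec, hJ] at h2
    set w := (Q + J)⁻¹ *ᵥ ζ
    have h3 : ∑ m, w m = 0 := by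
      have h4 := congrArg (fun f : Fin M → ℝ => ∑ m, f m) h2
      simp only [Pi.add_apply, Finset.sum_add_distrib, hQs, hζ, Finset.sum_const,
        Finset.card_univ, Fintype.card_fin, nsmul_eq_mul, zero_add] at h4
      field_simp at h4
      exact h4
    refine ⟨h3, ?_⟩
    rw [h3, mul_zero] at h2
    ext i
    have := congrFun h2 i
    simpa using this
  have hi : ∀ ζ : Fin M → ℝ, ∑ m, ζ m = 0 → ∀ x, C *ᵥ ζ ⬝ᵥ C *ᵥ (Q *ᵥ x) = ζ ⬝ᵥ x := by
    intro ζ hζ x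
    rw [hCC, hQsymm, (hw ζ hζ).2]
  refine ⟨C, hi, ?_, ?_, ?_⟩
  · intro ζ hζ
    obtain ⟨h3, h4⟩ := hw ζ hζ
    rw [hCC]
    set w := (Q + J)⁻¹ *ᵥ ζ
    rw [← h4]
    have h5 := hW.mulVec_contracts h0 h1 h3
    have h6 : 0 ≤ w ⬝ᵥ w := dotProduct_self_nonneg w
    have h7 : σ₂ ^ 2 ≤ 1 := by nlinarith
    -- With ζ = Qw the claim reads ‖Qw‖² ≤ 2 w·Qw, which after expansion is ‖Ww‖ ≤ ‖w‖.
    have h8 : W *ᵥ w ⬝ᵥ W *ᵥ w ≤ w ⬝ᵥ w := by nlinarith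
    simp only [hQ, sub_mulVec, one_mulVec, dotProduct_sub, sub_dotProduct,
      dotProduct_comm (W *ᵥ w) w]
    linarith
  · intro ζ hζ
    obtain ⟨h3, h4⟩ := hw ζ hζ
    rw [hCC]
    set w := (Q + J)⁻¹ *ᵥ ζ
    have h5 := hW.gap h0 h1 h3
    rw [← hQ, h4] at h5
    have h6 := dotProduct_sq_le w ζ
    have h7 : 0 ≤ ζ ⬝ᵥ ζ := dotProduct_self_nonneg ζ
    have h9 : 0 ≤ w ⬝ᵥ w := dotProduct_self_nonneg w
    -- Here ‖Cζ‖² = w·ζ. The gap gives (1 − σ₂)‖w‖² ≤ w·ζ, and Cauchy–Schwarz gives (w·ζ)² ≤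
    -- ‖w‖²‖ζ‖²; dividing by w·ζ is possible unless it vanishes.
    rcases (le_trans (mul_nonneg (by linarith) h9) h5).lt_or_eq with h8 | h8
    · refine le_of_mul_le_mul_right ?_ h8
      nlinarith
    · rw [← h8]; simpa using h7
  · intro x
    rw [hi _ (hQs x)]
    have h2 : 0 ≤ x ⬝ᵥ (1 + W) *ᵥ x := by simpa using hW.neg_one_le.dotProduct_mulVec_nonneg x
    rw [← hQsymm]
    simp only [hQ, add_mulVec, sub_mulVec, one_mulVec, dotProduct_add, dotProduct_sub] at h2 ⊢
    linarith

variable {n : ℕ}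

/-- `(I - W) X`. -/
def laplacian (W : Matrix (Fin M) (Fin M) ℝ) (X : Fin M → Vec n) : Fin M → Vec n :=
  fun m => X m - ∑ j, W m j • X j

theorem sum_inner_eq_columns (X Y : Fin M → Vec n) :
    ∑ m, inner ℝ (X m) (Y m) = ∑ j, (fun m => X m j) ⬝ᵥ (fun m => Y m j) := by
  simp only [PiLp.inner_apply, RCLike.inner_apply, conj_trivial, dotProduct]
  rw [Finset.sum_comm]
  refine Finset.sum_congr rfl fun j _ => Finset.sum_congr rfl fun m _ => mul_comm _ _

/-- The dual metric on vectors of client variables. -/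
theorem IsGossip.exists_dual_map (hW : IsGossip W σ₂) (hM : 0 < M) (h0 : 0 ≤ σ₂)
    (h1 : σ₂ < 1) (n : ℕ) :
    ∃ N : (Fin M → Vec n) →ₗ[ℝ] PiLp 2 (fun _ : Fin M => Vec n),
      (∀ ζ : Fin M → Vec n, ∑ m, ζ m = 0 → ∀ X,
        inner ℝ (N ζ) (N (laplacian W X)) = ∑ m, inner ℝ (ζ m) (X m)) ∧
      (∀ ζ : Fin M → Vec n, ∑ m, ζ m = 0 → ∑ m, ‖ζ m‖ ^ 2 ≤ 2 * ‖N ζ‖ ^ 2) ∧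
      (∀ ζ : Fin M → Vec n, ∑ m, ζ m = 0 → (1 - σ₂) * ‖N ζ‖ ^ 2 ≤ ∑ m, ‖ζ m‖ ^ 2) ∧
      (∀ X : Fin M → Vec n, ‖N (laplacian W X)‖ ^ 2 ≤ 2 * ∑ m, ‖X m‖ ^ 2) := by
  obtain ⟨C, hC1, hC2, hC3, hC4⟩ := hW.exists_dual_metric hM h0 h1
  let N : (Fin M → Vec n) →ₗ[ℝ] PiLp 2 (fun _ : Fin M => Vec n) :=
    { toFun := fun ζ => WithLp.toLp 2 fun m => ∑ k, C m k • ζ k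
      map_add' := fun a b => by
        ext m : 1
        simp [Finset.sum_add_distrib]
      map_smul' := fun c a => by
        ext m : 1
        simp [Finset.smul_sum, smul_comm c] }
  have hin : ∀ X Y : Fin M → Vec n, inner ℝ (N X) (N Y)
      = ∑ j, C *ᵥ (fun m => X m j) ⬝ᵥ C *ᵥ (fun m => Y m j) := by
    intro X Y
    rw [PiLp.inner_apply, sum_inner_eq_columns]
    refine Finset.sum_congr rfl fun j _ => ?_
    congr 1 <;> ext m <;> simp [N, mulVec, dotProduct]
  have hl : ∀ (X : Fin M → Vec n) (j : Fin n),
      (fun m => laplacian W X m j) = (1 - W) *ᵥ (fun m => X m j) := by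
    intro X j
    ext m
    rw [sub_mulVec, one_mulVec]
    simp [laplacian, mulVec, dotProduct]
  have hz : ∀ ζ : Fin M → Vec n, ∑ m, ζ m = 0 → ∀ j, ∑ m, ζ m j = 0 := by
    intro ζ hζ j
    have := congrArg (fun v : Vec n => v j) hζ
    simpa using this
  have hsq : ∀ X : Fin M → Vec n,
      ∑ m, ‖X m‖ ^ 2 = ∑ j, (fun m => X m j) ⬝ᵥ (fun m => X m j) := by
    intro X
    rw [← sum_inner_eq_columns]
    simp
  refine ⟨N, ?_, ?_, ?_, ?_⟩
  · intro ζ hζ X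
    rw [hin, sum_inner_eq_columns]
    refine Finset.sum_congr rfl fun j _ => ?_
    rw [hl, hC1 _ (hz ζ hζ j)]
  · intro ζ hζ
    rw [← real_inner_self_eq_norm_sq, hin, hsq, Finset.mul_sum]
    exact Finset.sum_le_sum fun j _ => hC2 _ (hz ζ hζ j)
  · intro ζ hζ
    rw [← real_inner_self_eq_norm_sq, hin, hsq, Finset.mul_sum]
    exact Finset.sum_le_sum fun j _ => hC3 _ (hz ζ hζ j)
  · intro X
    rw [← real_inner_self_eq_norm_sq, hin, hsq, Finset.mul_sum]
    refine Finset.sum_le_sum fun j _ => ?_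
    rw [hl]
    exact hC4 _

theorem IsGossip.sum_laplacian (hW : IsGossip W σ₂) (X : Fin M → Vec n) :
    ∑ m, laplacian W X m = 0 := by
  ext j
  have h := hW.sum_mulVec (fun m => X m j)
  simp only [mulVec, dotProduct] at h
  simp only [laplacian, WithLp.ofLp_sum, WithLp.ofLp_sub, WithLp.ofLp_smul, Finset.sum_apply,
    Pi.sub_apply, Pi.smul_apply, Finset.sum_sub_distrib, smul_eq_mul, h, sub_self]
  simp

theorem IsGossip.laplacian_const (hW : IsGossip W σ₂) (x : Vec n) :
    laplacian W (fun _ => x) = 0 := by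
  ext m : 1
  have h : ∑ j, W m j = 1 := by
    have := congrFun hW.mulVec_one m
    simpa [mulVec, dotProduct] using this
  simp [laplacian, ← Finset.sum_smul, h]

end Gossip

end DecOpt

namespace DecOpt

/-! ### Accelerated gradient steps with inexact gradients -/

/-- Nesterov's potential argument with a gradient error e. The step is half of 1/ℓ and the rate θ/2
half of the usual θ; the two reserves absorb e through Young's inequality. The inequalities on φ are
assumed only at the points that occur, because the dual function lives on dual variables of mean
zero and not on all of `E`. -/
theorem accelerated_step {E : Type*} [NormedAddCommGroup E] [InnerProductSpace ℝ E]
    {θ τ μ ℓ : ℝ} (hθ : 0 < θ) (hθ1 : θ ≤ 1) (hμ : 0 < μ) (hθτ : θ ^ 2 = μ * τ)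
    (hℓ : 2 * ℓ * τ = 1) {x v y x' v' xs d e : E} (hy : (1 + θ) • y = x + θ • v)
    (hx' : x' = y - τ • (d + e)) (hv' : θ • v' = θ • x + (x' - x)) {φx φy φx' φs : ℝ}
    (h1 : φx' ≤ φy + inner ℝ d (x' - y) + ℓ / 2 * ‖x' - y‖ ^ 2)
    (h2 : φy + inner ℝ d (x - y) ≤ φx)
    (h3 : φy + inner ℝ d (xs - y) + μ / 2 * ‖xs - y‖ ^ 2 ≤ φs)
    (h4 : μ / 2 * ‖x - xs‖ ^ 2 ≤ φx - φs) :
    φx' - φs + μ / 2 * ‖v' - xs‖ ^ 2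
      ≤ (1 - θ / 2) * (φx - φs + μ / 2 * ‖v - xs‖ ^ 2) + 2 * θ / μ * ‖e‖ ^ 2 := by
  -- All differences that occur are combinations of p, r, g and e, so the claim becomes an
  -- inequality between their inner products.
  obtain ⟨p, hp⟩ : ∃ p, p = y - xs := ⟨_, rfl⟩
  obtain ⟨r, hr⟩ : ∃ r, r = v - y := ⟨_, rfl⟩
  obtain ⟨g, hg⟩ : ∃ g, g = d + e := ⟨_, rfl⟩
  have hxe : x = (1 + θ) • y - θ • v := by rw [hy]; abel
  have hd : d = g - e := by rw [hg]; abel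
  have e1 : x - y = -(θ • r) := by rw [hxe, hr]; module
  have e2 : x - xs = p - θ • r := by rw [hxe, hr, hp]; module
  have e3 : v - xs = p + r := by rw [hr, hp]; abel
  have e4 : x' - y = -(τ • g) := by rw [hx', hg]; module
  have e5 : xs - y = -p := by rw [hp]; abel
  have e6 : v' - xs = p + (1 - θ) • r - (τ / θ) • g := by
    have : v' = (1 / θ) • (θ • v') := by rw [smul_smul]; field_simp; simp
    rw [this, hv', hx', hxe, hr, hp, ← hg]
    have h5 : (1 / θ) • (θ • ((1 + θ) • y - θ • v) + (y - τ • g - ((1 + θ) • y - θ • v)))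
        = (1 / θ * θ) • ((1 + θ) • y - θ • v) + (1 / θ) • (y - (1 + θ) • y)
          + (1 / θ * θ) • v - (1 / θ * τ) • g := by module
    have h6 : 1 / θ * θ = 1 := by field_simp
    have h7 : (1 / θ) • (y - (1 + θ) • y) = -y := by
      have : y - (1 + θ) • y = -(θ • y) := by module
      rw [this, smul_neg, smul_smul, h6, one_smul]
    rw [h5, h6, h7, one_div_mul_eq_div]
    module
  have hτ : 0 < τ := by
    have : 0 < μ * τ := by rw [← hθτ]; positivity
    exact pos_of_mul_pos_right this hμ.le
  have hτθ : μ * (τ / θ) = θ := by field_simp; linarith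
  have hτθ2 : μ * (τ / θ) ^ 2 = τ := by
    rw [sq, ← mul_assoc, hτθ]; field_simp
  have hτe : τ ≤ θ / μ := by
    rw [le_div_iff₀ hμ, mul_comm, ← hθτ]; nlinarith
  rw [e4, hd] at h1
  rw [e1, hd] at h2
  rw [e5, hd] at h3
  rw [e2] at h4
  rw [e6, e3]
  -- Two squares for Young's inequality: the first pairs e with the displacement of v', the second
  -- pairs e with the inexact gradient g.
  have young : 0 ≤ ‖(2 / μ) • e + (p + (1 - θ) • r)‖ ^ 2 := sq_nonneg _
  have young2 : 0 ≤ ‖(1 / 2 : ℝ) • g - e‖ ^ 2 := sq_nonneg _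
  have hw : 0 ≤ ‖(p + r) - (p - θ • r)‖ ^ 2 := sq_nonneg _
  -- The remainder of the first Young inequality is charged to ‖v − xs‖², through the unused half of
  -- the rate, and to ‖x − xs‖², through quadratic growth `h4`.
  have hw2 : ‖p + (1 - θ) • r‖ ^ 2 ≤ ‖p + r‖ ^ 2 + ‖p - θ • r‖ ^ 2 := by
    have : 0 ≤ ‖p‖ ^ 2 := sq_nonneg _
    have h8 : 0 ≤ ‖r‖ ^ 2 := sq_nonneg _
    rw [norm_add_sq_real, norm_add_sq_real, norm_sub_sq_real, norm_smul, norm_smul,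
      inner_smul_right, inner_smul_right, mul_pow, mul_pow, Real.norm_eq_abs, Real.norm_eq_abs,
      sq_abs, sq_abs]
    nlinarith [mul_nonneg hθ.le h8]
  have hee : 0 ≤ ‖e‖ ^ 2 := sq_nonneg _
  simp only [norm_neg, norm_smul, mul_pow, Real.norm_eq_abs, sq_abs, inner_neg_right,
    inner_sub_left, inner_smul_right, norm_add_sq_real, norm_sub_sq_real, inner_add_left,
    inner_add_right, inner_smul_left, conj_trivial, real_inner_comm g p, real_inner_comm g r,
    real_inner_comm e g, real_inner_self_eq_norm_sq] at h1 h2 h3 h4 young young2 hw2 ⊢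
  have hrr : 0 ≤ ‖r‖ ^ 2 := sq_nonneg _
  generalize ‖p‖ ^ 2 = pp at *
  generalize ‖r‖ ^ 2 = rr at *
  generalize ‖g‖ ^ 2 = gg at *
  generalize ‖e‖ ^ 2 = ee at *
  generalize inner ℝ g p = gp at *
  generalize inner ℝ g r = gr at *
  generalize inner ℝ e p = ep at *
  generalize inner ℝ e r = er at *
  generalize inner ℝ e g = ge at *
  generalize inner ℝ p r = pr at *
  obtain ⟨T, hT⟩ : ∃ T, T = τ / θ := ⟨_, rfl⟩
  obtain ⟨i, hi⟩ : ∃ i, i = 1 / μ := ⟨_, rfl⟩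
  have hμi : μ * i = 1 := by rw [hi]; field_simp
  have hdiv : ∀ a : ℝ, a / μ = a * i := fun a => by rw [hi]; ring
  rw [hdiv] at hτe
  simp only [hdiv, ← hT] at *
  have k2 := mul_le_mul_of_nonneg_left h2 (sub_nonneg.2 hθ1)
  have k3 := mul_le_mul_of_nonneg_left h3 hθ.le
  have k4 := mul_le_mul_of_nonneg_left h4 hθ.le
  have k5 := mul_nonneg (mul_nonneg hθ.le hμ.le) young
  have k6 := mul_nonneg hτ.le young2
  have k7 := mul_le_mul_of_nonneg_left hw2 (mul_nonneg hθ.le hμ.le)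
  have k8 := mul_nonneg (mul_nonneg (mul_nonneg hθ.le hμ.le) (sub_nonneg.2 hθ1)) hrr
  have k9 := mul_le_mul_of_nonneg_right hτe hee
  linear_combination h1 + k2 + k3 + k4 / 2 + k5 / 4 + k6 + k7 / 4 + k8 / 2 + k9
    + (gp + gr * (1 - θ)) * (-1) * hτθ + gg / 2 * hτθ2 + τ * gg / 4 * hℓ
    + (θ * (ep + (1 - θ) * er) + θ * ee * i) * hμi

/-! ### The dual problem of the inner algorithm -/

section Dual
variable {M n : ℕ} {L : ℝ} {F : Fin M → Vec n → ℝ}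

/-- The minimizers of `Fₘ + L ‖· - yₘ‖² + ⟨Zₘ, ·⟩`. -/
noncomputable def dualPoint (L : ℝ) (F : Fin M → Vec n → ℝ) (y Z : Fin M → Vec n) : Fin M → Vec n :=
  fun m => resolvent L (F m) ((2 * L) • y m - Z m)

/-- The dual function (up to sign). -/
noncomputable def dualFun (L : ℝ) (F : Fin M → Vec n → ℝ) (y Z : Fin M → Vec n) : ℝ :=
  -∑ m, (F m (dualPoint L F y Z m) + L * ‖dualPoint L F y Z m - y m‖ ^ 2
    + inner ℝ (Z m) (dualPoint L F y Z m))

theorem dualPoint_eq (hL : 0 < L) (hF : ∀ m, SmoothWith L (F m)) (y Z : Fin M → Vec n)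
    (m : Fin M) : gradient (F m) (dualPoint L F y Z m) + (2 * L) • (dualPoint L F y Z m - y m)
      = -Z m := by
  have := (hF m).resolvent_eq hL ((2 * L) • y m - Z m)
  rw [dualPoint, smul_sub, ← add_sub_assoc, this]
  abel

theorem norm_dualPoint_sub_le (hL : 0 < L) (hF : ∀ m, SmoothWith L (F m))
    (y Z Z' : Fin M → Vec n) (m : Fin M) :
    L * ‖dualPoint L F y Z' m - dualPoint L F y Z m‖ ≤ ‖Z' m - Z m‖ := by
  refine ((hF m).norm_resolvent_sub_le hL _ _).trans_eq ?_
  rw [sub_sub_sub_cancel_left, norm_sub_rev]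

theorem sum_dualPoint_sub_sq_le (hL : 0 < L) (hF : ∀ m, SmoothWith L (F m))
    (y Z Z' : Fin M → Vec n) :
    L ^ 2 * ∑ m, ‖dualPoint L F y Z' m - dualPoint L F y Z m‖ ^ 2 ≤ ∑ m, ‖Z' m - Z m‖ ^ 2 := by
  rw [Finset.mul_sum]
  refine Finset.sum_le_sum fun m _ => ?_
  rw [← mul_pow]
  exact pow_le_pow_left₀ (by positivity) (norm_dualPoint_sub_le hL hF y Z Z' m) 2

/-- Conjugate duality: the dual Bregman distance from Z to Z' is the primal one from X' to X, which
lies between L/2 and 3L/2 times ‖X − X'‖². The resolvent satisfies L‖X − X'‖ ≤ ‖Z − Z'‖ ≤ 3L‖X −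
X'‖, whence 1/(18L) and 3/(2L). -/
theorem dual_bregman (hL : 0 < L) (hF : ∀ m, SmoothWith L (F m)) (y Z Z' : Fin M → Vec n) :
    1 / (18 * L) * ∑ m, ‖Z' m - Z m‖ ^ 2 ≤ dualFun L F y Z' - dualFun L F y Z
        + ∑ m, inner ℝ (dualPoint L F y Z m) (Z' m - Z m) ∧
      dualFun L F y Z' - dualFun L F y Z + ∑ m, inner ℝ (dualPoint L F y Z m) (Z' m - Z m)
        ≤ 3 / (2 * L) * ∑ m, ‖Z' m - Z m‖ ^ 2 := by
  set X := dualPoint L F y Z with hX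
  set X' := dualPoint L F y Z' with hX'
  have key : ∀ m, 1 / (18 * L) * ‖Z' m - Z m‖ ^ 2
        ≤ F m (X m) + L * ‖X m - y m‖ ^ 2 + inner ℝ (Z m) (X m)
          - (F m (X' m) + L * ‖X' m - y m‖ ^ 2 + inner ℝ (Z' m) (X' m))
          + inner ℝ (X m) (Z' m - Z m) ∧
      F m (X m) + L * ‖X m - y m‖ ^ 2 + inner ℝ (Z m) (X m)
          - (F m (X' m) + L * ‖X' m - y m‖ ^ 2 + inner ℝ (Z' m) (X' m))
          + inner ℝ (X m) (Z' m - Z m) ≤ 3 / (2 * L) * ‖Z' m - Z m‖ ^ 2 := by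
    intro m
    obtain ⟨h1, h2⟩ := (hF m).regularized_bregman (y m) (X' m) (X m)
    rw [dualPoint_eq hL hF y Z' m] at h1 h2
    have h3 : ‖Z' m - Z m‖ ≤ 3 * L * ‖X m - X' m‖ := by
      have := (hF m).norm_le_resolvent_sub hL ((2 * L) • y m - Z m) ((2 * L) • y m - Z' m)
      rwa [sub_sub_sub_cancel_left] at this
    have h4 : L * ‖X m - X' m‖ ≤ ‖Z' m - Z m‖ := by
      rw [norm_sub_rev]
      exact norm_dualPoint_sub_le hL hF y Z Z' m
    have h5 := pow_le_pow_left₀ (norm_nonneg _) h3 2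
    have h6 := pow_le_pow_left₀ (by positivity) h4 2
    have e1 : F m (X m) + L * ‖X m - y m‖ ^ 2 + inner ℝ (Z m) (X m)
          - (F m (X' m) + L * ‖X' m - y m‖ ^ 2 + inner ℝ (Z' m) (X' m))
          + inner ℝ (X m) (Z' m - Z m)
        = F m (X m) + L * ‖X m - y m‖ ^ 2 - (F m (X' m) + L * ‖X' m - y m‖ ^ 2)
          - inner ℝ (-Z' m) (X m - X' m) := by
      rw [inner_sub_right, inner_sub_right, inner_neg_left, inner_neg_left,
        real_inner_comm (X m) (Z m), real_inner_comm (X m) (Z' m)]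
      ring
    rw [e1]
    constructor
    · refine le_trans ?_ h1
      rw [div_mul_eq_mul_div, one_mul, div_le_iff₀ (by positivity)]
      nlinarith
    · refine h2.trans ?_
      rw [div_mul_eq_mul_div (3 : ℝ) (2 * L), le_div_iff₀ (by positivity)]
      nlinarith
  have e2 : dualFun L F y Z' - dualFun L F y Z + ∑ m, inner ℝ (X m) (Z' m - Z m)
      = ∑ m, (F m (X m) + L * ‖X m - y m‖ ^ 2 + inner ℝ (Z m) (X m)
          - (F m (X' m) + L * ‖X' m - y m‖ ^ 2 + inner ℝ (Z' m) (X' m))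
          + inner ℝ (X m) (Z' m - Z m)) := by
    rw [Finset.sum_add_distrib, Finset.sum_sub_distrib, dualFun, dualFun, ← hX, ← hX']
    ring
  rw [e2, Finset.mul_sum, Finset.mul_sum]
  exact ⟨Finset.sum_le_sum fun m _ => (key m).1, Finset.sum_le_sum fun m _ => (key m).2⟩

theorem sq_le_of_convex_comb {θ a b c K : ℝ} (hθ : 0 ≤ θ) (hc : 0 ≤ c)
    (h : (1 + θ) * c ≤ a + θ * b) (ha : a ^ 2 ≤ K) (hb : b ^ 2 ≤ K) : c ^ 2 ≤ K := by
  have h1 : ((1 + θ) * c) ^ 2 ≤ (1 + θ) * (a ^ 2 + θ * b ^ 2) := by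
    refine (pow_le_pow_left₀ (by positivity) h 2).trans ?_
    nlinarith [mul_nonneg hθ (sq_nonneg (a - b))]
  have h2 : (1 + θ) ^ 2 * c ^ 2 ≤ (1 + θ) ^ 2 * K := by
    rw [mul_pow] at h1
    have h3 : (1 + θ) * (a ^ 2 + θ * b ^ 2) ≤ (1 + θ) * (K + θ * K) := by gcongr
    linarith
  exact le_of_mul_le_mul_left h2 (by positivity)

/-- The potential function of the accelerated dual ascent: `V` decreases geometrically up to the
errors of the approximate primal solutions, and it controls the distance of the extrapolated dual
variables to the dual solution. -/
theorem exists_dual_potential {W : Matrix (Fin M) (Fin M) ℝ} {σ₂ θ τ : ℝ} (hM : 0 < M) (hL : 0 < L)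
    (hF : ∀ m, SmoothWith L (F m)) (hW : IsGossip W σ₂) (h0 : 0 ≤ σ₂) (h1 : σ₂ < 1)
    (hθ : 0 < θ) (hθ2 : 108 * θ ^ 2 = 1 - σ₂) (hτ : τ = L / 12)
    (y : Fin M → Vec n) (z : Vec n)
    (hz : ∑ m, (gradient (F m) z + (2 * L) • (z - y m)) = 0)
    {Z Zt x : ℕ → Fin M → Vec n} (hZ0 : Z 0 = 0) (hZt0 : Zt 0 = 0)
    (hZ : ∀ t, Z (t + 1) = Zt t + τ • laplacian W (x (t + 1)))
    (hZt : ∀ t, Zt (t + 1) = Z (t + 1) + ((1 - θ) / (1 + θ)) • (Z (t + 1) - Z t)) :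
    ∃ V : ℕ → ℝ, (∀ t, 0 ≤ V t) ∧
      V 0 ≤ 4 / (L * (1 - σ₂)) * ∑ m, ‖gradient (F m) z + (2 * L) • (z - y m)‖ ^ 2 ∧
      (∀ t, V (t + 1) ≤ (1 - θ / 2) * V t
        + 36 * θ * L / (1 - σ₂) * ∑ m, ‖x (t + 1) m - dualPoint L F y (Zt t) m‖ ^ 2) ∧
      ∀ t, ∑ m, ‖Zt t m - -(gradient (F m) z + (2 * L) • (z - y m))‖ ^ 2
        ≤ 36 * L / (1 - σ₂) * V t := by
  obtain ⟨N, hN1, hN2, hN3, hN4⟩ := hW.exists_dual_map hM h0 h1 n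
  obtain ⟨s, hs⟩ : ∃ s, s = 1 - σ₂ := ⟨_, rfl⟩
  have hspos : 0 < s := by rw [hs]; linarith
  have hs1 : s ≤ 1 := by rw [hs]; linarith
  rw [← hs] at hθ2 hN3 ⊢
  -- The optimal multiplier: for Zs all local minimizers coincide with z, so the Laplacian of the
  -- primal points, and with it the dual gradient, vanishes.
  set Zs : Fin M → Vec n := fun m => -(gradient (F m) z + (2 * L) • (z - y m)) with hZs
  have hZs0 : ∑ m, Zs m = 0 := by
    rw [hZs, Finset.sum_neg_distrib, hz, neg_zero]
  have hXs : dualPoint L F y Zs = fun _ => z := by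
    ext1 m
    refine (hF m).resolvent_of_eq hL ?_
    simp only [hZs]
    module
  have hZt_sum : ∀ t, ∑ m, Z t m = 0 ∧ ∑ m, Zt t m = 0 := by
    intro t
    induction t with
    | zero => simp [hZ0, hZt0]
    | succ t ih =>
      have h2 : ∑ m, Z (t + 1) m = 0 := by
        simp only [hZ, Pi.add_apply, Pi.smul_apply, Finset.sum_add_distrib, ← Finset.smul_sum,
          hW.sum_laplacian, ih.2, smul_zero, add_zero]
      refine ⟨h2, ?_⟩
      simp only [hZt, Pi.add_apply, Pi.sub_apply, Pi.smul_apply, Finset.sum_add_distrib,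
        ← Finset.smul_sum, Finset.sum_sub_distrib, h2, ih.1, sub_zero, smul_zero, add_zero]
  have hθ1 : θ ≤ 1 := by nlinarith
  set φ := dualFun L F y with hφ
  -- The gradient of the negative dual function in the metric of N. In that metric the strong
  -- convexity constant is s/(9L) by `hN3` and the smoothness constant is 6/L by `hN2`.
  set d : (Fin M → Vec n) → PiLp 2 (fun _ : Fin M => Vec n) :=
    fun A => -N (laplacian W (dualPoint L F y A)) with hd
  have hinner : ∀ A B : Fin M → Vec n, ∑ m, A m = 0 → ∑ m, B m = 0 →
      inner ℝ (d A) (N B - N A) = -∑ m, inner ℝ (dualPoint L F y A m) (B m - A m) := by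
    intro A B hA hB
    rw [hd, inner_neg_left, ← map_sub, real_inner_comm, hN1 _ (by simp [hA, hB])]
    simp only [Pi.sub_apply, real_inner_comm]
  have hdiff : ∀ A B : Fin M → Vec n, ∑ m, A m = 0 → ∑ m, B m = 0 → ∑ m, (B - A) m = 0 := by
    intro A B hA hB
    simp [hA, hB]
  have hlow : ∀ A B : Fin M → Vec n, ∑ m, A m = 0 → ∑ m, B m = 0 →
      φ A + inner ℝ (d A) (N B - N A) + s / (9 * L) / 2 * ‖N B - N A‖ ^ 2 ≤ φ B := by
    intro A B hA hB
    have h2 := (dual_bregman hL hF y A B).1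
    have h3 := hN3 _ (hdiff A B hA hB)
    simp only [Pi.sub_apply, map_sub] at h3
    have h4 : s / (9 * L) / 2 * ‖N B - N A‖ ^ 2 ≤ 1 / (18 * L) * ∑ m, ‖B m - A m‖ ^ 2 := by
      calc _ = 1 / (18 * L) * (s * ‖N B - N A‖ ^ 2) := by field_simp; ring
        _ ≤ _ := by gcongr
    rw [hinner A B hA hB]
    linarith
  have hup : ∀ A B : Fin M → Vec n, ∑ m, A m = 0 → ∑ m, B m = 0 →
      φ B ≤ φ A + inner ℝ (d A) (N B - N A) + 6 / L / 2 * ‖N B - N A‖ ^ 2 := by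
    intro A B hA hB
    have h2 := (dual_bregman hL hF y A B).2
    have h3 := hN2 _ (hdiff A B hA hB)
    simp only [Pi.sub_apply, map_sub] at h3
    have h4 : 3 / (2 * L) * ∑ m, ‖B m - A m‖ ^ 2 ≤ 6 / L / 2 * ‖N B - N A‖ ^ 2 := by
      calc _ ≤ 3 / (2 * L) * (2 * ‖N B - N A‖ ^ 2) := by gcongr
        _ = _ := by field_simp; ring
    rw [hinner A B hA hB]
    linarith
  have hds : d Zs = 0 := by
    simp only [hd, hXs, hW.laplacian_const, map_zero, neg_zero]
  have hqg : ∀ A : Fin M → Vec n, ∑ m, A m = 0 →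
      s / (9 * L) / 2 * ‖N A - N Zs‖ ^ 2 ≤ φ A - φ Zs := by
    intro A hA
    have := hlow Zs A hZs0 hA
    rw [hds, inner_zero_left] at this
    linarith
  -- The auxiliary sequence of the accelerated method, recovered from consecutive Z. Its value 0 at
  -- time 0 equals N (Z 0), so the extrapolation rule `hy` holds from the start.
  let v : ℕ → PiLp 2 (fun _ : Fin M => Vec n) := fun t =>
    Nat.casesOn t 0 fun t => N (Z t) + (1 / θ) • (N (Z (t + 1)) - N (Z t))
  have hv : ∀ t, θ • v (t + 1) = θ • N (Z t) + (N (Z (t + 1)) - N (Z t)) := by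
    intro t
    simp only [v, smul_add, smul_smul, mul_one_div_cancel hθ.ne', one_smul]
  have hy : ∀ t, (1 + θ) • N (Zt t) = N (Z t) + θ • v t := by
    intro t
    cases t with
    | zero => simp [v, hZ0, hZt0]
    | succ t =>
      rw [hv, hZt, map_add, map_smul, map_sub, smul_add, smul_smul,
        mul_div_cancel₀ _ (by positivity : (1 + θ) ≠ 0)]
      module
  have hμ : 0 < s / (9 * L) := by positivity
  have hdist : ∀ t, ‖v t - N Zs‖ ^ 2 ≤ 2 / (s / (9 * L)) *
      (φ (Z t) - φ Zs + s / (9 * L) / 2 * ‖v t - N Zs‖ ^ 2) := by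
    intro t
    have := hqg (Z t) (hZt_sum t).1
    rw [div_mul_eq_mul_div, le_div_iff₀ hμ]
    nlinarith [sq_nonneg ‖N (Z t) - N Zs‖]
  refine ⟨fun t => φ (Z t) - φ Zs + s / (9 * L) / 2 * ‖v t - N Zs‖ ^ 2, ?_, ?_, ?_, ?_⟩
  · intro t
    have := hqg (Z t) (hZt_sum t).1
    have h2 : 0 ≤ s / (9 * L) / 2 * ‖N (Z t) - N Zs‖ ^ 2 := by positivity
    have h3 : 0 ≤ s / (9 * L) / 2 * ‖v t - N Zs‖ ^ 2 := by positivity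
    simp only
    linarith
  · have h2 := hup Zs 0 hZs0 (by simp)
    have h3 := hN3 Zs hZs0
    rw [hds, inner_zero_left, map_zero, zero_sub, norm_neg] at h2
    have e1 : ∑ m, ‖gradient (F m) z + (2 * L) • (z - y m)‖ ^ 2 = ∑ m, ‖Zs m‖ ^ 2 := by
      simp only [hZs, norm_neg]
    have e2 : v 0 = 0 := rfl
    simp only [hZ0, e1, e2, zero_sub, norm_neg]
    have h4 : ‖N Zs‖ ^ 2 ≤ (∑ m, ‖Zs m‖ ^ 2) / s := by
      rw [le_div_iff₀ hspos]; linarith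
    calc φ 0 - φ Zs + s / (9 * L) / 2 * ‖N Zs‖ ^ 2
        ≤ 6 / L / 2 * ‖N Zs‖ ^ 2 + s / (9 * L) / 2 * ‖N Zs‖ ^ 2 := by linarith
      _ ≤ 6 / L / 2 * ‖N Zs‖ ^ 2 + 1 / (9 * L) / 2 * ‖N Zs‖ ^ 2 := by gcongr
      _ = (55 / 18) / L * ‖N Zs‖ ^ 2 := by field_simp; ring
      _ ≤ 4 / L * ((∑ m, ‖Zs m‖ ^ 2) / s) := by gcongr; norm_num
      _ = _ := by field_simp
  · intro t
    set e : PiLp 2 (fun _ : Fin M => Vec n) :=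
      -N (laplacian W (x (t + 1) - dualPoint L F y (Zt t))) with he
    have hx' : N (Z (t + 1)) = N (Zt t) - τ • (d (Zt t) + e) := by
      have hl : laplacian W (x (t + 1) - dualPoint L F y (Zt t))
          = laplacian W (x (t + 1)) - laplacian W (dualPoint L F y (Zt t)) := by
        ext1 m
        simp only [laplacian, Pi.sub_apply, smul_sub, Finset.sum_sub_distrib]
        abel
      rw [he, hd, hl, hZ, map_add, map_smul, map_sub]
      module
    -- With ℓ = 6/L the condition 2ℓτ = 1 forces τ = L/12, and then θ² = μτ = s/108; this is the
    -- origin of both constants.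
    have hst := accelerated_step (μ := s / (9 * L)) (ℓ := 6 / L) (τ := τ) hθ hθ1 hμ
      (by rw [hτ]; field_simp; linarith) (by rw [hτ]; field_simp; norm_num)
      (hy t) hx' (hv t) (hup _ _ (hZt_sum t).2 (hZt_sum (t + 1)).1)
      (by
        have := hlow _ _ (hZt_sum t).2 (hZt_sum t).1
        have h2 : 0 ≤ s / (9 * L) / 2 * ‖N (Z t) - N (Zt t)‖ ^ 2 := by positivity
        linarith)
      (hlow _ _ (hZt_sum t).2 hZs0) (hqg _ (hZt_sum t).1)
    refine hst.trans ?_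
    have h2 : ‖e‖ ^ 2 ≤ 2 * ∑ m, ‖x (t + 1) m - dualPoint L F y (Zt t) m‖ ^ 2 := by
      rw [he, norm_neg]
      exact hN4 _
    have h3 : 2 * θ / (s / (9 * L)) * ‖e‖ ^ 2
        ≤ 2 * θ / (s / (9 * L)) * (2 * ∑ m, ‖x (t + 1) m - dualPoint L F y (Zt t) m‖ ^ 2) := by
      gcongr
    refine add_le_add le_rfl (h3.trans_eq ?_)
    field_simp
    ring
  · intro t
    have h2 := hN2 _ (hdiff Zs (Zt t) hZs0 (hZt_sum t).2)
    simp only [Pi.sub_apply, map_sub] at h2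
    refine h2.trans ?_
    -- Zt is the average of Z and v with weights 1 and θ, and the potential controls the distances
    -- of both to Zs.
    have h3 : ‖N (Zt t) - N Zs‖ ^ 2
        ≤ 2 / (s / (9 * L)) * (φ (Z t) - φ Zs + s / (9 * L) / 2 * ‖v t - N Zs‖ ^ 2) := by
      have h4 := hqg (Z t) (hZt_sum t).1
      have e1 : (1 + θ) • (N (Zt t) - N Zs) = (N (Z t) - N Zs) + θ • (v t - N Zs) := by
        rw [smul_sub, hy]; module
      have h6 : (1 + θ) * ‖N (Zt t) - N Zs‖ ≤ ‖N (Z t) - N Zs‖ + θ * ‖v t - N Zs‖ := by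
        have := norm_add_le (N (Z t) - N Zs) (θ • (v t - N Zs))
        rwa [← e1, norm_smul, norm_smul, Real.norm_of_nonneg (by positivity),
          Real.norm_of_nonneg hθ.le] at this
      refine sq_le_of_convex_comb hθ.le (norm_nonneg _) h6 ?_ (hdist t)
      rw [div_mul_eq_mul_div, le_div_iff₀ hμ]
      have h7 : 0 ≤ s / (9 * L) / 2 * ‖v t - N Zs‖ ^ 2 := by positivity
      linarith
    calc _ ≤ _ := mul_le_mul_of_nonneg_left h3 zero_le_two
      _ = _ := by field_simp; ring

end Dual

end DecOpt

namespace DecOpt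

/-! ### Upper bounds of expectations -/

section UpperMean
variable {Ω : Type*} [MeasurableSpace Ω] {P : Measure Ω} {f f' : Ω → ℝ} {c c' : ℝ}

/-- `f` is bounded by a measurable function of mean at most `c`. -/
def UpperMean (P : Measure Ω) (f : Ω → ℝ) (c : ℝ) : Prop :=
  ∃ g : Ω → ENNReal, Measurable g ∧ (∀ ω, ENNReal.ofReal (f ω) ≤ g ω) ∧
    ∫⁻ ω, g ω ∂P ≤ ENNReal.ofReal c

theorem UpperMean.mono (h : UpperMean P f c) (hf : ∀ ω, f' ω ≤ f ω) (hc : c ≤ c') :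
    UpperMean P f' c' := by
  obtain ⟨g, hg, hfg, hgc⟩ := h
  exact ⟨g, hg, fun ω => (ENNReal.ofReal_le_ofReal (hf ω)).trans (hfg ω),
    hgc.trans (ENNReal.ofReal_le_ofReal hc)⟩

theorem UpperMean.add (h : UpperMean P f c) (h' : UpperMean P f' c') (hc : 0 ≤ c) (hc' : 0 ≤ c') :
    UpperMean P (fun ω => f ω + f' ω) (c + c') := by
  obtain ⟨g, hg, hfg, hgc⟩ := h
  obtain ⟨g', hg', hfg', hgc'⟩ := h'
  refine ⟨fun ω => g ω + g' ω, hg.add hg',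
    fun ω => ENNReal.ofReal_add_le.trans (add_le_add (hfg ω) (hfg' ω)), ?_⟩
  rw [lintegral_add_left hg, ENNReal.ofReal_add hc hc']
  exact add_le_add hgc hgc'

theorem UpperMean.const_mul (h : UpperMean P f c) {a : ℝ} (ha : 0 ≤ a) :
    UpperMean P (fun ω => a * f ω) (a * c) := by
  obtain ⟨g, hg, hfg, hgc⟩ := h
  refine ⟨fun ω => ENNReal.ofReal a * g ω, hg.const_mul _, fun ω => ?_, ?_⟩
  · rw [ENNReal.ofReal_mul ha]
    exact mul_le_mul_right (hfg ω) _
  · rw [lintegral_const_mul _ hg, ENNReal.ofReal_mul ha]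
    exact mul_le_mul_right hgc _

theorem UpperMean.const [IsProbabilityMeasure P] (c : ℝ) : UpperMean P (fun _ => c) c :=
  ⟨fun _ => ENNReal.ofReal c, measurable_const, fun _ => le_rfl, by simp⟩

theorem UpperMean.sum {ι : Type*} (s : Finset ι) {f : ι → Ω → ℝ} {c : ι → ℝ}
    (h : ∀ i ∈ s, UpperMean P (f i) (c i)) (hc : ∀ i ∈ s, 0 ≤ c i) :
    UpperMean P (fun ω => ∑ i ∈ s, f i ω) (∑ i ∈ s, c i) := by
  classical
  induction s using Finset.induction_on with
  | empty => exact ⟨fun _ => 0, measurable_const, fun _ => by simp, by simp⟩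
  | insert a s ha ih =>
    simp only [Finset.sum_insert ha]
    refine UpperMean.add (h a (Finset.mem_insert_self a s))
      (ih (fun i hi => h i (Finset.mem_insert_of_mem hi))
        (fun i hi => hc i (Finset.mem_insert_of_mem hi)))
      (hc a (Finset.mem_insert_self a s))
      (Finset.sum_nonneg fun i hi => hc i (Finset.mem_insert_of_mem hi))

theorem UpperMean.lintegral_le (h : UpperMean P f c) :
    ∫⁻ ω, ENNReal.ofReal (f ω) ∂P ≤ ENNReal.ofReal c := by
  obtain ⟨g, -, hfg, hgc⟩ := h
  exact (lintegral_mono hfg).trans hgc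

theorem UpperMean.of_lintegral_le (hf : Measurable f)
    (h : ∫⁻ ω, ENNReal.ofReal (f ω) ∂P ≤ ENNReal.ofReal c) : UpperMean P f c :=
  ⟨_, hf.ennreal_ofReal, fun _ => le_rfl, h⟩

end UpperMean

/-! ### Stochastic gradient steps -/

section Noise
variable {n : ℕ} {Ξ Ω : Type*} [MeasurableSpace Ξ]

/-- The cross term has mean zero. The variance bound first yields square integrability, so the
expansion may be integrated termwise. -/
theorem lintegral_norm_sub_smul_sq_le {D : Measure Ξ} [IsProbabilityMeasure D] {w : Ξ → Vec n}
    (hw : Integrable w D) (hw0 : ∫ z, w z ∂D = 0) {σ : ℝ}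
    (hσ : ∫⁻ z, ‖w z‖ₑ ^ 2 ∂D ≤ ENNReal.ofReal (σ ^ 2)) (a : Vec n) (η : ℝ) :
    ∫⁻ z, ENNReal.ofReal (‖a - η • w z‖ ^ 2) ∂D ≤ ENNReal.ofReal (‖a‖ ^ 2 + η ^ 2 * σ ^ 2) := by
  have hsq : ∀ v : Vec n, ‖v‖ₑ ^ 2 = ENNReal.ofReal (‖v‖ ^ 2) := fun v => by
    rw [ENNReal.ofReal_pow (norm_nonneg _), ofReal_norm]
  have hint : Integrable (fun z => ‖w z‖ ^ 2) D := by
    refine ⟨hw.1.norm.pow 2, ?_⟩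
    rw [hasFiniteIntegral_iff_ofReal (Filter.Eventually.of_forall fun z => sq_nonneg _)]
    simp only [← hsq]
    exact hσ.trans_lt ENNReal.ofReal_lt_top
  have hle : ∫ z, ‖w z‖ ^ 2 ∂D ≤ σ ^ 2 := by
    have := ofReal_integral_eq_lintegral_ofReal hint (Filter.Eventually.of_forall fun z => sq_nonneg _)
    simp only [← hsq] at this
    rw [← this] at hσ
    exact (ENNReal.ofReal_le_ofReal_iff (sq_nonneg _)).1 hσ
  have e : ∀ z, ‖a - η • w z‖ ^ 2 = ‖a‖ ^ 2 - 2 * η * inner ℝ a (w z) + η ^ 2 * ‖w z‖ ^ 2 := by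
    intro z
    rw [norm_sub_sq_real, inner_smul_right, norm_smul, mul_pow, Real.norm_eq_abs, sq_abs]
    ring
  have hi : Integrable (fun z => inner ℝ a (w z)) D := hw.const_inner a
  have hint2 : Integrable (fun z => ‖a - η • w z‖ ^ 2) D := by
    simp only [e]
    exact ((integrable_const _).sub (hi.const_mul _)).add (hint.const_mul _)
  rw [← ofReal_integral_eq_lintegral_ofReal hint2 (Filter.Eventually.of_forall fun z => sq_nonneg _)]
  refine ENNReal.ofReal_le_ofReal ?_
  simp only [e]
  have hi2 : Integrable (fun z => ‖a‖ ^ 2 - 2 * η * inner ℝ a (w z)) D :=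
    (integrable_const _).sub (hi.const_mul _)
  rw [integral_add hi2 (hint.const_mul _),
    integral_sub (integrable_const _) (hi.const_mul _), integral_const_mul, integral_const_mul,
    integral_inner hw, hw0, inner_zero_right]
  simp only [integral_const, probReal_univ, one_smul, mul_zero, sub_zero]
  gcongr

/-- The mean square of a step along an unbiased stochastic direction that is independent of the
past. -/
theorem lintegral_noisy_step_le {𝓕 : MeasurableSpace Ω} [mΩ : MeasurableSpace Ω] {P : Measure Ω} [IsProbabilityMeasure P]
    {D : Measure Ξ} [IsProbabilityMeasure D] {g : Vec n → Ξ → Vec n} {G : Vec n → Vec n}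
    (hg : Measurable (Function.uncurry g)) (hG : Measurable G) (hi : ∀ x, Integrable (g x) D)
    (hu : ∀ x, ∫ z, g x z ∂D = G x) {σ : ℝ}
    (hσ : ∀ x, ∫⁻ z, ‖g x z - G x‖ₑ ^ 2 ∂D ≤ ENNReal.ofReal (σ ^ 2))
    (h𝓕 : 𝓕 ≤ mΩ) {ξ : Ω → Ξ} (hξ : Measurable ξ) (hlaw : P.map ξ = D)
    (hind : Indep 𝓕 (MeasurableSpace.comap ξ inferInstance) P) {a b : Ω → Vec n}
    (ha : Measurable[𝓕] a) (hb : Measurable[𝓕] b) (η : ℝ) :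
    ∫⁻ ω, ENNReal.ofReal (‖a ω - η • (g (b ω) (ξ ω) - G (b ω))‖ ^ 2) ∂P
      ≤ ∫⁻ ω, ENNReal.ofReal (‖a ω‖ ^ 2 + η ^ 2 * σ ^ 2) ∂P := by
  have ha' : Measurable a := ha.mono h𝓕 le_rfl
  have hb' : Measurable b := hb.mono h𝓕 le_rfl
  have hab : Measurable fun ω => (a ω, b ω) := ha'.prodMk hb'
  have hif : IndepFun (fun ω => (a ω, b ω)) ξ P := by
    rw [IndepFun_iff_Indep]
    refine indep_of_indep_of_le_left hind ?_
    exact (ha.prodMk hb).comap_le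
  -- The joint law of the past pair (a, b) and the sample is a product, so the sample can be
  -- integrated first, with the past frozen.
  have hmap := (indepFun_iff_map_prod_eq_prod_map_map hab.aemeasurable hξ.aemeasurable).1 hif
  have hΨ : Measurable fun q : (Vec n × Vec n) × Ξ =>
      ENNReal.ofReal (‖q.1.1 - η • (g q.1.2 q.2 - G q.1.2)‖ ^ 2) := by
    have h1 : Measurable fun q : (Vec n × Vec n) × Ξ => g q.1.2 q.2 :=
      hg.comp ((measurable_snd.comp measurable_fst).prodMk measurable_snd)
    have h2 : Measurable fun q : (Vec n × Vec n) × Ξ => G q.1.2 :=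
      hG.comp (measurable_snd.comp measurable_fst)
    have h3 : Measurable fun q : (Vec n × Vec n) × Ξ => q.1.1 :=
      measurable_fst.comp measurable_fst
    exact ((h3.sub ((h1.sub h2).const_smul η)).norm.pow_const 2).ennreal_ofReal
  calc ∫⁻ ω, ENNReal.ofReal (‖a ω - η • (g (b ω) (ξ ω) - G (b ω))‖ ^ 2) ∂P
      = ∫⁻ q, ENNReal.ofReal (‖q.1.1 - η • (g q.1.2 q.2 - G q.1.2)‖ ^ 2)
          ∂(P.map fun ω => ((a ω, b ω), ξ ω)) := by
        rw [lintegral_map hΨ (hab.prodMk hξ)]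
    _ = ∫⁻ q, ∫⁻ z, ENNReal.ofReal (‖q.1 - η • (g q.2 z - G q.2)‖ ^ 2) ∂D
          ∂(P.map fun ω => (a ω, b ω)) := by
        rw [hmap, hlaw, lintegral_prod _ hΨ.aemeasurable]
    _ ≤ ∫⁻ q, ENNReal.ofReal (‖q.1‖ ^ 2 + η ^ 2 * σ ^ 2) ∂(P.map fun ω => (a ω, b ω)) := by
        refine lintegral_mono fun q => ?_
        refine lintegral_norm_sub_smul_sq_le ((hi q.2).sub (integrable_const _)) ?_ (hσ q.2) _ _
        rw [integral_sub' (hi q.2) (integrable_const _), hu]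
        simp
    _ = _ := by
        rw [lintegral_map (by fun_prop) hab]

end Noise

/-! ### The past of the algorithm -/

section Past
variable {M n : ℕ} {Ξ Ω : Type*} [MeasurableSpace Ξ]

/-- The samples drawn before local step `k` of outer iteration `t` of round `s`. -/
def earlier (M s t k : ℕ) : Set (ℕ × ℕ × ℕ × Fin M) :=
  {i | i.1 < s ∨ i.1 = s ∧ (i.2.1 < t ∨ i.2.1 = t ∧ i.2.2.1 < k)}

/-- The information available before local step `k` of outer iteration `t` of round `s`. -/
@[reducible] def past (ξ : ℕ → ℕ → ℕ → Fin M → Ω → Ξ) (s t k : ℕ) : MeasurableSpace Ω :=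
  ⨆ i ∈ earlier M s t k, MeasurableSpace.comap (ξ i.1 i.2.1 i.2.2.1 i.2.2.2) inferInstance

theorem measurable_past (ξ : ℕ → ℕ → ℕ → Fin M → Ω → Ξ) {s t k s' t' k' : ℕ} (m : Fin M)
    (h : s' < s ∨ s' = s ∧ (t' < t ∨ t' = t ∧ k' < k)) :
    Measurable[past ξ s t k] (ξ s' t' k' m) := by
  rw [measurable_iff_comap_le]
  exact le_iSup₂_of_le (f := fun (i : ℕ × ℕ × ℕ × Fin M) (_ : i ∈ earlier M s t k) =>
    MeasurableSpace.comap (ξ i.1 i.2.1 i.2.2.1 i.2.2.2) inferInstance) (s', t', k', m) h le_rfl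

variable [mΩ : MeasurableSpace Ω] {P : Measure Ω} {D : Fin M → Measure Ξ}
  {ξ : ℕ → ℕ → ℕ → Fin M → Ω → Ξ}

theorem IsSampling.past_le (h : IsSampling P D ξ) (s t k : ℕ) : past ξ s t k ≤ mΩ :=
  iSup₂_le fun i _ => (h.meas i.1 i.2.1 i.2.2.1 i.2.2.2).comap_le

theorem IsSampling.indep_past (h : IsSampling P D ξ) (s t k : ℕ) (m : Fin M) :
    Indep (past ξ s t k) (MeasurableSpace.comap (ξ s t k m) inferInstance) P := by
  have h1 := indep_iSup_of_disjoint
    (fun i : ℕ × ℕ × ℕ × Fin M => (h.meas i.1 i.2.1 i.2.2.1 i.2.2.2).comap_le) h.indep.iIndep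
    (S := earlier M s t k) (T := {(s, t, k, m)}) (by
      rw [Set.disjoint_singleton_right]
      simp [earlier])
  rw [iSup_singleton] at h1
  exact h1

end Past

end DecOpt

namespace DecOpt

/-! ### Measurability of the iterates -/

section Measurability
variable {M n : ℕ} {Ξ Ω : Type*} [MeasurableSpace Ξ] [MeasurableSpace Ω]
  {g : Fin M → Vec n → Ξ → Vec n} {L : ℝ} {y x : Ω → Fin M → Vec n}

/-- The σ-algebra on Ω is arbitrary in this section, so that the same statements also apply with
`past ξ s t k` in its place; this is how adaptedness of the iterates is obtained. -/
theorem measurable_localSteps (hg : ∀ m, Measurable (Function.uncurry (g m)))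
    {ζ : Ω → Fin M → Vec n} (hy : ∀ m, Measurable fun ω => y ω m)
    (hx : ∀ m, Measurable fun ω => x ω m) (hζ : ∀ m, Measurable fun ω => ζ ω m) (τ : ℕ → ℝ)
    {ξ : ℕ → Fin M → Ω → Ξ} {k : ℕ} (hξ : ∀ j < k, ∀ m, Measurable (ξ j m)) (m : Fin M) :
    Measurable fun ω => localSteps (fun m x z => g m x z + (2 * L) • (x - y ω m)) τ (ζ ω)
      (fun j m => ξ j m ω) (x ω) k m := by
  induction k generalizing m with
  | zero => exact hx m
  | succ k ih =>
    have h1 := ih (fun j hj => hξ j (by omega))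
    have h2 := hξ k (by omega) m
    exact (h1 m).sub (((((hg m).comp ((h1 m).prodMk h2)).add
      (((h1 m).sub (hy m)).const_smul (2 * L))).const_smul (1 / (M : ℝ)) |>.add (hζ m)).const_smul
        (τ k))

theorem measurable_accState (hg : ∀ m, Measurable (Function.uncurry (g m)))
    (hy : ∀ m, Measurable fun ω => y ω m) (hx : ∀ m, Measurable fun ω => x ω m)
    (W : Matrix (Fin M) (Fin M) ℝ) (a : AccParams)
    {ξ : ℕ → ℕ → Fin M → Ω → Ξ} {t : ℕ} (hξ : ∀ t' < t, ∀ j m, Measurable (ξ t' j m)) (m : Fin M) :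
    Measurable (fun ω => (accState W (fun m x z => g m x z + (2 * L) • (x - y ω m)) a
      (fun t j m => ξ t j m ω) (x ω) t).x m) ∧
    Measurable (fun ω => (accState W (fun m x z => g m x z + (2 * L) • (x - y ω m)) a
      (fun t j m => ξ t j m ω) (x ω) t).ζ m) ∧
    Measurable (fun ω => (accState W (fun m x z => g m x z + (2 * L) • (x - y ω m)) a
      (fun t j m => ξ t j m ω) (x ω) t).ζt m) := by
  induction t generalizing m with
  | zero => exact ⟨hx m, measurable_const, measurable_const⟩
  | succ t ih =>
    have h1 := ih (fun j hj => hξ j (by omega))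
    have h2 := measurable_localSteps (L := L) (k := a.K) hg hy (fun m => (h1 m).1)
      (fun m => (h1 m).2.2) a.τ₁ (fun j _ m => hξ t (by omega) j m)
    have h3 := ((h1 m).2.2).add (((h2 m).sub (Finset.measurable_sum Finset.univ
      fun j _ => (h2 j).const_smul (W m j))).const_smul a.τ₂)
    exact ⟨h2 m, h3, h3.add ((h3.sub (h1 m).2.1).const_smul a.β)⟩

theorem measurable_run (p : Problem M n Ξ) (hg : ∀ m, Measurable (Function.uncurry (p.g m)))
    (L : ℝ) (r : Regime) (par : ℕ → AccParams) {ξ : ℕ → ℕ → ℕ → Fin M → Ω → Ξ} {s : ℕ}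
    (hξ : ∀ s' ≤ s, ∀ t j m, Measurable (ξ s' t j m)) (m : Fin M) :
    Measurable (fun ω => (p.run L r par ξ s ω).x m) ∧
    Measurable (fun ω => (p.run L r par ξ s ω).y m) ∧
    Measurable (fun ω => (p.run L r par ξ s ω).yNext m) := by
  induction s generalizing m with
  | zero => exact ⟨measurable_const, measurable_const, measurable_const⟩
  | succ s ih =>
    have h1 := ih (fun s' hs => hξ s' (by omega))
    have h2 := measurable_accState (L := L) (y := fun ω => (p.run L r par ξ s ω).yNext)
      (x := fun ω m => (p.run L r par ξ s ω).x m
        + r.warm L • ((p.run L r par ξ s ω).yNext m - (p.run L r par ξ s ω).y m))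
      hg (fun m => (h1 m).2.2)
      (fun m => (h1 m).1.add (((h1 m).2.2.sub (h1 m).2.1).const_smul (r.warm L))) p.W (par (s + 1))
      (ξ := ξ (s + 1)) (t := (par (s + 1)).T + 1) (fun t' _ j m => hξ (s + 1) le_rfl t' j m)
    exact ⟨(h2 m).1, (h1 m).2.2, (h2 m).1.add (((h2 m).1.sub (h1 m).1).const_smul (r.beta L (s + 1)))⟩

end Measurability

theorem past_mono {M : ℕ} {Ξ Ω : Type*} [MeasurableSpace Ξ] (ξ : ℕ → ℕ → ℕ → Fin M → Ω → Ξ)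
    {s t k t' k' : ℕ} (h : t < t' ∨ t = t' ∧ k ≤ k') : past ξ s t k ≤ past ξ s t' k' := by
  refine iSup₂_le fun i hi => ?_
  rw [← measurable_iff_comap_le]
  refine measurable_past ξ i.2.2.2 ?_
  change i.1 < s ∨ i.1 = s ∧ (i.2.1 < t ∨ i.2.1 = t ∧ i.2.2.1 < k) at hi
  omega

theorem sq_le_two_mul {a b c : ℝ} (ha : 0 ≤ a) (h : a ≤ b + c) :
    a ^ 2 ≤ 2 * (b ^ 2 + c ^ 2) := by
  have := pow_le_pow_left₀ ha h 2
  nlinarith [sq_nonneg (b - c)]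

theorem sq_le_three_mul {a b c d : ℝ} (ha : 0 ≤ a) (h : a ≤ b + c + d) :
    a ^ 2 ≤ 3 * (b ^ 2 + c ^ 2 + d ^ 2) := by
  have := pow_le_pow_left₀ ha h 2
  nlinarith [sq_nonneg (b - c), sq_nonneg (b - d), sq_nonneg (c - d)]

/-! ### The local steps -/

section Inner
variable {M n : ℕ} {Ξ Ω : Type*} [MeasurableSpace Ξ] [mΩ : MeasurableSpace Ω]
  {P : Measure Ω} [IsProbabilityMeasure P] {p : Problem M n Ξ} {L σ σ₂ : ℝ}
  {ξ : ℕ → ℕ → ℕ → Fin M → Ω → Ξ}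

/-- An exact step contracts the squared distance by 1 − ηL and the noise adds η²σ² per client, with
geometric sum at most ησ²/L. The step size Mη cancels the weight 1/M of the local functions, which
turns ζ into the multiplier Mζ. The target is random but determined by the past. -/
theorem upperMean_localSteps (hp : p.Standing L σ σ₂) (hξ : IsSampling P p.D ξ) (hM : 0 < M)
    (hL : 0 < L) {s t : ℕ} {y x ζ : Ω → Fin M → Vec n}
    (hy : ∀ m, Measurable[past ξ s t 0] fun ω => y ω m)
    (hx : ∀ m, Measurable[past ξ s t 0] fun ω => x ω m)
    (hζ : ∀ m, Measurable[past ξ s t 0] fun ω => ζ ω m) {η : ℝ} (hη : 0 < η)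
    (hη' : η * (9 * L) ≤ 1) {c : ℝ} (hc : 0 ≤ c)
    (h : UpperMean P (fun ω => ∑ m, ‖x ω m
      - dualPoint L p.F (y ω) ((M : ℝ) • ζ ω) m‖ ^ 2) (M * c)) (k : ℕ) :
    UpperMean P (fun ω => ∑ m, ‖localSteps (fun m x z => p.g m x z + (2 * L) • (x - y ω m))
        (fun _ => M * η) (ζ ω) (fun j m => ξ s t j m ω) (x ω) k m
      - dualPoint L p.F (y ω) ((M : ℝ) • ζ ω) m‖ ^ 2)
      (M * ((1 - η * L) ^ k * c + η * σ ^ 2 / L)) := by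
  have hMpos : (0 : ℝ) < M := by exact_mod_cast hM
  have hηL : 0 ≤ 1 - η * L := by nlinarith [mul_pos hη hL]
  induction k with
  | zero =>
    refine h.mono (fun ω => le_rfl) ?_
    have : 0 ≤ η * σ ^ 2 / L := by positivity
    rw [pow_zero, one_mul]
    gcongr
    linarith
  | succ k ih =>
    set X : Ω → Fin M → Vec n := fun ω => localSteps (fun m x z => p.g m x z + (2 * L) • (x - y ω m))
        (fun _ => M * η) (ζ ω) (fun j m => ξ s t j m ω) (x ω) k with hX
    set Y : Ω → Fin M → Vec n := fun ω => dualPoint L p.F (y ω) ((M : ℝ) • ζ ω) with hY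
    have hmono : past ξ s t 0 ≤ past ξ s t k := past_mono ξ (by omega)
    have hXm : ∀ m, Measurable[past ξ s t k] fun ω => X ω m := fun m =>
      @measurable_localSteps M n Ξ Ω _ (past ξ s t k) p.g L y x hp.meas ζ
        (fun m => (hy m).mono hmono le_rfl) (fun m => (hx m).mono hmono le_rfl)
        (fun m => (hζ m).mono hmono le_rfl) (fun _ => M * η) (ξ s t) k
        (fun j hj m => measurable_past ξ m (by omega)) m
    have hYm : ∀ m, Measurable[past ξ s t k] fun ω => Y ω m := fun m =>
      ((hp.smooth m).continuous_resolvent hL).measurable.comp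
        ((((hy m).mono hmono le_rfl).const_smul (2 * L)).sub
          (((hζ m).mono hmono le_rfl).const_smul (M : ℝ)))
    have hGm : ∀ m, Measurable (gradient (p.F m)) :=
      fun m => (hp.smooth m).continuous_gradient.measurable
    -- The noiseless step. Since Y is stationary for the local problem, subtracting the regularized
    -- gradient at Y accounts for both the prox centre and the multiplier.
    set A : Ω → Fin M → Vec n := fun ω m => (X ω m - Y ω m)
      - η • ((gradient (p.F m) (X ω m) + (2 * L) • X ω m)
        - (gradient (p.F m) (Y ω m) + (2 * L) • Y ω m)) with hA
    have hAm : ∀ m, Measurable[past ξ s t k] fun ω => A ω m := fun m =>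
      ((hXm m).sub (hYm m)).sub (((((hGm m).comp (hXm m)).add ((hXm m).const_smul (2 * L))).sub
        (((hGm m).comp (hYm m)).add ((hYm m).const_smul (2 * L)))).const_smul η)
    have hstep : ∀ ω m, localSteps (fun m x z => p.g m x z + (2 * L) • (x - y ω m))
        (fun _ => M * η) (ζ ω) (fun j m => ξ s t j m ω) (x ω) (k + 1) m - Y ω m
        = A ω m - η • (p.g m (X ω m) (ξ s t k m ω) - gradient (p.F m) (X ω m)) := by
      intro ω m
      have h1 : localSteps (fun m x z => p.g m x z + (2 * L) • (x - y ω m))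
          (fun _ => M * η) (ζ ω) (fun j m => ξ s t j m ω) (x ω) (k + 1) m
          = X ω m - (M * η) • ((1 / (M : ℝ)) • (p.g m (X ω m) (ξ s t k m ω)
            + (2 * L) • (X ω m - y ω m)) + ζ ω m) := rfl
      have h2 := (hp.smooth m).resolvent_eq hL ((2 * L) • y ω m - ((M : ℝ) • ζ ω) m)
      have h3 : gradient (p.F m) (Y ω m) + (2 * L) • Y ω m
          = (2 * L) • y ω m - (M : ℝ) • ζ ω m := h2
      have h4 : (M * η) • ((1 / (M : ℝ)) • (p.g m (X ω m) (ξ s t k m ω)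
            + (2 * L) • (X ω m - y ω m)) + ζ ω m)
          = η • (p.g m (X ω m) (ξ s t k m ω) + (2 * L) • (X ω m - y ω m) + (M : ℝ) • ζ ω m) := by
        rw [smul_add, smul_smul, smul_add η _ ((M : ℝ) • ζ ω m), smul_smul η]
        congr 2
        · field_simp
        · ring
      rw [h1, h4]
      simp only [hA, h3]
      module
    have hAle : ∀ ω m, ‖A ω m‖ ^ 2 ≤ (1 - η * L) * ‖X ω m - Y ω m‖ ^ 2 := fun ω m =>
      (hp.smooth m).gradient_step_contracts hL hη.le hη' _ _
    have hAsum : UpperMean P (fun ω => ∑ m, (‖A ω m‖ ^ 2 + η ^ 2 * σ ^ 2))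
        (M * ((1 - η * L) ^ (k + 1) * c + η * σ ^ 2 / L)) := by
      -- The noise floor ησ²/L is the fixed point of u ↦ (1 − ηL)u + η²σ², so the bound reproduces
      -- itself exactly.
      have h5 := (ih.const_mul hηL).add (UpperMean.const (P := P) (M * (η ^ 2 * σ ^ 2)))
        (by positivity) (by positivity)
      refine h5.mono (fun ω => ?_) (le_of_eq ?_)
      · rw [Finset.sum_add_distrib, Finset.mul_sum]
        refine add_le_add (Finset.sum_le_sum fun m _ => hAle ω m) (by simp)
      · field_simp
        ring
    have hmle := hξ.past_le s t k
    have hfin := hAsum.lintegral_le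
    suffices hs : UpperMean P (fun ω => ∑ m, ‖A ω m - η • (p.g m (X ω m) (ξ s t k m ω)
        - gradient (p.F m) (X ω m))‖ ^ 2) (M * ((1 - η * L) ^ (k + 1) * c + η * σ ^ 2 / L)) from
      hs.mono (fun ω => le_of_eq (Finset.sum_congr rfl fun m _ => by rw [← hstep])) le_rfl
    refine UpperMean.of_lintegral_le ?_ ?_
    · refine Finset.measurable_sum _ fun m _ => ?_
      have h6 : Measurable fun ω => p.g m (X ω m) (ξ s t k m ω) :=
        (hp.meas m).comp (((hXm m).mono hmle le_rfl).prodMk (hξ.meas s t k m))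
      exact ((((hAm m).mono hmle le_rfl).sub ((h6.sub ((hGm m).comp
        ((hXm m).mono hmle le_rfl))).const_smul η)).norm.pow_const 2)
    · refine le_trans ?_ hfin
      have e1 : ∀ ω, ENNReal.ofReal (∑ m, (‖A ω m‖ ^ 2 + η ^ 2 * σ ^ 2))
          = ∑ m, ENNReal.ofReal (‖A ω m‖ ^ 2 + η ^ 2 * σ ^ 2) := fun ω =>
        ENNReal.ofReal_sum_of_nonneg fun m _ => by positivity
      have e2 : ∀ ω, ENNReal.ofReal (∑ m, ‖A ω m - η • (p.g m (X ω m) (ξ s t k m ω)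
            - gradient (p.F m) (X ω m))‖ ^ 2)
          = ∑ m, ENNReal.ofReal (‖A ω m - η • (p.g m (X ω m) (ξ s t k m ω)
            - gradient (p.F m) (X ω m))‖ ^ 2) := fun ω =>
        ENNReal.ofReal_sum_of_nonneg fun m _ => by positivity
      simp only [e1, e2]
      rw [lintegral_finsetSum, lintegral_finsetSum]
      · refine Finset.sum_le_sum fun m _ => ?_
        have := hp.prob m
        exact lintegral_noisy_step_le (hp.meas m) (hGm m) (hp.integrable m) (hp.unbiased m)
          (hp.variance m) hmle (hξ.meas s t k m) (hξ.law s t k m) (hξ.indep_past s t k m)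
          (hAm m) (hXm m) η
      · intro m _
        exact ((((hAm m).mono hmle le_rfl).norm.pow_const 2).add_const _).ennreal_ofReal
      · intro m _
        have h6 : Measurable fun ω => p.g m (X ω m) (ξ s t k m ω) :=
          (hp.meas m).comp (((hXm m).mono hmle le_rfl).prodMk (hξ.meas s t k m))
        exact ((((hAm m).mono hmle le_rfl).sub ((h6.sub ((hGm m).comp
          ((hXm m).mono hmle le_rfl))).const_smul η)).norm.pow_const 2).ennreal_ofReal

theorem sum_gradient_resolvent_obj {F : Fin M → Vec n → ℝ} (hM : 0 < M) {y : Fin M → Vec n}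
    {z : Vec n} (hz : (1 / (M : ℝ)) • ∑ m, gradient (F m) z + (2 * L) • z = (2 * L) • avg y) :
    ∑ m, (gradient (F m) z + (2 * L) • (z - y m)) = 0 := by
  have hMpos : (0 : ℝ) < M := by exact_mod_cast hM
  have h1 : (M : ℝ) • ((1 / (M : ℝ)) • ∑ m, gradient (F m) z + (2 * L) • z)
      = (M : ℝ) • ((2 * L) • avg y) := by rw [hz]
  rw [avg, smul_add, smul_smul, mul_one_div_cancel hMpos.ne', one_smul, smul_comm (2 * L) (1 / (M : ℝ)),
    smul_smul (M : ℝ) (1 / (M : ℝ)), mul_one_div_cancel hMpos.ne', one_smul] at h1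
  simp only [smul_sub, Finset.sum_add_distrib, Finset.sum_sub_distrib, ← Finset.smul_sum,
    Finset.sum_const, Finset.card_univ, Fintype.card_fin]
  rw [← h1, ← Nat.cast_smul_eq_nsmul ℝ, smul_comm (2 * L) (M : ℝ) z]
  abel

/-- The accuracy of one call of Acc-GA-MSGD. -/
theorem upperMean_accGaMsgd (hp : p.Standing L σ σ₂) (hξ : IsSampling P p.D ξ) (hM : 0 < M)
    (hL : 0 < L) (hσ₂ : 0 ≤ σ₂) (hσ₂' : σ₂ < 1) {s : ℕ} {y x : Ω → Fin M → Vec n}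
    (hy : ∀ m, Measurable[past ξ s 0 0] fun ω => y ω m)
    (hx : ∀ m, Measurable[past ξ s 0 0] fun ω => x ω m) {a : AccParams} {η θ δ A : ℝ}
    (haτ₁ : a.τ₁ = fun _ => M * η) (haτ₂ : a.τ₂ = L / (12 * M)) (haβ : a.β = (1 - θ) / (1 + θ))
    (hη : 0 < η) (hη' : η * (9 * L) ≤ 1) (hθ : 0 < θ) (hθ2 : 108 * θ ^ 2 = 1 - σ₂)
    (hδ : 0 ≤ δ) (hA : 0 ≤ A)
    (hK : (1 - η * L) ^ a.K * (16000 * (A + δ) / (1 - σ₂) ^ 2) + η * σ ^ 2 / L ≤ δ)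
    {z : Ω → Vec n}
    (hz : ∀ ω, (1 / (M : ℝ)) • ∑ m, gradient (p.F m) (z ω) + (2 * L) • z ω = (2 * L) • avg (y ω))
    (hA1 : UpperMean P (fun ω => ∑ m, ‖x ω m - dualPoint L p.F (y ω) 0 m‖ ^ 2) (M * A))
    (hA2 : UpperMean P (fun ω => ∑ m, ‖gradient (p.F m) (z ω) + (2 * L) • (z ω - y ω m)‖ ^ 2)
      (M * (L ^ 2 * A))) :
    UpperMean P (fun ω => ∑ m, ‖accGaMsgd p.W (fun m x z => p.g m x z + (2 * L) • (x - y ω m)) a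
        (fun t k m => ξ s t k m ω) (x ω) m - z ω‖ ^ 2)
      (M * ((5186 * δ + 288 * A * (1 - θ / 2) ^ a.T) / (1 - σ₂) ^ 2)) := by
  have hMpos : (0 : ℝ) < M := by exact_mod_cast hM
  obtain ⟨q, hq⟩ : ∃ q, q = 1 - σ₂ := ⟨_, rfl⟩
  have hqpos : 0 < q := by rw [hq]; linarith
  have hq1 : q ≤ 1 := by rw [hq]; linarith
  have hθ1 : θ ≤ 1 := by nlinarith
  have hρ : 0 ≤ 1 - θ / 2 := by linarith
  have hρ1 : 1 - θ / 2 ≤ 1 := by linarith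
  set st : Ω → ℕ → AccState M n := fun ω => accState p.W
    (fun m x z => p.g m x z + (2 * L) • (x - y ω m)) a (fun t k m => ξ s t k m ω) (x ω) with hst
  set Zt : Ω → ℕ → Fin M → Vec n := fun ω t => (M : ℝ) • (st ω t).ζt with hZt
  set Zs : Ω → Fin M → Vec n := fun ω m =>
    -(gradient (p.F m) (z ω) + (2 * L) • (z ω - y ω m)) with hZs
  have hpot : ∀ ω, ∃ V : ℕ → ℝ, (∀ t, 0 ≤ V t) ∧
      V 0 ≤ 4 / (L * (1 - σ₂)) * ∑ m, ‖gradient (p.F m) (z ω) + (2 * L) • (z ω - y ω m)‖ ^ 2 ∧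
      (∀ t, V (t + 1) ≤ (1 - θ / 2) * V t + 36 * θ * L / (1 - σ₂)
        * ∑ m, ‖(st ω (t + 1)).x m - dualPoint L p.F (y ω) (Zt ω t) m‖ ^ 2) ∧
      ∀ t, ∑ m, ‖Zt ω t m - Zs ω m‖ ^ 2 ≤ 36 * L / (1 - σ₂) * V t := by
    intro ω
    refine exists_dual_potential (Z := fun t => (M : ℝ) • (st ω t).ζ) (Zt := Zt ω)
      (x := fun t => (st ω t).x) (τ := L / 12) hM hL hp.smooth hp.gossip hσ₂ hσ₂' hθ hθ2 rfl
      (y ω) (z ω) (sum_gradient_resolvent_obj hM (hz ω)) ?_ ?_ ?_ ?_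
    · ext1 m; exact smul_zero (M : ℝ) (A := Vec n)
    · ext1 m; exact smul_zero (M : ℝ) (A := Vec n)
    · intro t
      ext1 m
      change (M : ℝ) • ((st ω t).ζt m + a.τ₂ • laplacian p.W (st ω (t + 1)).x m)
        = (M : ℝ) • (st ω t).ζt m + (L / 12) • laplacian p.W (st ω (t + 1)).x m
      rw [smul_add, smul_smul, haτ₂]
      congr 2
      field_simp
    · intro t
      ext1 m
      change (M : ℝ) • ((st ω (t + 1)).ζ m + a.β • ((st ω (t + 1)).ζ m - (st ω t).ζ m))
        = (M : ℝ) • (st ω (t + 1)).ζ m + ((1 - θ) / (1 + θ)) • ((M : ℝ) • (st ω (t + 1)).ζ m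
          - (M : ℝ) • (st ω t).ζ m)
      rw [haβ, ← smul_sub, smul_comm _ (M : ℝ), smul_add]
  -- The potential is chosen separately for each ω, so nothing is known about its measurability;
  -- `UpperMean` only asks for a measurable majorant.
  choose V hV0 hVi hV hVd using hpot
  rw [← hq] at hθ2 hK hVi hV hVd ⊢
  have hXs : ∀ ω, dualPoint L p.F (y ω) (Zs ω) = fun _ => z ω := by
    intro ω
    ext1 m
    refine (hp.smooth m).resolvent_of_eq hL ?_
    simp only [hZs]
    module
  have hnear : ∀ ω t, ∑ m, ‖dualPoint L p.F (y ω) (Zt ω t) m - z ω‖ ^ 2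
      ≤ 36 / (L * q) * V ω t := by
    intro ω t
    have h1 := sum_dualPoint_sub_sq_le hL hp.smooth (y ω) (Zs ω) (Zt ω t)
    rw [hXs] at h1
    have h2 := h1.trans (hVd ω t)
    have h3 : 36 / (L * q) * V ω t = (36 * L / q * V ω t) / L ^ 2 := by field_simp
    rw [h3, le_div_iff₀ (by positivity)]
    linarith
  have hmeas : ∀ t, (∀ m, Measurable[past ξ s t 0] fun ω => (st ω t).x m) ∧
      ∀ m, Measurable[past ξ s t 0] fun ω => (st ω t).ζt m := by
    intro t
    have hmono : past ξ s 0 0 ≤ past ξ s t 0 := past_mono ξ (by omega)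
    have h1 := @measurable_accState M n Ξ Ω _ (past ξ s t 0) p.g L y x hp.meas
      (fun m => (hy m).mono hmono le_rfl) (fun m => (hx m).mono hmono le_rfl) p.W a (ξ s) t
      (fun t' ht j m => measurable_past ξ m (by omega))
    exact ⟨fun m => (h1 m).1, fun m => (h1 m).2.2⟩
  have hloc : ∀ t, UpperMean P (fun ω => ∑ m, ‖(st ω t).x m
        - dualPoint L p.F (y ω) (Zt ω t) m‖ ^ 2) (M * (16000 * (A + δ) / q ^ 2)) →
      UpperMean P (fun ω => ∑ m, ‖(st ω (t + 1)).x m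
        - dualPoint L p.F (y ω) (Zt ω t) m‖ ^ 2) (M * δ) := by
    intro t ht
    have hmono : past ξ s 0 0 ≤ past ξ s t 0 := past_mono ξ (by omega)
    have h1 := upperMean_localSteps hp hξ hM hL (fun m => (hy m).mono hmono le_rfl) (hmeas t).1
      (hmeas t).2 hη hη' (by positivity) ht a.K
    rw [← haτ₁] at h1
    refine h1.mono (fun ω => le_rfl) ?_
    gcongr
  -- The potential and the starting error of the next local phase are bounded together: a bounded
  -- starting error gives local accuracy δ by `hK`, which keeps the potential small. The floor
  -- 72Lδ/q is 36θLδ/q divided by the rate θ/2.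
  have hmain : ∀ t, UpperMean P (fun ω => V ω t)
        (M * (4 * L * A / q * (1 - θ / 2) ^ t + 72 * L * δ / q)) ∧
      UpperMean P (fun ω => ∑ m, ‖(st ω t).x m
        - dualPoint L p.F (y ω) (Zt ω t) m‖ ^ 2) (M * (16000 * (A + δ) / q ^ 2)) := by
    intro t
    induction t with
    | zero =>
      constructor
      · refine (hA2.const_mul (by positivity : 0 ≤ 4 / (L * q))).mono hVi ?_
        have h1 : 4 / (L * q) * (M * (L ^ 2 * A)) = M * (4 * L * A / q * (1 - θ / 2) ^ 0) := by
          field_simp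
        rw [h1]
        gcongr
        have : 0 ≤ 72 * L * δ / q := by positivity
        linarith
      · refine hA1.mono (fun ω => ?_) ?_
        · have h1 : Zt ω 0 = 0 := by ext1 m; exact smul_zero (M : ℝ) (A := Vec n)
          rw [h1]
          exact le_rfl
        · gcongr
          rw [le_div_iff₀ (by positivity)]
          have : q ^ 2 ≤ 1 := by nlinarith
          nlinarith
    | succ t ih =>
      obtain ⟨ih1, ih2⟩ := ih
      have h1 := hloc t ih2
      have hpow : (1 - θ / 2) ^ (t + 1) ≤ 1 := pow_le_one₀ hρ hρ1
      have hpow' : (1 - θ / 2) ^ t ≤ 1 := pow_le_one₀ hρ hρ1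
      have h2 : UpperMean P (fun ω => V ω (t + 1))
          (M * (4 * L * A / q * (1 - θ / 2) ^ (t + 1) + 72 * L * δ / q)) := by
        refine ((ih1.const_mul hρ).add (h1.const_mul (by positivity : 0 ≤ 36 * θ * L / q))
          (by positivity) (by positivity)).mono (fun ω => hV ω t) (le_of_eq ?_)
        field_simp
        ring
      refine ⟨h2, ?_⟩
      have hb : ∀ t, (1 - θ / 2) ^ t ≤ 1 → 36 / (L * q)
          * (M * (4 * L * A / q * (1 - θ / 2) ^ t + 72 * L * δ / q))
          ≤ M * ((144 * A + 2592 * δ) / q ^ 2) := by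
        intro t ht
        calc _ ≤ 36 / (L * q) * (M * (4 * L * A / q * 1 + 72 * L * δ / q)) := by gcongr
          _ = _ := by field_simp; ring
      have h3 := (ih1.const_mul (by positivity : 0 ≤ 36 / (L * q))).mono (hnear · t)
        (hb t hpow')
      have h4 := (h2.const_mul (by positivity : 0 ≤ 36 / (L * q))).mono (hnear · (t + 1))
        (hb (t + 1) hpow)
      have h5 := ((h1.add h3 (by positivity) (by positivity)).add h4 (by positivity)
        (by positivity)).const_mul (by norm_num : (0 : ℝ) ≤ 3)
      refine h5.mono (fun ω => ?_) ?_
      · rw [← Finset.sum_add_distrib, ← Finset.sum_add_distrib, Finset.mul_sum]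
        refine Finset.sum_le_sum fun m _ => ?_
        -- The old target and the solution z serve as intermediate points: both targets are within
        -- the potential of z. This gives at most 864A + 15555δ over q², below the claimed 16000(A +
        -- δ)/q².
        have e : (st ω (t + 1)).x m - dualPoint L p.F (y ω) (Zt ω (t + 1)) m
            = ((st ω (t + 1)).x m - dualPoint L p.F (y ω) (Zt ω t) m)
              + (dualPoint L p.F (y ω) (Zt ω t) m - z ω)
              - (dualPoint L p.F (y ω) (Zt ω (t + 1)) m - z ω) := by abel
        rw [e]
        have h6 := norm_sub_le (((st ω (t + 1)).x m - dualPoint L p.F (y ω) (Zt ω t) m)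
              + (dualPoint L p.F (y ω) (Zt ω t) m - z ω))
              (dualPoint L p.F (y ω) (Zt ω (t + 1)) m - z ω)
        have h7 := norm_add_le ((st ω (t + 1)).x m - dualPoint L p.F (y ω) (Zt ω t) m)
              (dualPoint L p.F (y ω) (Zt ω t) m - z ω)
        exact sq_le_three_mul (norm_nonneg _) (h6.trans (add_le_add h7 le_rfl))
      · have h8 : M * δ ≤ M * (δ / q ^ 2) := by
          gcongr
          rw [le_div_iff₀ (by positivity)]
          have : q ^ 2 ≤ 1 := by nlinarith
          nlinarith
        calc _ ≤ 3 * (M * (δ / q ^ 2) + M * ((144 * A + 2592 * δ) / q ^ 2)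
              + M * ((144 * A + 2592 * δ) / q ^ 2)) := by gcongr
          _ = M * ((864 * A + 15555 * δ) / q ^ 2) := by ring
          _ ≤ _ := by
            gcongr
            nlinarith
  obtain ⟨h1, h2⟩ := hmain a.T
  have h3 := hloc a.T h2
  have h4 := (h1.const_mul (by positivity : 0 ≤ 36 / (L * q))).mono (hnear · a.T) le_rfl
  refine ((h3.add h4 (by positivity) (by positivity)).const_mul zero_le_two).mono
    (fun ω => ?_) ?_
  · rw [← Finset.sum_add_distrib, Finset.mul_sum]
    refine Finset.sum_le_sum fun m _ => ?_
    change ‖(st ω (a.T + 1)).x m - z ω‖ ^ 2 ≤ _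
    have e : (st ω (a.T + 1)).x m - z ω
        = ((st ω (a.T + 1)).x m - dualPoint L p.F (y ω) (Zt ω a.T) m)
          + (dualPoint L p.F (y ω) (Zt ω a.T) m - z ω) := by abel
    rw [e]
    exact sq_le_two_mul (norm_nonneg _) (norm_add_le _ _)
  · have h8 : δ ≤ δ / q ^ 2 := by
      rw [le_div_iff₀ (by positivity)]
      have : q ^ 2 ≤ 1 := by nlinarith
      nlinarith
    calc _ = M * (2 * δ + (288 * A * (1 - θ / 2) ^ a.T + 5184 * δ) / q ^ 2) := by
          field_simp
          ring
      _ ≤ M * (2 * (δ / q ^ 2) + (288 * A * (1 - θ / 2) ^ a.T + 5184 * δ) / q ^ 2) := by gcongr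
      _ = _ := by ring

end Inner

end DecOpt

namespace DecOpt

/-! ### The parameters of the inner algorithm -/

/-- In round `s`, a call of Acc-GA-MSGD with parameters `a` from a starting point with mean square
error `A` returns approximate minimizers with mean square error `ε`. -/
def InnerAccurate {M n : ℕ} {Ξ Ω : Type*} [MeasurableSpace Ξ] [MeasurableSpace Ω] (P : Measure Ω)
    (p : Problem M n Ξ) (ξ : ℕ → ℕ → ℕ → Fin M → Ω → Ξ) (L : ℝ) (a : AccParams) (A ε : ℝ)
    (s : ℕ) : Prop :=
  ∀ (y x : Ω → Fin M → Vec n) (z : Ω → Vec n),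
    (∀ m, Measurable[past ξ s 0 0] fun ω => y ω m) →
    (∀ m, Measurable[past ξ s 0 0] fun ω => x ω m) →
    (∀ ω, (1 / (M : ℝ)) • ∑ m, gradient (p.F m) (z ω) + (2 * L) • z ω = (2 * L) • avg (y ω)) →
    UpperMean P (fun ω => ∑ m, ‖x ω m - dualPoint L p.F (y ω) 0 m‖ ^ 2) (M * A) →
    UpperMean P (fun ω => ∑ m, ‖gradient (p.F m) (z ω) + (2 * L) • (z ω - y ω m)‖ ^ 2)
      (M * (L ^ 2 * A)) →
    UpperMean P (fun ω => ∑ m, ‖accGaMsgd p.W (fun m x z => p.g m x z + (2 * L) • (x - y ω m)) a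
      (fun t k m => ξ s t k m ω) (x ω) m - z ω‖ ^ 2) (M * ε)

theorem one_sub_pow_le {r B : ℝ} (hr : 0 < r) (hr1 : r ≤ 1) (hB : 0 < B) {N : ℕ}
    (h : Real.log B / r ≤ N) : (1 - r) ^ N ≤ 1 / B := by
  have h1 : (1 - r) ^ N ≤ Real.exp (-r) ^ N := by
    refine pow_le_pow_left₀ (by linarith) ?_ N
    have := Real.add_one_le_exp (-r)
    linarith
  refine h1.trans ?_
  rw [← Real.exp_nat_mul, one_div, ← Real.exp_log (inv_pos.2 hB), Real.log_inv]
  refine Real.exp_le_exp.2 ?_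
  rw [div_le_iff₀ hr] at h
  linarith

/-- As X ≥ 2, a numerical factor up to 2^a is absorbed into a power of X, so all logarithms can be
measured by log X. -/
theorem log_le_mul_log {c x X : ℝ} {a k : ℕ} (hX : 2 ≤ X) (hx : 0 < x) (hxX : x ≤ c * X ^ k)
    (hc : c ≤ 2 ^ a) : Real.log x ≤ (a + k) * Real.log X := by
  have h1 : x ≤ X ^ (a + k) := by
    refine hxX.trans ?_
    rw [pow_add]
    have : (2 : ℝ) ^ a ≤ X ^ a := pow_le_pow_left₀ (by norm_num) hX a
    gcongr
    linarith
  calc Real.log x ≤ Real.log (X ^ (a + k)) := Real.log_le_log hx h1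
    _ = _ := by rw [Real.log_pow]; push_cast; ring

theorem half_le_log {X : ℝ} (hX : 2 ≤ X) : 1 / 2 ≤ Real.log X := by
  have h1 := Real.log_le_log (by norm_num) hX
  have h2 := Real.log_two_gt_d9
  linarith

theorem log_mul_pow_add_le {X x u c c' : ℝ} {a b j : ℕ} (hX : 2 ≤ X) (hx : x ≤ X) (hu : u ≤ X)
    (hx0 : 0 ≤ x) (hu0 : 0 < u) (hc : 0 ≤ c) (hbj : b ≤ j + 1) (hc' : 0 < c')
    (ha : c + c' ≤ 2 ^ a) :
    Real.log (c * (x * u ^ j) + c' * u ^ b) ≤ (a + (j + 1 : ℕ)) * Real.log X := by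
  refine log_le_mul_log hX (by positivity) ?_ ha
  have h1 : x * u ^ j ≤ X ^ (j + 1) := by
    rw [pow_succ']
    gcongr
  have h2 : u ^ b ≤ X ^ (j + 1) :=
    (pow_le_pow_left₀ hu0.le hu b).trans (pow_le_pow_right₀ (by linarith) hbj)
  rw [add_mul]
  gcongr

-- T + 1 is of order log X / √q and K of order log X / (ηL), with 1/(ηL) of order 1 + σ²/(L²q²ε).
-- The noise part of the product carries √(1/q)·q⁻², which is bounded by q⁻³. The parameters are
-- fixed before the problem and the probability space are given.
set_option maxHeartbeats 800000 in
theorem exists_accParams : ∃ C₀ > (0 : ℝ), ∀ (M : ℕ) (L σ σ₂ A ε : ℝ), 0 < M → 0 < L →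
    0 ≤ σ₂ → σ₂ < 1 → 0 ≤ A → 0 < ε →
    ∃ a : AccParams,
      (a.comm : ℝ) ≤ C₀ * √(1 / (1 - σ₂)) * Real.log (2 + A / ε + 1 / (1 - σ₂)) ∧
      (a.samples : ℝ) ≤ C₀ * (√(1 / (1 - σ₂)) + σ ^ 2 / (L ^ 2 * (1 - σ₂) ^ 3 * ε))
        * Real.log (2 + A / ε + 1 / (1 - σ₂)) ^ 2 ∧
      ∀ (n : ℕ) (Ξ Ω : Type*) [MeasurableSpace Ξ] [MeasurableSpace Ω]
        (P : Measure Ω) [IsProbabilityMeasure P] (p : Problem M n Ξ)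
        (ξ : ℕ → ℕ → ℕ → Fin M → Ω → Ξ), p.Standing L σ σ₂ → IsSampling P p.D ξ →
        ∀ s, InnerAccurate P p ξ L a A ε s := by
  refine ⟨10 ^ 9, by norm_num, fun M L σ σ₂ A ε hM hL hσ₂ hσ₂' hA hε => ?_⟩
  have hMpos : (0 : ℝ) < M := by exact_mod_cast hM
  obtain ⟨q, hq⟩ : ∃ q, q = 1 - σ₂ := ⟨_, rfl⟩
  have hqpos : 0 < q := by rw [hq]; linarith
  have hq1 : q ≤ 1 := by rw [hq]; linarith
  rw [← hq]
  set X := 2 + A / ε + 1 / q with hX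
  have hAε : 0 ≤ A / ε := by positivity
  have huq : 1 ≤ 1 / q := by rw [le_div_iff₀ hqpos]; linarith
  have hX2 : 2 ≤ X := by linarith
  have hAX : A / ε ≤ X := by linarith
  have hqX : 1 / q ≤ X := by linarith
  have hlog := half_le_log hX2
  obtain ⟨θ, hθ⟩ : ∃ θ, θ = √(q / 108) := ⟨_, rfl⟩
  have hθpos : 0 < θ := by rw [hθ]; positivity
  have hθ2 : 108 * θ ^ 2 = q := by rw [hθ, Real.sq_sqrt (by positivity)]; ring
  have hθ1 : θ ≤ 1 := by nlinarith
  have hθinv : 1 / θ ≤ 11 * √(1 / q) := by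
    rw [div_le_iff₀ hθpos, hθ, mul_assoc, ← Real.sqrt_mul (by positivity)]
    have : 1 / q * (q / 108) = 1 / 108 := by field_simp
    rw [this]
    have h2 : (1 / 11 : ℝ) ≤ √(1 / 108) := Real.le_sqrt_of_sq_le (by norm_num)
    linarith
  have hsq1 : 1 ≤ √(1 / q) := Real.one_le_sqrt.2 huq
  have hsqq : √(1 / q) ≤ 1 / q := by
    rw [Real.sqrt_le_left (by positivity)]
    nlinarith
  -- This makes the contribution 5186δ/q² of the local errors at most ε/2.
  obtain ⟨δ, hδ⟩ : ∃ δ, δ = q ^ 2 * ε / 10400 := ⟨_, rfl⟩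
  have hδpos : 0 < δ := by rw [hδ]; positivity
  -- The first summand enforces 9ηL ≤ 1, the second keeps the noise floor ησ²/L below δ/2.
  obtain ⟨η, hη⟩ : ∃ η, η = 1 / (9 * L + 2 * σ ^ 2 / (δ * L)) := ⟨_, rfl⟩
  have hden : 0 < 9 * L + 2 * σ ^ 2 / (δ * L) := by positivity
  have hηpos : 0 < η := by rw [hη]; positivity
  have hη9 : η * (9 * L) ≤ 1 := by
    rw [hη, div_mul_eq_mul_div, one_mul, div_le_one hden]
    have : 0 ≤ 2 * σ ^ 2 / (δ * L) := by positivity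
    linarith
  have hηL1 : η * L ≤ 1 := by nlinarith [mul_pos hηpos hL]
  have hησ : η * σ ^ 2 / L ≤ δ / 2 := by
    rw [hη, div_le_iff₀ hL, div_mul_eq_mul_div, one_mul, div_le_iff₀ hden]
    have : δ / 2 * L * (9 * L + 2 * σ ^ 2 / (δ * L)) = 9 / 2 * δ * L ^ 2 + σ ^ 2 := by
      field_simp
    rw [this]
    have : 0 ≤ 9 / 2 * δ * L ^ 2 := by positivity
    linarith
  -- B₁ and B₂ are the factors by which the outer loop must reduce the initial dual error and one
  -- local phase must reduce its starting error.
  obtain ⟨B₁, hB₁⟩ : ∃ B₁, B₁ = 600 * A / (q ^ 2 * ε) + 1 := ⟨_, rfl⟩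
  have hB₁pos : 0 < B₁ := by rw [hB₁]; positivity
  obtain ⟨B₂, hB₂⟩ : ∃ B₂, B₂ = 32000 * (A + δ) / (δ * q ^ 2) := ⟨_, rfl⟩
  have hB₂pos : 0 < B₂ := by rw [hB₂]; positivity
  have hX1 : 1 ≤ X := by linarith
  have hB₁X : Real.log B₁ ≤ 13 * Real.log X := by
    have e1 : B₁ = 600 * ((A / ε) * (1 / q) ^ 2) + 1 := by rw [hB₁]; field_simp
    have e2 := log_mul_pow_add_le (c := 600) (b := 0) (j := 2) hX2 hAX hqX hAε (by positivity)
      (by norm_num) (c' := 1) (by norm_num) one_pos (a := 10) (by norm_num)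
    rw [pow_zero, mul_one] at e2
    rw [e1]
    push_cast at e2
    linarith
  have hB₂X : Real.log B₂ ≤ 34 * Real.log X := by
    have e1 : B₂ = 332800000 * ((A / ε) * (1 / q) ^ 4) + 32000 * (1 / q) ^ 2 := by
      rw [hB₂, hδ]; field_simp; ring
    have e2 := log_mul_pow_add_le (c := 332800000) (b := 2) (j := 4) hX2 hAX hqX hAε (by positivity)
      (by norm_num) (c' := 32000) (by norm_num) (by norm_num) (a := 29) (by norm_num)
    rw [e1]
    push_cast at e2
    linarith
  have hB₁1 : 1 ≤ B₁ := by
    rw [hB₁]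
    have : 0 ≤ 600 * A / (q ^ 2 * ε) := by positivity
    linarith
  obtain ⟨T, hT⟩ : ∃ T, T = ⌈Real.log B₁ / (θ / 2)⌉₊ := ⟨_, rfl⟩
  obtain ⟨K, hK⟩ : ∃ K, K = ⌈34 * Real.log X / (η * L)⌉₊ := ⟨_, rfl⟩
  have hTle : (T : ℝ) + 1 ≤ 300 * √(1 / q) * Real.log X := by
    have h1 : (T : ℝ) < Real.log B₁ / (θ / 2) + 1 := by
      rw [hT]
      exact Nat.ceil_lt_add_one (div_nonneg (Real.log_nonneg hB₁1) (by positivity))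
    have h2 : Real.log B₁ / (θ / 2) ≤ 286 * √(1 / q) * Real.log X := by
      calc Real.log B₁ / (θ / 2) ≤ 13 * Real.log X / (θ / 2) := by gcongr
        _ = 26 * Real.log X * (1 / θ) := by field_simp; ring
        _ ≤ 26 * Real.log X * (11 * √(1 / q)) := by gcongr
        _ = _ := by ring
    nlinarith [mul_le_mul hsq1 hlog (by norm_num) (by linarith)]
  have hKle : (K : ℝ) ≤ 10 ^ 6 * (1 + σ ^ 2 / (L ^ 2 * q ^ 2 * ε)) * Real.log X := by
    have h1 : (K : ℝ) < 34 * Real.log X / (η * L) + 1 := by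
      rw [hK]
      exact Nat.ceil_lt_add_one (by positivity)
    have h2 : 1 / (η * L) = 9 + 20800 * (σ ^ 2 / (L ^ 2 * q ^ 2 * ε)) := by
      rw [hη, hδ]; field_simp; ring
    have h3 : 34 * Real.log X / (η * L) = 34 * Real.log X * (1 / (η * L)) := by ring
    rw [h3, h2] at h1
    have h4 : 0 ≤ σ ^ 2 / (L ^ 2 * q ^ 2 * ε) := by positivity
    nlinarith [mul_nonneg h4 (by linarith : (0 : ℝ) ≤ Real.log X)]
  have hβ : 0 ≤ (1 - θ) / (1 + θ) := div_nonneg (by linarith) (by linarith)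
  refine ⟨⟨T, K, fun _ => M * η, L / (12 * M), (1 - θ) / (1 + θ), fun _ => by positivity,
    by positivity, hβ⟩, ?_, ?_, ?_⟩
  · simp only [AccParams.comm]
    push_cast
    refine hTle.trans ?_
    gcongr
    norm_num
  · simp only [AccParams.samples]
    push_cast
    calc ((T : ℝ) + 1) * K ≤ (300 * √(1 / q) * Real.log X)
          * (10 ^ 6 * (1 + σ ^ 2 / (L ^ 2 * q ^ 2 * ε)) * Real.log X) := by gcongr
      _ = 3 * 10 ^ 8 * (√(1 / q) + √(1 / q) * (σ ^ 2 / (L ^ 2 * q ^ 2 * ε))) * Real.log X ^ 2 := by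
          ring
      _ ≤ 10 ^ 9 * (√(1 / q) + 1 / q * (σ ^ 2 / (L ^ 2 * q ^ 2 * ε))) * Real.log X ^ 2 := by
          gcongr
          norm_num
      _ = _ := by
          congr 3
          field_simp
  · intro n Ξ Ω _ _ P _ p ξ hp hξ s y x z hy hx hz hA1 hA2
    have hmain := upperMean_accGaMsgd (a := ⟨T, K, fun _ => M * η, L / (12 * M),
      (1 - θ) / (1 + θ), fun _ => by positivity, by positivity, hβ⟩) hp hξ hM hL hσ₂ hσ₂' hy hx
      rfl rfl rfl hηpos hη9 hθpos (hθ2.trans hq) hδpos.le hA ?_ hz hA1 hA2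
    · refine hmain.mono (fun ω => le_rfl) ?_
      simp only
      rw [← hq]
      gcongr
      rw [div_le_iff₀ (by positivity)]
      have h1 : (1 - θ / 2) ^ T ≤ 1 / B₁ :=
        one_sub_pow_le (by positivity) (by linarith) hB₁pos (by rw [hT]; exact Nat.le_ceil _)
      have h2 : 288 * A * (1 - θ / 2) ^ T ≤ 288 / 600 * (q ^ 2 * ε) := by
        calc 288 * A * (1 - θ / 2) ^ T ≤ 288 * A * (1 / B₁) := by gcongr
          _ ≤ _ := by
            rw [mul_one_div, div_le_iff₀ hB₁pos, hB₁]
            have : 288 / 600 * (q ^ 2 * ε) * (600 * A / (q ^ 2 * ε) + 1)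
                = 288 * A + 288 / 600 * (q ^ 2 * ε) := by field_simp
            rw [this]
            have : 0 ≤ 288 / 600 * (q ^ 2 * ε) := by positivity
            linarith
      have h3 : 5186 * δ ≤ 1 / 2 * (q ^ 2 * ε) := by
        rw [hδ]
        have : 0 ≤ q ^ 2 * ε := by positivity
        linarith
      have : 0 ≤ q ^ 2 * ε := by positivity
      linarith
    · simp only
      rw [← hq]
      have h1 : (1 - η * L) ^ K ≤ 1 / B₂ := by
        refine one_sub_pow_le (by positivity) hηL1 hB₂pos ?_
        rw [hK]
        refine le_trans ?_ (Nat.le_ceil _)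
        gcongr
      have h2 : (1 - η * L) ^ K * (16000 * (A + δ) / q ^ 2) ≤ δ / 2 := by
        calc _ ≤ 1 / B₂ * (16000 * (A + δ) / q ^ 2) := by gcongr
          _ = _ := by rw [hB₂]; field_simp; norm_num
      linarith

end DecOpt

namespace DecOpt

/-! ### Inexact accelerated proximal point steps -/

section Prox
variable {n : ℕ} {L μ : ℝ} {f : Vec n → ℝ}

/-- The regularized function grows like (μ + 2L)/2 ‖u − z‖² around its stationary point z, and its
3L-smoothness carries the bound from z to the inexact x. The sign of μ is free: the convex case
takes μ = 0 and the nonconvex one μ = −L. -/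
theorem prox_inequality (hf : SmoothWith L f)
    (hsc : ∀ x u, f x + inner ℝ (gradient f x) (u - x) + μ / 2 * ‖u - x‖ ^ 2 ≤ f u)
    {y z : Vec n} (hz : gradient f z + (2 * L) • z = (2 * L) • y) (x u : Vec n) :
    f x + L * ‖x - y‖ ^ 2 + (μ + 2 * L) / 2 * ‖u - z‖ ^ 2
      ≤ f u + L * ‖u - y‖ ^ 2 + 3 * L / 2 * ‖x - z‖ ^ 2 := by
  have h1 := (hf.regularized_bregman y z x).2
  have h2 : gradient f z + (2 * L) • (z - y) = 0 := by
    rw [smul_sub, ← add_sub_assoc, hz, sub_self]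
  rw [h2, inner_zero_left] at h1
  have h3 := hsc z u
  have h4 : gradient f z = -((2 * L) • (z - y)) := eq_neg_of_add_eq_zero_left h2
  rw [h4, inner_neg_left, inner_smul_left] at h3
  simp only [conj_trivial] at h3
  have e : u - y = (u - z) + (z - y) := by abel
  rw [e, norm_add_sq_real, real_inner_comm]
  nlinarith

theorem norm_sub_sq_ge (u x z : Vec n) :
    ‖u - x‖ ^ 2 - 2 * ‖u - x‖ * ‖x - z‖ ≤ ‖u - z‖ ^ 2 := by
  have e : u - z = (u - x) + (x - z) := by abel
  have h1 := (abs_le.1 (abs_real_inner_le_norm (u - x) (x - z))).1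
  rw [e, norm_add_sq_real]
  nlinarith [sq_nonneg ‖x - z‖]

theorem strongly_convex_comb
    (hsc : ∀ x u, f x + inner ℝ (gradient f x) (u - x) + μ / 2 * ‖u - x‖ ^ 2 ≤ f u)
    {a : ℝ} (ha : 0 ≤ a) (ha1 : a ≤ 1) (x w : Vec n) :
    f ((1 - a) • x + a • w) ≤ (1 - a) * f x + a * f w - a * (1 - a) * (μ / 2) * ‖w - x‖ ^ 2 := by
  set u := (1 - a) • x + a • w with hu
  have h1 := mul_le_mul_of_nonneg_left (hsc u x) (sub_nonneg.2 ha1)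
  have h2 := mul_le_mul_of_nonneg_left (hsc u w) ha
  have e1 : x - u = -(a • (w - x)) := by rw [hu]; module
  have e2 : w - u = (1 - a) • (w - x) := by rw [hu]; module
  rw [e1, inner_neg_right, inner_smul_right, norm_neg, norm_smul, mul_pow, Real.norm_eq_abs,
    sq_abs] at h1
  rw [e2, inner_smul_right, norm_smul, mul_pow, Real.norm_eq_abs, sq_abs] at h2
  nlinarith

/-- The term in b ≤ V' is moved to the left. Then (1 − 0.05a)(1 − 0.95a) ≥ 1 − a and 34 · 0.95 ≥
31.5. -/
theorem absorb_error {a b V V' E : ℝ} (ha : 0 < a) (ha1 : a ≤ 1) (hV : 0 ≤ V) (hE : 0 ≤ E)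
    (hb : b ≤ V') (h : V' ≤ (1 - a) * V + 0.05 * a * b + 31.5 * E) :
    V' ≤ (1 - 0.95 * a) * V + 34 * E := by
  have h1 : (1 - 0.05 * a) * V' ≤ (1 - a) * V + 31.5 * E := by
    nlinarith [mul_le_mul_of_nonneg_left hb ha.le]
  have h2 : (1 - 0.05 * a) * V' ≤ (1 - 0.05 * a) * ((1 - 0.95 * a) * V + 34 * E) := by
    nlinarith [mul_nonneg (sq_nonneg a) hV, mul_nonneg (sub_nonneg.2 ha1) hE]
  exact le_of_mul_le_mul_left h2 (by linarith)

/-- One step of the accelerated inexact proximal point method, strongly convex case. -/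
theorem catalyst_step_strongly_convex (hf : SmoothWith L f) (hL : 0 < L) (hμ : 0 < μ)
    (hμL : μ ≤ L)
    (hsc : ∀ x u, f x + inner ℝ (gradient f x) (u - x) + μ / 2 * ‖u - x‖ ^ 2 ≤ f u)
    {a : ℝ} (ha : 0 < a) (ha1 : a ≤ 1) (ha2 : a ^ 2 * (μ + 2 * L) = μ) {xs x v y x' v' z : Vec n}
    (hxs : ∀ u, f xs ≤ f u) (hy : (1 + a) • y = x + a • v)
    (hv' : a • v' = a • x + (x' - x)) (hz : gradient f z + (2 * L) • z = (2 * L) • y) :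
    f x' - f xs + μ / 2 * ‖v' - xs‖ ^ 2
      ≤ (1 - 0.95 * a) * (f x - f xs + μ / 2 * ‖v - xs‖ ^ 2) + 34 * L / a * ‖x' - z‖ ^ 2 := by
  -- With this comparison point u − x' = −a(v' − xs), so the quadratic gain of the prox step becomes
  -- the distance term of the new potential.
  set u := (1 - a) • x + a • xs with hu
  have h1 := strongly_convex_comb hsc ha.le ha1 x xs
  rw [← hu] at h1
  have h2 := prox_inequality hf hsc hz x' u
  have h3 := norm_sub_sq_ge u x' z
  have e1 : u - x' = -(a • (v' - xs)) := by
    rw [smul_sub, hv', hu]; module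
  rw [e1, norm_neg, norm_smul, Real.norm_of_nonneg ha.le] at h3
  -- Since y = (x + a v)/(1 + a), the distance from u to y also involves xs − x; the resulting extra
  -- square is cancelled exactly by the strong convexity term in `h1`.
  have h4 : (1 + a) * ‖u - y‖ ^ 2 ≤ a ^ 2 * (‖v - xs‖ ^ 2 + a * ‖xs - x‖ ^ 2) := by
    have e2 : (1 + a) • (u - y) = a • (-(v - xs) + a • (xs - x)) := by
      rw [smul_sub, hy, hu]; module
    have h5 : (1 + a) * ‖u - y‖ ≤ a * (‖v - xs‖ + a * ‖xs - x‖) := by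
      have h6 := congrArg norm e2
      rw [norm_smul, norm_smul, Real.norm_of_nonneg ha.le, Real.norm_of_nonneg (by linarith)] at h6
      rw [h6]
      have h7 := norm_add_le (-(v - xs)) (a • (xs - x))
      rw [norm_neg, norm_smul, Real.norm_of_nonneg ha.le] at h7
      gcongr
    have h8 := pow_le_pow_left₀ (by positivity) h5 2
    have h9 : (‖v - xs‖ + a * ‖xs - x‖) ^ 2 ≤ (1 + a) * (‖v - xs‖ ^ 2 + a * ‖xs - x‖ ^ 2) := by
      nlinarith [mul_nonneg ha.le (sq_nonneg (‖v - xs‖ - ‖xs - x‖))]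
    have h10 : (1 + a) * ((1 + a) * ‖u - y‖ ^ 2)
        ≤ (1 + a) * (a ^ 2 * (‖v - xs‖ ^ 2 + a * ‖xs - x‖ ^ 2)) := by
      calc _ = ((1 + a) * ‖u - y‖) ^ 2 := by ring
        _ ≤ _ := h8
        _ = a ^ 2 * (‖v - xs‖ + a * ‖xs - x‖) ^ 2 := by ring
        _ ≤ a ^ 2 * ((1 + a) * (‖v - xs‖ ^ 2 + a * ‖xs - x‖ ^ 2)) := by gcongr
        _ = _ := by ring
    exact le_of_mul_le_mul_left h10 (by linarith)
  have h5 : L * ‖u - y‖ ^ 2 ≤ μ / 2 * (1 - a) * (‖v - xs‖ ^ 2 + a * ‖xs - x‖ ^ 2) := by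
    have e2 : 2 * L * a ^ 2 = μ * (1 - a) * (1 + a) := by linear_combination ha2
    have h6 : (1 + a) * (L * ‖u - y‖ ^ 2)
        ≤ (1 + a) * (μ / 2 * (1 - a) * (‖v - xs‖ ^ 2 + a * ‖xs - x‖ ^ 2)) := by
      calc _ = L * ((1 + a) * ‖u - y‖ ^ 2) := by ring
        _ ≤ L * (a ^ 2 * (‖v - xs‖ ^ 2 + a * ‖xs - x‖ ^ 2)) := by gcongr
        _ = (2 * L * a ^ 2) / 2 * (‖v - xs‖ ^ 2 + a * ‖xs - x‖ ^ 2) := by ring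
        _ = _ := by rw [e2]; ring
    exact le_of_mul_le_mul_left h6 (by linarith)
  set w := ‖v' - xs‖ with hw
  set r := ‖x' - z‖ with hr
  -- Young's inequality, balanced so that only 5% of the decrease aμ/2·w² is lost; the price is
  -- 30L/a · r². Together with 3/2 from `h10` this gives 31.5.
  have h6 : (μ + 2 * L) / 2 * (2 * (a * w) * r) ≤ 0.025 * a * μ * w ^ 2 + 30 * L / a * r ^ 2 := by
    have h7 : 0 ≤ (μ + 2 * L) / a * (0.05 * a ^ 2 * w - r) ^ 2 := by positivity
    have h8 : 10 * ((μ + 2 * L) / a * (0.05 * a ^ 2 * w - r) ^ 2)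
        = 0.025 * a * (a ^ 2 * (μ + 2 * L)) * w ^ 2 - (μ + 2 * L) * a * w * r
          + 10 * (μ + 2 * L) / a * r ^ 2 := by
      field_simp
      ring
    rw [ha2] at h8
    have h9 : 10 * (μ + 2 * L) / a * r ^ 2 ≤ 30 * L / a * r ^ 2 := by
      have : 10 * (μ + 2 * L) ≤ 30 * L := by linarith
      gcongr
    linarith
  have h7 : (μ + 2 * L) / 2 * ((a * w) ^ 2 - 2 * (a * w) * r) ≤ (μ + 2 * L) / 2 * ‖u - z‖ ^ 2 := by
    gcongr
  have h8 : (μ + 2 * L) / 2 * (a * w) ^ 2 = μ / 2 * w ^ 2 := by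
    linear_combination w ^ 2 / 2 * ha2
  have h9 : 0 ≤ L * ‖x' - y‖ ^ 2 := by positivity
  have h10 : 3 * L / 2 * r ^ 2 ≤ 3 / 2 * L / a * r ^ 2 := by
    gcongr ?_ * _
    rw [le_div_iff₀ ha]
    nlinarith
  have h11 : f x' - f xs + μ / 2 * w ^ 2 ≤ (1 - a) * (f x - f xs + μ / 2 * ‖v - xs‖ ^ 2)
      + 0.05 * a * (μ / 2 * w ^ 2) + 31.5 * (L / a * r ^ 2) := by
    have e3 : 30 * L / a * r ^ 2 = 30 * (L / a * r ^ 2) := by ring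
    have e4 : 3 / 2 * L / a * r ^ 2 = 3 / 2 * (L / a * r ^ 2) := by ring
    rw [e3] at h6
    rw [e4] at h10
    rw [mul_sub, h8] at h7
    linarith
  have h12 : 0 ≤ f x' - f xs := sub_nonneg.2 (hxs x')
  have h13 : 0 ≤ f x - f xs := sub_nonneg.2 (hxs x)
  have h14 : 0 ≤ f x - f xs + μ / 2 * ‖v - xs‖ ^ 2 := by positivity
  have h15 : 0 ≤ L / a * r ^ 2 := by positivity
  have e5 : 34 * L / a * r ^ 2 = 34 * (L / a * r ^ 2) := by ring
  rw [e5]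
  exact absorb_error ha ha1 h14 h15 (le_add_of_nonneg_left h12) h11

/-- One step of the accelerated inexact proximal point method, convex case. -/
theorem catalyst_step_convex (hf : SmoothWith L f) (hL : 0 < L)
    (hsc : ∀ x u, f x + inner ℝ (gradient f x) (u - x) ≤ f u)
    {a c : ℝ} (ha : 0 < a) (ha1 : a ≤ 1) (hc : 0 < c) (hc1 : c ≤ 1 / 2) {xs x v y x' v' z : Vec n}
    (hxs : ∀ u, f xs ≤ f u) (hy : y = (1 - a) • x + a • v)
    (hv' : a • v' = a • x + (x' - x)) (hz : gradient f z + (2 * L) • z = (2 * L) • y) :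
    1 / a ^ 2 * (f x' - f xs) + L * ‖v' - xs‖ ^ 2
      ≤ (1 + 2 * c) * ((1 - a) / a ^ 2 * (f x - f xs) + L * ‖v - xs‖ ^ 2
        + 2 * L / (c * a ^ 2) * ‖x' - z‖ ^ 2) := by
  have hsc' : ∀ x u, f x + inner ℝ (gradient f x) (u - x) + (0 : ℝ) / 2 * ‖u - x‖ ^ 2 ≤ f u := by
    intro x u
    simpa using hsc x u
  set u := (1 - a) • x + a • xs with hu
  have h1 := strongly_convex_comb hsc' ha.le ha1 x xs
  rw [← hu] at h1
  have h2 := prox_inequality hf hsc' hz x' u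
  have h3 := norm_sub_sq_ge u x' z
  have e1 : u - x' = -(a • (v' - xs)) := by
    rw [smul_sub, hv', hu]; module
  have e2 : u - y = -(a • (v - xs)) := by
    rw [hy, hu]; module
  rw [e1, norm_neg, norm_smul, Real.norm_of_nonneg ha.le] at h3
  rw [e2, norm_neg, norm_smul, Real.norm_of_nonneg ha.le] at h2
  set w := ‖v' - xs‖ with hw
  set r := ‖x' - z‖ with hr
  have h9 : 0 ≤ L * ‖x' - y‖ ^ 2 := by positivity
  have h12 : 0 ≤ f x' - f xs := sub_nonneg.2 (hxs x')
  have h13 : 0 ≤ f x - f xs := sub_nonneg.2 (hxs x)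
  -- Without strong convexity nothing contracts, so the loss c in Young's inequality remains as a
  -- multiplicative factor. It is left free in order to be summable over the rounds.
  have h6 : L * (2 * (a * w) * r) ≤ c * (L * (a * w) ^ 2) + L / c * r ^ 2 := by
    have h7 : 0 ≤ L / c * (c * (a * w) - r) ^ 2 := by positivity
    have h8 : L / c * (c * (a * w) - r) ^ 2
        = c * (L * (a * w) ^ 2) - L * (2 * (a * w) * r) + L / c * r ^ 2 := by
      field_simp
      ring
    linarith
  have h10 : 3 * L / 2 * r ^ 2 ≤ L / c * r ^ 2 := by
    gcongr ?_ * _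
    rw [le_div_iff₀ hc]
    nlinarith
  have h11 : (1 - c) * (f x' - f xs + L * (a * w) ^ 2)
      ≤ (1 - a) * (f x - f xs) + L * (a * ‖v - xs‖) ^ 2 + 2 * L / c * r ^ 2 := by
    have e3 : 2 * L / c * r ^ 2 = 2 * (L / c * r ^ 2) := by ring
    nlinarith [mul_le_mul_of_nonneg_left h3 hL.le, mul_nonneg hc.le h12]
  set E := (1 - a) * (f x - f xs) + L * (a * ‖v - xs‖) ^ 2 + 2 * L / c * r ^ 2 with hE
  have hE0 : 0 ≤ E := by
    have := mul_nonneg (sub_nonneg.2 ha1) h13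
    positivity
  -- This is 1/(1 − c) ≤ 1 + 2c for c ≤ 1/2.
  have h14 : f x' - f xs + L * (a * w) ^ 2 ≤ (1 + 2 * c) * E := by
    have h15 : (1 - c) * (f x' - f xs + L * (a * w) ^ 2) ≤ (1 - c) * ((1 + 2 * c) * E) := by
      have : 0 ≤ c * (1 - 2 * c) * E := by
        have : 0 ≤ 1 - 2 * c := by linarith
        positivity
      nlinarith
    exact le_of_mul_le_mul_left h15 (by linarith)
  have h15 : 1 / a ^ 2 * (f x' - f xs + L * (a * w) ^ 2) ≤ 1 / a ^ 2 * ((1 + 2 * c) * E) := by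
    gcongr
  calc _ = 1 / a ^ 2 * (f x' - f xs + L * (a * w) ^ 2) := by field_simp
    _ ≤ _ := h15
    _ = _ := by rw [hE]; field_simp

end Prox

end DecOpt

namespace DecOpt

/-! ### The rounds of Catalyst -/

section Averages
variable {M n : ℕ}

theorem avg_add (x y : Fin M → Vec n) : avg (fun m => x m + y m) = avg x + avg y := by
  simp [avg, Finset.sum_add_distrib]

theorem avg_sub (x y : Fin M → Vec n) : avg (fun m => x m - y m) = avg x - avg y := by
  simp [avg, Finset.sum_sub_distrib, smul_sub]

theorem avg_smul (c : ℝ) (x : Fin M → Vec n) : avg (fun m => c • x m) = c • avg x := by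
  simp [avg, ← Finset.smul_sum, smul_comm c]

theorem avg_const (hM : 0 < M) (x : Vec n) : avg (fun _ : Fin M => x) = x := by
  have hMpos : (M : ℝ) ≠ 0 := by positivity
  simp only [avg, Finset.sum_const, Finset.card_univ, Fintype.card_fin]
  rw [← Nat.cast_smul_eq_nsmul ℝ, smul_smul, one_div_mul_cancel hMpos, one_smul]

theorem norm_avg_sq_le (hM : 0 < M) (x : Fin M → Vec n) :
    M * ‖avg x‖ ^ 2 ≤ ∑ m, ‖x m‖ ^ 2 := by
  have hMpos : (0 : ℝ) < M := by exact_mod_cast hM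
  have h1 : ‖avg x‖ ≤ (1 / (M : ℝ)) * ∑ m, ‖x m‖ := by
    rw [avg, norm_smul, Real.norm_of_nonneg (by positivity)]
    gcongr
    exact norm_sum_le _ _
  have h2 : (∑ m, ‖x m‖) ^ 2 ≤ M * ∑ m, ‖x m‖ ^ 2 := by
    have := sq_sum_le_card_mul_sum_sq (s := Finset.univ) (f := fun m => ‖x m‖)
    simpa using this
  calc M * ‖avg x‖ ^ 2 ≤ M * ((1 / (M : ℝ)) * ∑ m, ‖x m‖) ^ 2 := by gcongr
    _ = (∑ m, ‖x m‖) ^ 2 / M := by field_simp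
    _ ≤ _ := by rw [div_le_iff₀ hMpos]; linarith

theorem norm_avg_sub_sq_le (hM : 0 < M) (x : Fin M → Vec n) (z : Vec n) :
    M * ‖avg x - z‖ ^ 2 ≤ ∑ m, ‖x m - z‖ ^ 2 := by
  have h := norm_avg_sq_le hM (fun m => x m - z)
  rwa [avg_sub, avg_const hM] at h

end Averages

/-! ### The averaged objective and the objective of a subproblem -/

section Objective
variable {M n : ℕ} {Ξ : Type*} [MeasurableSpace Ξ] {p : Problem M n Ξ} {L σ σ₂ : ℝ}

theorem hasGradientAt_obj (hF : ∀ m, SmoothWith L (p.F m)) (x : Vec n) :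
    HasGradientAt p.obj ((1 / (M : ℝ)) • ∑ m, gradient (p.F m) x) x := by
  rw [hasGradientAt_iff_hasFDerivAt]
  have h1 : HasFDerivAt (fun x => ∑ m, p.F m x)
      (∑ m, InnerProductSpace.toDual ℝ (Vec n) (gradient (p.F m) x)) x :=
    HasFDerivAt.fun_sum fun m _ => ((hF m).1 x).hasGradientAt.hasFDerivAt
  have h2 := h1.const_mul (1 / (M : ℝ))
  have e : InnerProductSpace.toDual ℝ (Vec n) ((1 / (M : ℝ)) • ∑ m, gradient (p.F m) x)
      = (1 / (M : ℝ)) • ∑ m, InnerProductSpace.toDual ℝ (Vec n) (gradient (p.F m) x) := by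
    simp [map_sum]
  rw [e]
  exact h2

theorem gradient_obj (hF : ∀ m, SmoothWith L (p.F m)) (x : Vec n) :
    gradient p.obj x = (1 / (M : ℝ)) • ∑ m, gradient (p.F m) x :=
  (hasGradientAt_obj hF x).gradient

theorem smoothWith_obj (hM : 0 < M) (hF : ∀ m, SmoothWith L (p.F m)) : SmoothWith L p.obj := by
  have hMpos : (0 : ℝ) < M := by exact_mod_cast hM
  refine ⟨fun x => (hasGradientAt_obj hF x).differentiableAt, fun x y => ?_⟩
  rw [gradient_obj hF, gradient_obj hF, ← smul_sub, ← Finset.sum_sub_distrib, norm_smul,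
    Real.norm_of_nonneg (by positivity)]
  calc _ ≤ 1 / (M : ℝ) * ∑ _m : Fin M, L * ‖x - y‖ := by
        gcongr
        exact (norm_sum_le _ _).trans (Finset.sum_le_sum fun m _ => (hF m).2 x y)
    _ = _ := by
        rw [Finset.sum_const, Finset.card_univ, Fintype.card_fin, nsmul_eq_mul]
        field_simp

theorem obj_lower_bound (hM : 0 < M) (hF : ∀ m, SmoothWith L (p.F m)) {μ : ℝ}
    (h : ∀ m x u, p.F m x + inner ℝ (gradient (p.F m) x) (u - x) + μ / 2 * ‖u - x‖ ^ 2 ≤ p.F m u)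
    (x u : Vec n) :
    p.obj x + inner ℝ (gradient p.obj x) (u - x) + μ / 2 * ‖u - x‖ ^ 2 ≤ p.obj u := by
  have hMpos : (0 : ℝ) < M := by exact_mod_cast hM
  have h1 := Finset.sum_le_sum fun m (_ : m ∈ Finset.univ) => h m x u
  rw [Finset.sum_add_distrib, Finset.sum_add_distrib, Finset.sum_const, Finset.card_univ,
    Fintype.card_fin, nsmul_eq_mul] at h1
  rw [gradient_obj hF, inner_smul_left, sum_inner, Problem.obj, Problem.obj]
  simp only [conj_trivial]
  have h2 := mul_le_mul_of_nonneg_left h1 (by positivity : 0 ≤ 1 / (M : ℝ))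
  refine le_trans (le_of_eq ?_) h2
  field_simp

theorem norm_gradient_obj_sq_le (hM : 0 < M) (hF : ∀ m, SmoothWith L (p.F m)) {G : ℝ}
    (hG : p.InitGradBound G) : ‖gradient p.obj p.x0‖ ^ 2 ≤ G ^ 2 := by
  have hMpos : (0 : ℝ) < M := by exact_mod_cast hM
  have h1 := norm_avg_sq_le hM (fun m => gradient (p.F m) p.x0)
  rw [gradient_obj hF]
  refine le_trans ?_ hG
  rw [one_div_mul_eq_div, le_div_iff₀ hMpos, mul_comm]
  exact h1

/-- The suboptimality in the regularised problem is controlled by the distance to its solution. -/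
theorem subObj_sub_iInf_le (hM : 0 < M) (hL : 0 < L) (hF : ∀ m, SmoothWith L (p.F m))
    {y : Fin M → Vec n} {z : Vec n}
    (hz : gradient p.obj z + (2 * L) • z = (2 * L) • avg y) (x : Vec n) :
    p.subObj L y x - ⨅ u, p.subObj L y u ≤ 3 * L / 2 * ‖x - z‖ ^ 2 := by
  have hMpos : (0 : ℝ) < M := by exact_mod_cast hM
  -- The centres enter only through their average, up to a constant independent of u. Hence the
  -- exact step on the subproblem is a proximal step of F at the average centre.
  have hsum : ∀ u, p.subObj L y u = p.obj u + L * ‖u - avg y‖ ^ 2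
      + (p.subObj L y 0 - p.obj 0 - L * ‖avg y‖ ^ 2) := by
    intro u
    have h1 : ∀ u, p.subObj L y u = p.obj u + L * ‖u‖ ^ 2 - 2 * L * inner ℝ u (avg y)
        + 1 / (M : ℝ) * ∑ m, L * ‖y m‖ ^ 2 := by
      intro u
      have e : ∀ m, p.F m u + L * ‖u - y m‖ ^ 2
          = p.F m u + L * ‖u‖ ^ 2 - 2 * L * inner ℝ u (y m) + L * ‖y m‖ ^ 2 := by
        intro m
        rw [norm_sub_sq_real]
        ring
      rw [Problem.subObj]
      simp only [e]
      rw [Finset.sum_add_distrib, Finset.sum_sub_distrib, Finset.sum_add_distrib,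
        Finset.sum_const, Finset.card_univ, Fintype.card_fin, nsmul_eq_mul, ← Finset.mul_sum,
        ← inner_sum, Problem.obj, avg, inner_smul_right]
      field_simp
    rw [h1 u, h1 0, norm_sub_sq_real]
    simp
    ring
  have hs := smoothWith_obj hM hF
  have hz0 : gradient p.obj z + (2 * L) • (z - avg y) = 0 := by
    rw [smul_sub, ← add_sub_assoc, hz, sub_self]
  have hmin : p.subObj L y z ≤ ⨅ u, p.subObj L y u := by
    refine le_ciInf fun u => ?_
    have h2 := (hs.regularized_bregman (avg y) z u).1
    rw [hz0, inner_zero_left] at h2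
    rw [hsum z, hsum u]
    have : 0 ≤ L / 2 * ‖u - z‖ ^ 2 := by positivity
    linarith
  have h2 := (hs.regularized_bregman (avg y) z x).2
  rw [hz0, inner_zero_left] at h2
  rw [hsum x]
  rw [hsum z] at hmin
  linarith

end Objective

end DecOpt

namespace DecOpt

/-! ### Propagation of errors between rounds -/

section Rounds
variable {M n : ℕ} {Ξ Ω : Type*} [MeasurableSpace Ξ]

/-- The exact solution of the subproblem of round `s`. -/
noncomputable def Problem.proxPoint (p : Problem M n Ξ) (L : ℝ) (r : Regime) (par : ℕ → AccParams)
    (ξ : ℕ → ℕ → ℕ → Fin M → Ω → Ξ) (s : ℕ) (ω : Ω) : Vec n :=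
  resolvent L p.obj ((2 * L) • avg (p.run L r par ξ s ω).y)

/-- The squared distance of the clients' iterates to the solution of the subproblem. -/
noncomputable def Problem.errSq (p : Problem M n Ξ) (L : ℝ) (r : Regime) (par : ℕ → AccParams)
    (ξ : ℕ → ℕ → ℕ → Fin M → Ω → Ξ) (s : ℕ) (ω : Ω) : ℝ :=
  ∑ m, ‖(p.run L r par ξ s ω).x m - p.proxPoint L r par ξ s ω‖ ^ 2

/-- The squared distance of the clients' iterates to the starting point. -/
noncomputable def Problem.devSq (p : Problem M n Ξ) (L : ℝ) (r : Regime) (par : ℕ → AccParams)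
    (ξ : ℕ → ℕ → ℕ → Fin M → Ω → Ξ) (s : ℕ) (ω : Ω) : ℝ :=
  ∑ m, ‖(p.run L r par ξ s ω).x m - p.x0‖ ^ 2

variable {p : Problem M n Ξ} {L σ σ₂ : ℝ} {r : Regime} {par : ℕ → AccParams}
  {ξ : ℕ → ℕ → ℕ → Fin M → Ω → Ξ}

theorem proxPoint_eq (hM : 0 < M) (hL : 0 < L) (hF : ∀ m, SmoothWith L (p.F m)) (s : ℕ) (ω : Ω) :
    gradient p.obj (p.proxPoint L r par ξ s ω) + (2 * L) • p.proxPoint L r par ξ s ω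
      = (2 * L) • avg (p.run L r par ξ s ω).y :=
  (smoothWith_obj hM hF).resolvent_eq hL _

theorem norm_xbar_sub_proxPoint_sq_le (hM : 0 < M) (s : ℕ) (ω : Ω) :
    ‖p.xbar L r par ξ s ω - p.proxPoint L r par ξ s ω‖ ^ 2
      ≤ 1 / (M : ℝ) * p.errSq L r par ξ s ω := by
  have hMpos : (0 : ℝ) < M := by exact_mod_cast hM
  rw [one_div_mul_eq_div, le_div_iff₀ hMpos, mul_comm]
  exact norm_avg_sub_sq_le hM _ _

theorem avg_y_succ (s : ℕ) (ω : Ω) : avg (p.run L r par ξ (s + 2) ω).y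
    = p.xbar L r par ξ (s + 1) ω
      + r.beta L (s + 1) • (p.xbar L r par ξ (s + 1) ω - p.xbar L r par ξ s ω) := by
  rw [Problem.xbar, Problem.xbar, ← avg_sub, ← avg_smul, ← avg_add]
  rfl

theorem xbar_zero (hM : 0 < M) (ω : Ω) : p.xbar L r par ξ 0 ω = p.x0 := avg_const hM _

theorem avg_y_one (hM : 0 < M) (ω : Ω) : avg (p.run L r par ξ 1 ω).y = p.x0 := avg_const hM _

variable [mΩ : MeasurableSpace Ω] {P : Measure Ω} [IsProbabilityMeasure P]

theorem upperMean_zero {f : Ω → ℝ} {c : ℝ} (hf : ∀ ω, f ω = 0) (hc : 0 ≤ c) : UpperMean P f c :=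
  (UpperMean.const (P := P) 0).mono (fun ω => (hf ω).le) hc

/-- Passes from the average to the individual clients through the prox point: the error bounds both
the distance of the clients and that of their average to it. -/
theorem upperMean_dev (hM : 0 < M) {s : ℕ} {ε D : ℝ} (hε : 0 ≤ ε) (hD : 0 ≤ D)
    (h1 : UpperMean P (p.errSq L r par ξ s) (M * ε))
    (h2 : UpperMean P (fun ω => ‖p.xbar L r par ξ s ω - p.x0‖ ^ 2) D) :
    UpperMean P (p.devSq L r par ξ s) (M * (6 * ε + 4 * D)) := by
  have hMpos : (0 : ℝ) < M := by exact_mod_cast hM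
  refine ((h1.const_mul (by norm_num : (0 : ℝ) ≤ 6)).add
    (h2.const_mul (by positivity : (0 : ℝ) ≤ 4 * M)) (by positivity) (by positivity)).mono
    (fun ω => ?_) (le_of_eq (by ring))
  set z := p.proxPoint L r par ξ s ω with hz
  set X := p.xbar L r par ξ s ω with hX
  have h3 := norm_xbar_sub_proxPoint_sq_le (p := p) (L := L) (r := r) (par := par) (ξ := ξ) hM s ω
  rw [← hz, ← hX] at h3
  have h4 : M * ‖X - z‖ ^ 2 ≤ p.errSq L r par ξ s ω := by
    have := mul_le_mul_of_nonneg_left h3 hMpos.le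
    rwa [← mul_assoc, mul_one_div_cancel hMpos.ne', one_mul] at this
  have h5 : ‖z - p.x0‖ ^ 2 ≤ 2 * (‖X - z‖ ^ 2 + ‖X - p.x0‖ ^ 2) := by
    refine sq_le_two_mul (norm_nonneg _) ?_
    have e : z - p.x0 = -(X - z) + (X - p.x0) := by abel
    rw [e]
    exact (norm_add_le _ _).trans (by rw [norm_neg])
  have h6 : p.devSq L r par ξ s ω ≤ 2 * p.errSq L r par ξ s ω + 2 * M * ‖z - p.x0‖ ^ 2 := by
    rw [Problem.devSq, Problem.errSq, Finset.mul_sum, ← hz]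
    have e : 2 * M * ‖z - p.x0‖ ^ 2 = ∑ _m : Fin M, 2 * ‖z - p.x0‖ ^ 2 := by
      rw [Finset.sum_const, Finset.card_univ, Fintype.card_fin, nsmul_eq_mul]; ring
    rw [e, ← Finset.sum_add_distrib]
    refine Finset.sum_le_sum fun m _ => ?_
    rw [← mul_add]
    refine sq_le_two_mul (norm_nonneg _) ?_
    exact norm_sub_le_norm_sub_add_norm_sub _ _ _
  nlinarith [mul_le_mul_of_nonneg_left h5 hMpos.le]

theorem upperMean_yNext {B : ℝ} (hB : 0 ≤ B)
    (hβ : ∀ s, 0 ≤ r.beta L (s + 1) ∧ r.beta L (s + 1) ≤ 1) (s : ℕ)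
    (h : ∀ s' ≤ s, UpperMean P (p.devSq L r par ξ s') (M * B)) :
    UpperMean P (fun ω => ∑ m, ‖(p.run L r par ξ s ω).yNext m - p.x0‖ ^ 2) (M * (10 * B)) := by
  cases s with
  | zero =>
    refine upperMean_zero (fun ω => Finset.sum_eq_zero fun m _ => ?_) (by positivity)
    change ‖p.x0 - p.x0‖ ^ 2 = 0
    simp
  | succ s =>
    refine (((h (s + 1) le_rfl).const_mul (by norm_num : (0 : ℝ) ≤ 8)).add
      ((h s (by omega)).const_mul (by norm_num : (0 : ℝ) ≤ 2)) (by positivity)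
      (by positivity)).mono (fun ω => ?_) (le_of_eq (by ring))
    rw [Problem.devSq, Problem.devSq, Finset.mul_sum, Finset.mul_sum, ← Finset.sum_add_distrib]
    refine Finset.sum_le_sum fun m _ => ?_
    set x' := (p.run L r par ξ (s + 1) ω).x m with hx'
    set x := (p.run L r par ξ s ω).x m with hx
    have e : (p.run L r par ξ (s + 1) ω).yNext m - p.x0
        = (1 + r.beta L (s + 1)) • (x' - p.x0) - r.beta L (s + 1) • (x - p.x0) := by
      have e1 : (p.run L r par ξ (s + 1) ω).yNext m = x' + r.beta L (s + 1) • (x' - x) := rfl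
      rw [e1]
      module
    obtain ⟨hβ0, hβ1⟩ := hβ s
    have h1 : ‖(p.run L r par ξ (s + 1) ω).yNext m - p.x0‖ ≤ 2 * ‖x' - p.x0‖ + ‖x - p.x0‖ := by
      rw [e]
      refine (norm_sub_le _ _).trans ?_
      rw [norm_smul, norm_smul, Real.norm_of_nonneg hβ0, Real.norm_of_nonneg (by linarith)]
      nlinarith [norm_nonneg (x' - p.x0), norm_nonneg (x - p.x0)]
    have := sq_le_two_mul (norm_nonneg _) h1
    nlinarith

theorem upperMean_y {B : ℝ} (hB : 0 ≤ B)
    (hβ : ∀ s, 0 ≤ r.beta L (s + 1) ∧ r.beta L (s + 1) ≤ 1) (s : ℕ)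
    (h : ∀ s' ≤ s, UpperMean P (p.devSq L r par ξ s') (M * B)) :
    UpperMean P (fun ω => ∑ m, ‖(p.run L r par ξ s ω).y m - p.x0‖ ^ 2) (M * (10 * B)) := by
  cases s with
  | zero =>
    refine upperMean_zero (fun ω => Finset.sum_eq_zero fun m _ => ?_) (by positivity)
    change ‖p.x0 - p.x0‖ ^ 2 = 0
    simp
  | succ s => exact upperMean_yNext hB hβ s fun s' hs => h s' (by omega)

theorem sq_le_four_mul {a b c d e : ℝ} (ha : 0 ≤ a) (h : a ≤ b + c + d + e) :
    a ^ 2 ≤ 4 * (b ^ 2 + c ^ 2 + d ^ 2 + e ^ 2) := by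
  have := pow_le_pow_left₀ ha h 2
  nlinarith [sq_nonneg (b - c), sq_nonneg (b - d), sq_nonneg (c - d), sq_nonneg (b - e),
    sq_nonneg (c - e), sq_nonneg (d - e)]

/-- If the iterates of the previous rounds stay near the starting point, then the next call of
Acc-GA-MSGD has the desired accuracy. -/
theorem upperMean_errSq_succ (hp : p.Standing L σ σ₂) (hM : 0 < M)
    (hL : 0 < L) {G B ε : ℝ} (hG : p.InitGradBound G) (hB : 0 ≤ B)
    (hβ : ∀ s, 0 ≤ r.beta L (s + 1) ∧ r.beta L (s + 1) ≤ 1)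
    (hw : 0 ≤ r.warm L ∧ r.warm L ≤ 1) {s : ℕ}
    (hacc : InnerAccurate P p ξ L (par (s + 1)) (40 * (G ^ 2 / L ^ 2) + 1600 * B) ε (s + 1))
    (h : ∀ s' ≤ s, UpperMean P (p.devSq L r par ξ s') (M * B)) :
    UpperMean P (p.errSq L r par ξ (s + 1)) (M * ε) := by
  have hMpos : (0 : ℝ) < M := by exact_mod_cast hM
  have hyN := upperMean_yNext hB hβ s h
  have hy := upperMean_y hB hβ s h
  have hx := h s le_rfl
  have hG0 : ∑ m, ‖gradient (p.F m) p.x0‖ ^ 2 ≤ M * G ^ 2 := by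
    have : (1 / (M : ℝ)) * ∑ m, ‖gradient (p.F m) p.x0‖ ^ 2 ≤ G ^ 2 := hG
    rwa [one_div_mul_eq_div, div_le_iff₀ hMpos, mul_comm] at this
  have hG1 := norm_gradient_obj_sq_le hM hp.smooth hG
  have hmeas : ∀ m, Measurable[past ξ (s + 1) 0 0] (fun ω => (p.run L r par ξ s ω).x m) ∧
      Measurable[past ξ (s + 1) 0 0] (fun ω => (p.run L r par ξ s ω).y m) ∧
      Measurable[past ξ (s + 1) 0 0] (fun ω => (p.run L r par ξ s ω).yNext m) := fun m =>
    @measurable_run M n Ξ Ω _ (past ξ (s + 1) 0 0) p hp.meas L r par ξ s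
      (fun s' hs t j m => measurable_past ξ m (by omega)) m
  refine hacc (fun ω => (p.run L r par ξ s ω).yNext)
    (fun ω m => (p.run L r par ξ s ω).x m + r.warm L
      • ((p.run L r par ξ s ω).yNext m - (p.run L r par ξ s ω).y m))
    (p.proxPoint L r par ξ (s + 1)) (fun m => (hmeas m).2.2) (fun m => (hmeas m).1.add
      (((hmeas m).2.2.sub (hmeas m).2.1).const_smul (r.warm L))) (fun ω => ?_) ?_ ?_
  · rw [← gradient_obj hp.smooth]
    exact proxPoint_eq hM hL hp.smooth (s + 1) ω
  -- The distance from the warm start to the local minimizers at multiplier 0 costs 4G²/L² + 36B +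
  -- 1000B + 360B, within the allowance 40G²/L² + 1600B.
  · refine ((((UpperMean.const (P := P) (4 * (M * (G ^ 2 / L ^ 2)))).add
      (hx.const_mul (by norm_num : (0 : ℝ) ≤ 36)) (by positivity) (by positivity)).add
      (hyN.const_mul (by norm_num : (0 : ℝ) ≤ 100)) (by positivity) (by positivity)).add
      (hy.const_mul (by norm_num : (0 : ℝ) ≤ 36)) (by positivity) (by positivity)).mono
      (fun ω => ?_) ?_
    · set x := (p.run L r par ξ s ω).x with hx0
      set y := (p.run L r par ξ s ω).y with hy0
      set yN := (p.run L r par ξ s ω).yNext with hyN0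
      have hm : ∀ m, ‖x m + r.warm L • (yN m - y m) - dualPoint L p.F yN 0 m‖ ^ 2
          ≤ 4 * ‖gradient (p.F m) p.x0‖ ^ 2 / L ^ 2 + 36 * ‖x m - p.x0‖ ^ 2
            + 100 * ‖yN m - p.x0‖ ^ 2 + 36 * ‖y m - p.x0‖ ^ 2 := by
        intro m
        obtain ⟨w0, w1⟩ := hw
        set v := x m + r.warm L • (yN m - y m) with hv
        have h1 := (hp.smooth m).norm_sub_resolvent_le hL v ((2 * L) • yN m - (0 : Fin M → Vec n) m)
        change L * ‖v - dualPoint L p.F yN 0 m‖ ≤ _ at h1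
        have hv1 : ‖v - p.x0‖ ≤ ‖x m - p.x0‖ + ‖yN m - p.x0‖ + ‖y m - p.x0‖ := by
          have e : v - p.x0 = (x m - p.x0) + r.warm L • ((yN m - p.x0) - (y m - p.x0)) := by
            rw [hv, sub_sub_sub_cancel_right]; abel
          rw [e]
          refine (norm_add_le _ _).trans ?_
          rw [norm_smul, Real.norm_of_nonneg w0, add_assoc]
          gcongr
          have h2 := norm_sub_le (yN m - p.x0) (y m - p.x0)
          nlinarith [norm_nonneg ((yN m - p.x0) - (y m - p.x0))]
        have e2 : gradient (p.F m) v + (2 * L) • v - ((2 * L) • yN m - (0 : Fin M → Vec n) m)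
            = gradient (p.F m) p.x0 + (gradient (p.F m) v - gradient (p.F m) p.x0)
              + (2 * L) • (v - p.x0) + (2 * L) • (p.x0 - yN m) := by
          simp only [Pi.zero_apply]
          module
        have h3 : ‖gradient (p.F m) v + (2 * L) • v - ((2 * L) • yN m - (0 : Fin M → Vec n) m)‖
            ≤ ‖gradient (p.F m) p.x0‖ + 3 * L * ‖v - p.x0‖ + 2 * L * ‖yN m - p.x0‖ := by
          rw [e2]
          refine (norm_add₄_le).trans ?_
          have h4 := (hp.smooth m).2 v p.x0
          rw [norm_smul, norm_smul, Real.norm_of_nonneg (by positivity), norm_sub_rev p.x0]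
          linarith
        have h5 : ‖v - dualPoint L p.F yN 0 m‖ ≤ ‖gradient (p.F m) p.x0‖ / L
            + 3 * ‖x m - p.x0‖ + 5 * ‖yN m - p.x0‖ + 3 * ‖y m - p.x0‖ := by
          have e3 : ‖gradient (p.F m) p.x0‖ / L
            + 3 * ‖x m - p.x0‖ + 5 * ‖yN m - p.x0‖ + 3 * ‖y m - p.x0‖
            = (‖gradient (p.F m) p.x0‖ + 3 * L * (‖x m - p.x0‖ + ‖yN m - p.x0‖ + ‖y m - p.x0‖)
              + 2 * L * ‖yN m - p.x0‖) / L := by field_simp; ring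
          rw [e3, le_div_iff₀ hL, mul_comm]
          refine h1.trans (h3.trans ?_)
          gcongr
        refine (sq_le_four_mul (norm_nonneg _) h5).trans (le_of_eq ?_)
        rw [div_pow]
        ring
      refine (Finset.sum_le_sum fun m _ => hm m).trans ?_
      rw [Finset.sum_add_distrib, Finset.sum_add_distrib, Finset.sum_add_distrib, ← Finset.mul_sum,
        ← Finset.mul_sum, ← Finset.mul_sum, ← Finset.sum_div, ← Finset.mul_sum]
      have : 4 * ∑ m, ‖gradient (p.F m) p.x0‖ ^ 2 / L ^ 2 ≤ 4 * (M * (G ^ 2 / L ^ 2)) := by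
        rw [← Finset.sum_div, ← mul_div_assoc (M : ℝ)]
        gcongr
      rw [← Finset.sum_div, ← mul_div_assoc] at this
      simp only [Problem.devSq]
      linarith
    · have : 0 ≤ M * B := by positivity
      have : 0 ≤ M * (G ^ 2 / L ^ 2) := by positivity
      linarith
  -- The size of the optimal multiplier; this estimate determines the constants 40 and 1600.
  · refine ((UpperMean.const (P := P) (40 * (M * G ^ 2))).add
      (hyN.const_mul (by positivity : (0 : ℝ) ≤ 160 * L ^ 2)) (by positivity) (by positivity)).mono
      (fun ω => ?_) ?_
    · set yN := (p.run L r par ξ s ω).yNext with hyN0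
      set z := p.proxPoint L r par ξ (s + 1) ω with hz
      have hz1 : L * ‖z - p.x0‖ ≤ ‖gradient p.obj p.x0‖ + 2 * L * ‖avg yN - p.x0‖ := by
        have h1 := (smoothWith_obj hM hp.smooth).norm_sub_resolvent_le hL p.x0 ((2 * L) • avg yN)
        change L * ‖p.x0 - z‖ ≤ _ at h1
        rw [norm_sub_rev] at h1
        refine h1.trans ?_
        have e : gradient p.obj p.x0 + (2 * L) • p.x0 - (2 * L) • avg yN
            = gradient p.obj p.x0 - (2 * L) • (avg yN - p.x0) := by module
        rw [e]
        refine (norm_sub_le _ _).trans ?_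
        rw [norm_smul, Real.norm_of_nonneg (by positivity)]
      have hm : ∀ m, ‖gradient (p.F m) z + (2 * L) • (z - yN m)‖ ^ 2
          ≤ 4 * ‖gradient (p.F m) p.x0‖ ^ 2 + 36 * ‖gradient p.obj p.x0‖ ^ 2
            + 144 * L ^ 2 * ‖avg yN - p.x0‖ ^ 2 + 16 * L ^ 2 * ‖yN m - p.x0‖ ^ 2 := by
        intro m
        have e : gradient (p.F m) z + (2 * L) • (z - yN m)
            = gradient (p.F m) p.x0 + (gradient (p.F m) z - gradient (p.F m) p.x0)
              + (2 * L) • (z - p.x0) + (2 * L) • (p.x0 - yN m) := by module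
        have h3 : ‖gradient (p.F m) z + (2 * L) • (z - yN m)‖ ≤ ‖gradient (p.F m) p.x0‖
            + 3 * ‖gradient p.obj p.x0‖ + 6 * L * ‖avg yN - p.x0‖ + 2 * L * ‖yN m - p.x0‖ := by
          rw [e]
          refine (norm_add₄_le).trans ?_
          have h4 := (hp.smooth m).2 z p.x0
          rw [norm_smul, norm_smul, Real.norm_of_nonneg (by positivity), norm_sub_rev p.x0]
          linarith
        refine (sq_le_four_mul (norm_nonneg _) h3).trans (le_of_eq (by ring))
      refine (Finset.sum_le_sum fun m _ => hm m).trans ?_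
      rw [Finset.sum_add_distrib, Finset.sum_add_distrib, Finset.sum_add_distrib, ← Finset.mul_sum,
        ← Finset.mul_sum (f := fun m => ‖yN m - p.x0‖ ^ 2)]
      simp only [Finset.sum_const, Finset.card_univ, Fintype.card_fin, nsmul_eq_mul]
      have h5 := mul_le_mul_of_nonneg_left (norm_avg_sub_sq_le hM yN p.x0)
        (by positivity : 0 ≤ 144 * L ^ 2)
      have h6 := mul_le_mul_of_nonneg_left hG1 hMpos.le
      nlinarith
    · have e : M * (L ^ 2 * (40 * (G ^ 2 / L ^ 2) + 1600 * B))
          = 40 * (M * G ^ 2) + 160 * L ^ 2 * (M * (10 * B)) := by field_simp; ring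
      exact e.ge

theorem devSq_zero (ω : Ω) : p.devSq L r par ξ 0 ω = 0 := by
  refine Finset.sum_eq_zero fun m _ => ?_
  change ‖p.x0 - p.x0‖ ^ 2 = 0
  simp

/-- All rounds are accurate if accuracy of the previous rounds keeps the iterates bounded. -/
theorem upperMean_errSq (hp : p.Standing L σ σ₂) (hM : 0 < M)
    (hL : 0 < L) {G B : ℝ} {S : ℕ} {ε : ℕ → ℝ} (hG : p.InitGradBound G) (hB : 0 ≤ B)
    (hβ : ∀ s, 0 ≤ r.beta L (s + 1) ∧ r.beta L (s + 1) ≤ 1)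
    (hw : 0 ≤ r.warm L ∧ r.warm L ≤ 1)
    (hacc : ∀ s, InnerAccurate P p ξ L (par (s + 1)) (40 * (G ^ 2 / L ^ 2) + 1600 * B) (ε (s + 1))
      (s + 1))
    (hdev : ∀ s < S, (∀ s' ≤ s, UpperMean P (p.errSq L r par ξ (s' + 1)) (M * ε (s' + 1))) →
      UpperMean P (p.devSq L r par ξ (s + 1)) (M * B)) :
    ∀ s < S, UpperMean P (p.errSq L r par ξ (s + 1)) (M * ε (s + 1)) := by
  intro s
  induction s using Nat.strong_induction_on with
  | _ s ih =>
    intro hs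
    refine upperMean_errSq_succ hp hM hL hG hB hβ hw (hacc s) fun s' hs' => ?_
    cases s' with
    | zero => exact upperMean_zero devSq_zero (by positivity)
    | succ s' => exact hdev s' (by omega) fun s'' hs'' => ih s'' (by omega) (by omega)

/-- The suboptimality in the subproblem of an accurate round. -/
theorem expSubGap_le (hM : 0 < M) (hL : 0 < L) (hF : ∀ m, SmoothWith L (p.F m)) {s : ℕ} {ε : ℝ}
    (h : UpperMean P (p.errSq L r par ξ s) (M * ε)) :
    p.expSubGap P L r par ξ s ≤ ENNReal.ofReal (3 * L / 2 * ε) := by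
  have hMpos : (0 : ℝ) < M := by exact_mod_cast hM
  refine ((h.const_mul (by positivity : 0 ≤ 3 * L / 2 * (1 / (M : ℝ)))).mono (fun ω => ?_)
    (le_of_eq (by field_simp))).lintegral_le
  refine (subObj_sub_iInf_le hM hL hF (proxPoint_eq hM hL hF s ω) _).trans ?_
  rw [mul_assoc]
  exact mul_le_mul_of_nonneg_left (norm_xbar_sub_proxPoint_sq_le hM s ω) (by positivity)

end Rounds

end DecOpt

namespace DecOpt

/-! ### Extrapolated points -/

section Extrapolation
variable {n : ℕ}

/-- The auxiliary points `v` of the accelerated proximal point method. -/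
noncomputable def extrapolated (a : ℕ → ℝ) (X : ℕ → Vec n) : ℕ → Vec n
  | 0 => X 0
  | s + 1 => X s + (1 / a s) • (X (s + 1) - X s)

theorem smul_extrapolated_succ {a : ℕ → ℝ} (X : ℕ → Vec n) {s : ℕ} (ha : a s ≠ 0) :
    a s • extrapolated a X (s + 1) = a s • X s + (X (s + 1) - X s) := by
  rw [extrapolated, smul_add, smul_smul, mul_one_div_cancel ha, one_smul]

end Extrapolation

/-! ### Strongly convex objectives -/

section StronglyConvex

theorem alphaSeq_stronglyConvex {q : ℝ} (hq : 0 ≤ q) (s : ℕ) : alphaSeq q √q s = √q := by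
  induction s with
  | zero => rfl
  | succ s ih =>
    rw [alphaSeq, ih, nextAlpha, Real.sq_sqrt hq, sub_self, zero_pow two_ne_zero, zero_add,
      zero_add, Real.sqrt_mul (by norm_num), show (4 : ℝ) = 2 ^ 2 by norm_num,
      Real.sqrt_sq (by norm_num)]
    ring

theorem betaSeq_stronglyConvex {q : ℝ} (hq : 0 < q) (s : ℕ) :
    betaSeq q √q s = (1 - √q) / (1 + √q) := by
  have h1 : 0 < √q := Real.sqrt_pos.2 hq
  rw [betaSeq, alphaSeq_stronglyConvex hq.le, alphaSeq_stronglyConvex hq.le]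
  field_simp
  ring

/-- Strong convexity at 0 gives f ≥ f(0) outside the ball of radius 2‖∇f(0)‖/μ. -/
theorem exists_minimizer {n : ℕ} {f : Vec n → ℝ} {μ : ℝ} (hμ : 0 < μ) (hc : Continuous f)
    (hsc : ∀ x u, f x + inner ℝ (gradient f x) (u - x) + μ / 2 * ‖u - x‖ ^ 2 ≤ f u) :
    ∃ x, ∀ u, f x ≤ f u := by
  refine hc.exists_forall_le' 0 ?_
  have h1 : ∀ᶠ x : Vec n in Filter.cocompact (Vec n), 2 * ‖gradient f 0‖ / μ ≤ ‖x‖ :=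
    (tendsto_norm_cocompact_atTop (E := Vec n)).eventually_ge_atTop _
  filter_upwards [h1] with x hx
  have h2 := hsc 0 x
  have h3 := (abs_le.1 (abs_real_inner_le_norm (gradient f 0) (x - 0))).1
  rw [div_le_iff₀ hμ] at hx
  rw [sub_zero] at h2 h3
  nlinarith [norm_nonneg x]

theorem norm_sub_minimizer_sq_le {n : ℕ} {f : Vec n → ℝ} {μ : ℝ}
    (hsc : ∀ x u, f x + inner ℝ (gradient f x) (u - x) + μ / 2 * ‖u - x‖ ^ 2 ≤ f u)
    {xs : Vec n} (hxs : ∀ u, f xs ≤ f u) (x : Vec n) :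
    μ / 2 * ‖x - xs‖ ^ 2 ≤ f x - f xs := by
  have h0 : gradient f xs = 0 := by
    have : IsLocalMin f xs := Filter.Eventually.of_forall hxs
    rw [gradient, this.fderiv_eq_zero, map_zero]
  have h1 := hsc xs x
  rw [h0, inner_zero_left] at h1
  linarith

variable {M n : ℕ} {Ξ Ω : Type*} [MeasurableSpace Ξ] [MeasurableSpace Ω] {P : Measure Ω}
  [IsProbabilityMeasure P] {p : Problem M n Ξ} {L σ σ₂ μ a Δ : ℝ} {par : ℕ → AccParams}
  {ξ : ℕ → ℕ → ℕ → Fin M → Ω → Ξ}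

/-- The potential decreases linearly as long as the rounds are accurate. -/
theorem upperMean_potential_stronglyConvex (hM : 0 < M) (hL : 0 < L)
    (hF : ∀ m, SmoothWith L (p.F m)) (hμ : 0 < μ) (hμL : μ ≤ L)
    (hsc : ∀ m, StronglyConvexWith μ (p.F m)) (hΔ : 0 ≤ Δ) (hgap : p.InitGapBound Δ)
    (ha : a = √(μ / (μ + 2 * L))) {xs : Vec n} (hxs : ∀ u, p.obj xs ≤ p.obj u) (s : ℕ)
    (h : ∀ s' < s, UpperMean P (p.errSq L (.stronglyConvex μ) par ξ (s' + 1))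
      (M * ((1 - 0.9 * a) ^ (s' + 1) * Δ / (34 * L)))) :
    UpperMean P (fun ω => p.obj (p.xbar L (.stronglyConvex μ) par ξ s ω) - p.obj xs
        + μ / 2 * ‖extrapolated (fun _ => a)
          (fun k => p.xbar L (.stronglyConvex μ) par ξ k ω) s - xs‖ ^ 2)
      (20 / a ^ 2 * Δ * (1 - 0.9 * a) ^ s) := by
  have hMpos : (0 : ℝ) < M := by exact_mod_cast hM
  have hq : 0 < μ / (μ + 2 * L) := by positivity
  have ha0 : 0 < a := by rw [ha]; exact Real.sqrt_pos.2 hq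
  have ha2 : a ^ 2 * (μ + 2 * L) = μ := by
    rw [ha, Real.sq_sqrt hq.le]; field_simp
  have ha1 : a ≤ 1 := by
    rw [ha]
    refine Real.sqrt_le_iff.2 ⟨zero_le_one, ?_⟩
    rw [one_pow, div_le_one (by positivity)]
    linarith
  have hobj := obj_lower_bound hM hF hsc
  induction s with
  | zero =>
    refine (UpperMean.const (P := P) (2 * Δ)).mono (fun ω => ?_) ?_
    · change p.obj (p.xbar L (.stronglyConvex μ) par ξ 0 ω) - p.obj xs
        + μ / 2 * ‖p.xbar L (.stronglyConvex μ) par ξ 0 ω - xs‖ ^ 2 ≤ _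
      rw [xbar_zero hM]
      have h1 := norm_sub_minimizer_sq_le hobj hxs p.x0
      have := hgap xs
      linarith
    · have : 20 ≤ 20 / a ^ 2 := by
        rw [le_div_iff₀ (by positivity)]; nlinarith
      rw [pow_zero, mul_one]
      nlinarith
  | succ s ih =>
    have ih' := ih fun s' hs' => h s' (by omega)
    have hr0 : 0 ≤ 1 - 0.95 * a := by linarith
    have hρ0 : 0 ≤ 1 - 0.9 * a := by linarith
    refine ((ih'.const_mul hr0).add ((h s (by omega)).const_mul
      (by positivity : 0 ≤ 34 * L / a * (1 / (M : ℝ)))) ?_ ?_).mono (fun ω => ?_) ?_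
    · positivity
    · positivity
    · have e1 := catalyst_step_strongly_convex (smoothWith_obj hM hF) hL hμ hμL hobj ha0 ha1 ha2
        hxs (x := p.xbar L (.stronglyConvex μ) par ξ s ω)
        (v := extrapolated (fun _ => a) (fun k => p.xbar L (.stronglyConvex μ) par ξ k ω) s)
        (y := avg (p.run L (.stronglyConvex μ) par ξ (s + 1) ω).y) ?_
        (smul_extrapolated_succ (a := fun _ => a)
          (fun k => p.xbar L (.stronglyConvex μ) par ξ k ω) ha0.ne')
        (proxPoint_eq (r := .stronglyConvex μ) (par := par) (ξ := ξ) hM hL hF (s + 1) ω)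
      · refine e1.trans (add_le_add_right ?_ _)
        rw [mul_assoc]
        exact mul_le_mul_of_nonneg_left (norm_xbar_sub_proxPoint_sq_le hM _ _) (by positivity)
      · cases s with
        | zero =>
          rw [avg_y_one hM]
          change _ = p.xbar L (.stronglyConvex μ) par ξ 0 ω
            + a • p.xbar L (.stronglyConvex μ) par ξ 0 ω
          rw [xbar_zero hM]
          module
        | succ s =>
          rw [avg_y_succ]
          have hβ : Regime.beta L (.stronglyConvex μ) (s + 1) = (1 - a) / (1 + a) := by
            rw [Regime.beta, betaSeq_stronglyConvex hq, ha]
          rw [hβ, smul_add, smul_smul, mul_div_cancel₀ _ (by positivity),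
            smul_extrapolated_succ (a := fun _ => a)
            (fun k => p.xbar L (.stronglyConvex μ) par ξ k ω) ha0.ne']
          module
    -- The tolerance makes the error term Δρ^(s+1)/a with ρ = 1 − 0.9a. The slack 0.05a between the
    -- rates 0.95a and 0.9a, multiplied by the prefactor 20/a², equals 1/a and pays for it.
    · have e : (1 - 0.95 * a) * (20 / a ^ 2 * Δ * (1 - 0.9 * a) ^ s) + 34 * L / a * (1 / (M : ℝ))
          * (M * ((1 - 0.9 * a) ^ (s + 1) * Δ / (34 * L)))
          = 20 / a ^ 2 * Δ * (1 - 0.9 * a) ^ (s + 1) - 0.9 * (Δ * (1 - 0.9 * a) ^ s) := by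
        rw [pow_succ (1 - 0.9 * a)]
        field_simp
        ring
      rw [e]
      have : 0 ≤ Δ * (1 - 0.9 * a) ^ s := by positivity
      linarith

/-- Catalyst with accurate rounds, strongly convex case. -/
theorem catalyst_stronglyConvex (hp : p.Standing L σ σ₂) (hM : 0 < M)
    (hμ : 0 < μ) (hμL : μ ≤ L) (hsc : ∀ m, StronglyConvexWith μ (p.F m)) (hΔ : 0 ≤ Δ)
    (hgap : p.InitGapBound Δ) {G : ℝ} (hG : p.InitGradBound G) (ha : a = √(μ / (μ + 2 * L)))
    (hacc : ∀ s, InnerAccurate P p ξ L (par (s + 1))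
      (40 * (G ^ 2 / L ^ 2) + 1600 * (400 * Δ / (μ * a ^ 2)))
      ((1 - 0.9 * a) ^ (s + 1) * Δ / (34 * L)) (s + 1)) :
    (∀ s, 1 ≤ s → p.expSubGap P L (.stronglyConvex μ) par ξ s ≤
      ENNReal.ofReal (2 * (1 - 0.9 * a) ^ s * Δ / 9)) ∧
    ∀ s, p.expGap P L (.stronglyConvex μ) par ξ s
      ≤ ENNReal.ofReal (20 / a ^ 2 * Δ * (1 - 0.9 * a) ^ s) := by
  have hL : 0 < L := hμ.trans_le hμL
  have hMpos : (0 : ℝ) < M := by exact_mod_cast hM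
  have hF := hp.smooth
  have hq : 0 < μ / (μ + 2 * L) := by positivity
  have ha0 : 0 < a := by rw [ha]; exact Real.sqrt_pos.2 hq
  have ha2 : a ^ 2 * (μ + 2 * L) = μ := by
    rw [ha, Real.sq_sqrt hq.le]; field_simp
  have ha1 : a ≤ 1 := by
    rw [ha]
    refine Real.sqrt_le_iff.2 ⟨zero_le_one, ?_⟩
    rw [one_pow, div_le_one (by positivity)]
    linarith
  have hρ0 : 0 ≤ 1 - 0.9 * a := by linarith
  have hρ1 : 1 - 0.9 * a ≤ 1 := by linarith
  have hobj := obj_lower_bound hM hF hsc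
  obtain ⟨xs, hxs⟩ := exists_minimizer hμ (smoothWith_obj hM hF).1.continuous hobj
  have hV := upperMean_potential_stronglyConvex (P := P) (par := par) (ξ := ξ) hM hL hF hμ hμL hsc
    hΔ hgap ha hxs
  have hβ : ∀ s, 0 ≤ Regime.beta L (.stronglyConvex μ) (s + 1)
      ∧ Regime.beta L (.stronglyConvex μ) (s + 1) ≤ 1 := by
    intro s
    rw [Regime.beta, betaSeq_stronglyConvex hq, ← ha]
    refine ⟨div_nonneg (by linarith) (by linarith), ?_⟩
    rw [div_le_one (by linarith)]
    linarith
  have hw : 0 ≤ Regime.warm L (.stronglyConvex μ) ∧ Regime.warm L (.stronglyConvex μ) ≤ 1 := by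
    rw [Regime.warm]
    refine ⟨by positivity, ?_⟩
    rw [div_le_one (by positivity)]
    linarith
  have herr : ∀ s, UpperMean P (p.errSq L (.stronglyConvex μ) par ξ (s + 1))
      (M * ((1 - 0.9 * a) ^ (s + 1) * Δ / (34 * L))) := by
    intro s
    refine upperMean_errSq (B := 400 * Δ / (μ * a ^ 2))
      (ε := fun s => (1 - 0.9 * a) ^ s * Δ / (34 * L)) (par := par) hp hM hL hG (by positivity) hβ hw hacc
      (S := s + 1) (fun k _ hk => ?_) s (by omega)
    have h1 := hV (k + 1) fun s' hs' => hk s' (by omega)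
    have hpow : (1 - 0.9 * a) ^ (k + 1) ≤ 1 := pow_le_one₀ hρ0 hρ1
    have hpow0 : 0 ≤ (1 - 0.9 * a) ^ (k + 1) := pow_nonneg hρ0 _
    have h20 : 0 ≤ 20 / a ^ 2 * Δ := by positivity
    have h2 : UpperMean P (fun ω => ‖p.xbar L (.stronglyConvex μ) par ξ (k + 1) ω - p.x0‖ ^ 2)
        (84 * Δ / (μ * a ^ 2)) := by
      refine ((h1.const_mul (by positivity : 0 ≤ 4 / μ)).add (UpperMean.const (4 / μ * Δ))
        (by positivity) (by positivity)).mono (fun ω => ?_) ?_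
      · set X := p.xbar L (.stronglyConvex μ) par ξ (k + 1) ω
        have h3 := norm_sub_minimizer_sq_le hobj hxs X
        have h4 := norm_sub_minimizer_sq_le hobj hxs p.x0
        have h5 : ‖X - p.x0‖ ^ 2 ≤ 2 * (‖X - xs‖ ^ 2 + ‖p.x0 - xs‖ ^ 2) :=
          sq_le_two_mul (norm_nonneg _) (by
            rw [norm_sub_rev p.x0]; exact norm_sub_le_norm_sub_add_norm_sub _ _ _)
        have h6 := hgap xs
        have h7 : ‖X - p.x0‖ ^ 2 ≤ 4 / μ * (μ / 2 * ‖X - xs‖ ^ 2 + μ / 2 * ‖p.x0 - xs‖ ^ 2) := by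
          refine h5.trans (le_of_eq ?_)
          field_simp
          ring
        refine h7.trans ((mul_le_mul_of_nonneg_left ?_ (by positivity : 0 ≤ 4 / μ)).trans_eq
          (mul_add _ _ _))
        have : 0 ≤ μ / 2 * ‖extrapolated (fun _ => a)
          (fun k => p.xbar L (.stronglyConvex μ) par ξ k ω) (k + 1) - xs‖ ^ 2 := by positivity
        linarith
      · have h8 : 20 / a ^ 2 * Δ * (1 - 0.9 * a) ^ (k + 1) ≤ 20 / a ^ 2 * Δ :=
          mul_le_of_le_one_right h20 hpow
        have h9 : Δ ≤ 1 / a ^ 2 * Δ := by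
          refine le_mul_of_one_le_left hΔ ?_
          rw [le_div_iff₀ (by positivity)]; nlinarith
        have e : 84 * Δ / (μ * a ^ 2) = 4 / μ * (20 / a ^ 2 * Δ) + 4 / μ * (1 / a ^ 2 * Δ) := by
          field_simp; ring
        rw [e]
        gcongr
    refine (upperMean_dev hM ?_ ?_ (hk k le_rfl) h2).mono (fun _ => le_rfl) ?_
    · positivity
    · positivity
    · refine mul_le_mul_of_nonneg_left ?_ hMpos.le
      -- In units of Δ/(μa²), the deviation is at most 6 · 1 + 4 · 84 = 342, below 400.
      have h10 : (1 - 0.9 * a) ^ (k + 1) * Δ / (34 * L) ≤ Δ / (μ * a ^ 2) := by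
        refine div_le_div₀ hΔ (mul_le_of_le_one_left hΔ hpow) (by positivity) ?_
        nlinarith
      have e : 400 * Δ / (μ * a ^ 2) = 400 * (Δ / (μ * a ^ 2)) := by ring
      have e' : 84 * Δ / (μ * a ^ 2) = 84 * (Δ / (μ * a ^ 2)) := by ring
      have : 0 ≤ Δ / (μ * a ^ 2) := by positivity
      rw [e, e']
      linarith
  constructor
  · intro s hs
    obtain ⟨s, rfl⟩ := Nat.exists_eq_add_of_le' hs
    refine (expSubGap_le hM hL hF (herr s)).trans (ENNReal.ofReal_le_ofReal ?_)
    have e : 3 * L / 2 * ((1 - 0.9 * a) ^ (s + 1) * Δ / (34 * L))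
        = 3 / 68 * ((1 - 0.9 * a) ^ (s + 1) * Δ) := by field_simp; ring
    have : 0 ≤ (1 - 0.9 * a) ^ (s + 1) * Δ := by positivity
    rw [e]
    linarith
  · intro s
    refine ((hV s fun s' _ => herr s').mono (fun ω => ?_) le_rfl).lintegral_le
    have h1 : p.obj xs ≤ ⨅ z, p.obj z := le_ciInf hxs
    have : 0 ≤ μ / 2 * ‖extrapolated (fun _ => a)
          (fun k => p.xbar L (.stronglyConvex μ) par ξ k ω) s - xs‖ ^ 2 := by positivity
    linarith

end StronglyConvex

end DecOpt

namespace DecOpt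

/-! ### Convex objectives -/

section Convex

theorem alphaSeq_convex_pos (s : ℕ) : 0 < alphaSeq 0 1 s := by
  induction s with
  | zero => exact one_pos
  | succ s ih => exact nextAlpha_pos 0 ih.ne'

theorem alphaSeq_convex_eq (s : ℕ) :
    alphaSeq 0 1 (s + 1) ^ 2 = (1 - alphaSeq 0 1 (s + 1)) * alphaSeq 0 1 s ^ 2 := by
  have := nextAlpha_eq 0 (alphaSeq 0 1 s)
  rwa [zero_mul, add_zero] at this

/-- The reciprocals b = 1/α satisfy b'² − b' = b², hence increase by at least 1/2 and at most 1 in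
each step. -/
theorem inv_alphaSeq_convex_bounds (s : ℕ) :
    ((s : ℝ) + 2) / 2 ≤ 1 / alphaSeq 0 1 s ∧ 1 / alphaSeq 0 1 s ≤ s + 1 := by
  induction s with
  | zero => simp [alphaSeq]
  | succ s ih =>
    have h0 := alphaSeq_convex_pos s
    have h1 := alphaSeq_convex_pos (s + 1)
    have h2 := alphaSeq_convex_eq s
    set b := 1 / alphaSeq 0 1 s with hb
    set b' := 1 / alphaSeq 0 1 (s + 1) with hb'
    have hb0 : 0 < b := by positivity
    have hb0' : 0 < b' := by positivity
    have e : b' ^ 2 - b' = b ^ 2 := by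
      rw [hb, hb']
      field_simp
      linear_combination -h2
    push_cast
    constructor <;> nlinarith

theorem alphaSeq_convex_le_one (s : ℕ) : alphaSeq 0 1 s ≤ 1 := by
  have h := (inv_alphaSeq_convex_bounds s).1
  have : 1 ≤ 1 / alphaSeq 0 1 s := by
    have : (0 : ℝ) ≤ s := Nat.cast_nonneg s
    linarith
  rwa [le_div_iff₀ (alphaSeq_convex_pos s), one_mul] at this

/-- In this form the momentum step is visibly y = (1 − α)x + αv with the extrapolated point v. -/
theorem betaSeq_convex (s : ℕ) :
    betaSeq 0 1 (s + 1) = alphaSeq 0 1 (s + 1) * (1 / alphaSeq 0 1 s - 1) := by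
  have h0 := alphaSeq_convex_pos s
  have h1 := alphaSeq_convex_pos (s + 1)
  have h2 := alphaSeq_convex_eq s
  rw [betaSeq, Nat.add_sub_cancel, div_eq_iff (by positivity)]
  field_simp
  linear_combination (alphaSeq 0 1 s - 1) * h2

theorem betaSeq_convex_bounds (s : ℕ) : 0 ≤ betaSeq 0 1 (s + 1) ∧ betaSeq 0 1 (s + 1) ≤ 1 := by
  have h0 := alphaSeq_convex_pos s
  have h1 := alphaSeq_convex_pos (s + 1)
  have h3 := alphaSeq_convex_le_one s
  rw [betaSeq, Nat.add_sub_cancel]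
  refine ⟨div_nonneg (mul_nonneg h0.le (by linarith)) (by positivity), ?_⟩
  rw [div_le_one (by positivity)]
  have h2 := alphaSeq_convex_eq s
  by_contra! hcon
  nlinarith [mul_pos h0 h0, mul_pos h1 h0]

/-- The growth factor of the potential in the convex case. -/
noncomputable def growth (γ : ℝ) (s : ℕ) : ℝ :=
  Real.exp (2 * ∑ k ∈ Finset.range s, ((k : ℝ) + 1) ^ (-(1 + γ / 2)))

/-- A bound of `growth γ`. -/
noncomputable def growthBound (γ : ℝ) : ℝ :=
  Real.exp (2 * ∑' k : ℕ, ((k : ℝ) + 1) ^ (-(1 + γ / 2)))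

theorem one_le_growth (γ : ℝ) (s : ℕ) : 1 ≤ growth γ s :=
  Real.one_le_exp (mul_nonneg zero_le_two (Finset.sum_nonneg fun _ _ => by positivity))

theorem growth_le {γ : ℝ} (hγ : 0 < γ) (s : ℕ) : growth γ s ≤ growthBound γ := by
  have hs : Summable fun k : ℕ => ((k : ℝ) + 1) ^ (-(1 + γ / 2)) := by
    have h1 : Summable fun k : ℕ => (k : ℝ) ^ (-(1 + γ / 2)) :=
      Real.summable_nat_rpow.2 (by linarith)
    have h2 := (summable_nat_add_iff 1).2 h1
    simpa using h2
  refine Real.exp_le_exp.2 (mul_le_mul_of_nonneg_left ?_ zero_le_two)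
  exact hs.sum_le_tsum _ fun _ _ => by positivity

/-- This is 1 + c ≤ exp c, squared: one factor 1 + c is the loss of the prox step, the other pays
for its error. -/
theorem growth_succ {γ : ℝ} (s : ℕ) :
    (1 + ((s : ℝ) + 1) ^ (-(1 + γ / 2))) ^ 2 * growth γ s ≤ growth γ (s + 1) := by
  set c := ((s : ℝ) + 1) ^ (-(1 + γ / 2)) with hc
  have hc0 : 0 ≤ c := by positivity
  have h1 : growth γ (s + 1) = Real.exp c ^ 2 * growth γ s := by
    rw [growth, growth, Finset.sum_range_succ, ← hc, ← Real.exp_nat_mul, ← Real.exp_add]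
    congr 1
    push_cast
    ring
  rw [h1]
  have h2 := Real.add_one_le_exp c
  have h3 : 0 ≤ growth γ s := zero_le_one.trans (one_le_growth γ s)
  gcongr
  linarith

/-- The error term of one round. -/
theorem convex_error_le {γ Δ L : ℝ} (hγ : 0 < γ) (hL : 0 < L) (hΔ : 0 ≤ Δ) (s : ℕ) {a : ℝ} (ha : 0 < a)
    (hab : 1 / a ≤ s + 1) :
    2 * L / (((s : ℝ) + 1) ^ (-(1 + γ / 2)) / 2 * a ^ 2) * (Δ / (9 * L * ((s : ℝ) + 2) ^ (4 + γ)))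
      ≤ ((s : ℝ) + 1) ^ (-(1 + γ / 2)) * Δ := by
  have ht : (0 : ℝ) < (s : ℝ) + 1 := by positivity
  set t := (s : ℝ) + 1 with htd
  set c := t ^ (-(1 + γ / 2)) with hc
  have hc0 : 0 < c := by positivity
  have h1 : (1 / a) ^ 2 ≤ t ^ 2 := by gcongr
  -- The origin of the exponent 4 + γ = 2 + 2(1 + γ/2): the weight 1/a² takes two powers, and two
  -- factors 1/c are needed, one for Young's inequality with weight c/2 and one to leave the error
  -- cΔ.
  have e1 : t ^ (4 + γ) = t ^ 2 * (1 / c) * (1 / c) := by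
    rw [hc, one_div, ← Real.rpow_neg ht.le, ← Real.rpow_natCast t 2, ← Real.rpow_add ht,
      ← Real.rpow_add ht]
    congr 1
    push_cast
    ring
  have h2 : t ^ (4 + γ) ≤ ((s : ℝ) + 2) ^ (4 + γ) :=
    Real.rpow_le_rpow ht.le (by rw [htd]; linarith) (by linarith)
  have ht4 : 0 < t ^ (4 + γ) := by positivity
  calc 2 * L / (c / 2 * a ^ 2) * (Δ / (9 * L * ((s : ℝ) + 2) ^ (4 + γ)))
      = 4 / 9 * (Δ / c) * ((1 / a) ^ 2 / ((s : ℝ) + 2) ^ (4 + γ)) := by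
        field_simp
        ring
    _ ≤ 4 / 9 * (Δ / c) * (t ^ 2 / t ^ (4 + γ)) := by gcongr
    _ = 4 / 9 * (c * Δ) := by
        rw [e1]
        field_simp
    _ ≤ c * Δ := by
        have : 0 ≤ c * Δ := by positivity
        linarith

variable {M n : ℕ} {Ξ Ω : Type*} [MeasurableSpace Ξ] [MeasurableSpace Ω] {P : Measure Ω}
  [IsProbabilityMeasure P] {p : Problem M n Ξ} {L σ σ₂ γ Δ R : ℝ} {par : ℕ → AccParams}
  {ξ : ℕ → ℕ → ℕ → Fin M → Ω → Ξ}

theorem avg_y_convex (hM : 0 < M) (s : ℕ) (ω : Ω) : avg (p.run L .convex par ξ (s + 1) ω).y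
    = (1 - alphaSeq 0 1 s) • p.xbar L .convex par ξ s ω
      + alphaSeq 0 1 s • extrapolated (alphaSeq 0 1) (fun k => p.xbar L .convex par ξ k ω) s := by
  cases s with
  | zero =>
    rw [avg_y_one hM, extrapolated, xbar_zero hM]
    module
  | succ s =>
    rw [avg_y_succ, extrapolated]
    have hβ : Regime.beta L .convex (s + 1) = alphaSeq 0 1 (s + 1) * (1 / alphaSeq 0 1 s - 1) :=
      betaSeq_convex s
    rw [hβ]
    module

/-- The potential stays bounded as long as the rounds are accurate. -/
theorem upperMean_potential_convex (hM : 0 < M) (hL : 0 < L)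
    (hF : ∀ m, SmoothWith L (p.F m)) (hγ : 0 < γ)
    (hc : ∀ m, ConvexOn ℝ Set.univ (p.F m)) (hΔ : 0 ≤ Δ) {xs : Vec n}
    (hxs : ∀ u, p.obj xs ≤ p.obj u) (hR : ‖p.x0 - xs‖ ≤ R) (s : ℕ)
    (h : ∀ s' < s, UpperMean P (p.errSq L .convex par ξ (s' + 1))
      (M * (Δ / (9 * L * (((s' + 1 : ℕ) : ℝ) + 1) ^ (4 + γ))))) :
    UpperMean P (fun ω => (1 - alphaSeq 0 1 s) / alphaSeq 0 1 s ^ 2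
          * (p.obj (p.xbar L .convex par ξ s ω) - p.obj xs)
        + L * ‖extrapolated (alphaSeq 0 1) (fun k => p.xbar L .convex par ξ k ω) s - xs‖ ^ 2)
      (growth γ s * (L * R ^ 2 + Δ) - Δ) := by
  have hMpos : (0 : ℝ) < M := by exact_mod_cast hM
  have hobj : ∀ x u, p.obj x + inner ℝ (gradient p.obj x) (u - x) ≤ p.obj u := by
    intro x u
    have := obj_lower_bound hM hF (μ := 0)
      (fun m x u => by simpa using convex_first_order (hF m) (hc m) x u) x u
    simpa using this
  induction s with
  | zero =>
    refine (UpperMean.const (P := P) (L * R ^ 2)).mono (fun ω => ?_) ?_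
    · change (1 - 1) / 1 ^ 2 * _ + L * ‖p.xbar L .convex par ξ 0 ω - xs‖ ^ 2 ≤ _
      rw [xbar_zero hM, sub_self, zero_div, zero_mul, zero_add]
      gcongr
    · simp [growth]
  | succ s ih =>
    have ih' := ih fun s' hs' => h s' (by omega)
    set a := alphaSeq 0 1 s with ha
    have ha0 : 0 < a := alphaSeq_convex_pos s
    have ha1 : a ≤ 1 := alphaSeq_convex_le_one s
    set c := ((s : ℝ) + 1) ^ (-(1 + γ / 2)) with hc
    have hc0 : 0 < c := by positivity
    have hc1 : c ≤ 1 := Real.rpow_le_one_of_one_le_of_nonpos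
      (by have : (0 : ℝ) ≤ s := Nat.cast_nonneg s
          linarith) (by linarith)
    have hg1 := one_le_growth γ s
    have hB : 0 ≤ L * R ^ 2 := by positivity
    have hW0 : 0 ≤ growth γ s * (L * R ^ 2 + Δ) - Δ := by nlinarith
    -- The recursion of α matches the weight on the left of the prox step with the weight on the
    -- right of the next one.
    have hA : (1 - alphaSeq 0 1 (s + 1)) / alphaSeq 0 1 (s + 1) ^ 2 = 1 / a ^ 2 := by
      have h0 := alphaSeq_convex_pos (s + 1)
      rw [div_eq_div_iff (by positivity) (by positivity), one_mul, alphaSeq_convex_eq s]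
    refine ((ih'.add ((h s (by omega)).const_mul
      (by positivity : 0 ≤ 2 * L / (c / 2 * a ^ 2) * (1 / (M : ℝ)))) hW0 ?_).const_mul
      (by positivity : 0 ≤ 1 + 2 * (c / 2))).mono (fun ω => ?_) ?_
    · positivity
    · have e1 := catalyst_step_convex (smoothWith_obj hM hF) hL hobj ha0 ha1
        (by positivity : 0 < c / 2) (by linarith) hxs
        (avg_y_convex (L := L) (par := par) (ξ := ξ) hM s ω)
        (smul_extrapolated_succ (a := alphaSeq 0 1)
          (fun k => p.xbar L .convex par ξ k ω) ha0.ne')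
        (proxPoint_eq (r := .convex) (par := par) (ξ := ξ) hM hL hF (s + 1) ω)
      rw [hA]
      refine e1.trans (mul_le_mul_of_nonneg_left (add_le_add_right ?_ _) (by positivity))
      rw [mul_assoc]
      exact mul_le_mul_of_nonneg_left (norm_xbar_sub_proxPoint_sq_le hM _ _) (by positivity)
    · have h1 := convex_error_le hγ hL hΔ s ha0 (inv_alphaSeq_convex_bounds s).2
      rw [← hc] at h1
      have e : 2 * L / (c / 2 * a ^ 2) * (1 / (M : ℝ))
          * (M * (Δ / (9 * L * (((s + 1 : ℕ) : ℝ) + 1) ^ (4 + γ))))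
          = 2 * L / (c / 2 * a ^ 2) * (Δ / (9 * L * ((s : ℝ) + 2) ^ (4 + γ))) := by
        push_cast
        rw [show (s : ℝ) + 1 + 1 = s + 2 by ring]
        field_simp
      rw [e]
      have h2 := growth_succ (γ := γ) s
      rw [← hc] at h2
      set g := growth γ s
      set B := L * R ^ 2 + Δ with hBd
      have hB0 : 0 ≤ B := by positivity
      have h3 : (1 + c) ^ 2 * g * B ≤ growth γ (s + 1) * B := mul_le_mul_of_nonneg_right h2 hB0
      have h4 : (1 + 2 * (c / 2)) * (g * B - Δ + 2 * L / (c / 2 * a ^ 2)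
          * (Δ / (9 * L * ((s : ℝ) + 2) ^ (4 + γ)))) ≤ (1 + c) * (g * B - Δ + c * Δ) := by
        rw [mul_div_cancel₀ c two_ne_zero]
        gcongr
      -- Expanding, (1 + c)(gB − Δ + cΔ) = (1 + c)gB − Δ + c²Δ. The −Δ in the invariant cancels the
      -- first-order error, and gB ≥ Δ lets the second factor 1 + c absorb the rest.
      have h5 : Δ ≤ g * B := by linarith
      nlinarith [mul_nonneg hc0.le (mul_nonneg hc0.le hΔ),
        mul_nonneg hc0.le (sub_nonneg.2 h5), mul_nonneg hc0.le (hΔ.trans h5)]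

/-- The potential controls the distance of v, not that of x. The next iterate is a convex
combination of x and v, so the bound passes to x by induction. -/
theorem upperMean_norm_sub_minimizer_convex (hM : 0 < M) (hL : 0 < L)
    (hF : ∀ m, SmoothWith L (p.F m)) (hγ : 0 < γ)
    (hc : ∀ m, ConvexOn ℝ Set.univ (p.F m)) (hΔ : 0 ≤ Δ) {xs : Vec n}
    (hxs : ∀ u, p.obj xs ≤ p.obj u) (hR : ‖p.x0 - xs‖ ≤ R) (s : ℕ)
    (h : ∀ s' < s, UpperMean P (p.errSq L .convex par ξ (s' + 1))
      (M * (Δ / (9 * L * (((s' + 1 : ℕ) : ℝ) + 1) ^ (4 + γ))))) :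
    UpperMean P (fun ω => ‖p.xbar L .convex par ξ s ω - xs‖ ^ 2)
      (growthBound γ * (L * R ^ 2 + Δ) / L) := by
  have hB : 0 ≤ L * R ^ 2 + Δ := by positivity
  have hg : 0 ≤ growthBound γ := (Real.exp_pos _).le
  induction s with
  | zero =>
    refine (UpperMean.const (P := P) (R ^ 2)).mono (fun ω => ?_) ?_
    · rw [xbar_zero hM]
      gcongr
    · have h1 := (one_le_growth γ 0).trans (growth_le hγ 0)
      rw [le_div_iff₀ hL]
      nlinarith
  | succ s ih =>
    have ih' := ih fun s' hs' => h s' (by omega)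
    have hW := upperMean_potential_convex (P := P) (par := par) (ξ := ξ) hM hL hF hγ hc hΔ hxs hR
      (s + 1) h
    set a := alphaSeq 0 1 s with ha
    have ha0 : 0 < a := alphaSeq_convex_pos s
    have ha1 : a ≤ 1 := alphaSeq_convex_le_one s
    have ha1' : alphaSeq 0 1 (s + 1) ≤ 1 := alphaSeq_convex_le_one (s + 1)
    have hg1 := one_le_growth γ (s + 1)
    have hR0 : 0 ≤ L * R ^ 2 := by positivity
    refine ((ih'.const_mul (sub_nonneg.2 ha1)).add (hW.const_mul (by positivity : 0 ≤ a / L))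
      (mul_nonneg (sub_nonneg.2 ha1) (by positivity))
      (mul_nonneg (by positivity) (by nlinarith))).mono (fun ω => ?_) ?_
    · set X := p.xbar L .convex par ξ s ω with hX
      set X' := p.xbar L .convex par ξ (s + 1) ω with hX'
      have hv := smul_extrapolated_succ (a := alphaSeq 0 1)
          (fun k => p.xbar L .convex par ξ k ω) ha0.ne'
      set v := extrapolated (alphaSeq 0 1) (fun k => p.xbar L .convex par ξ k ω) (s + 1)
      change a • v = a • X + (X' - X) at hv
      have e : X' - xs = (1 - a) • (X - xs) + a • (v - xs) := by
        rw [smul_sub a v, hv]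
        module
      have h1 : ‖X' - xs‖ ≤ (1 - a) * ‖X - xs‖ + a * ‖v - xs‖ := by
        rw [e]
        refine (norm_add_le _ _).trans ?_
        rw [norm_smul, norm_smul, Real.norm_of_nonneg ha0.le,
          Real.norm_of_nonneg (sub_nonneg.2 ha1)]
      have h2 := pow_le_pow_left₀ (norm_nonneg _) h1 2
      have h3 : ((1 - a) * ‖X - xs‖ + a * ‖v - xs‖) ^ 2
          ≤ (1 - a) * ‖X - xs‖ ^ 2 + a * ‖v - xs‖ ^ 2 := by
        nlinarith [mul_nonneg (mul_nonneg ha0.le (sub_nonneg.2 ha1))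
          (sq_nonneg (‖X - xs‖ - ‖v - xs‖))]
      have h4 : 0 ≤ a / L * ((1 - alphaSeq 0 1 (s + 1)) / alphaSeq 0 1 (s + 1) ^ 2
          * (p.obj X' - p.obj xs)) :=
        mul_nonneg (by positivity) (mul_nonneg (div_nonneg (sub_nonneg.2 ha1') (sq_nonneg _))
          (sub_nonneg.2 (hxs _)))
      have e5 : a * ‖v - xs‖ ^ 2 = a / L * (L * ‖v - xs‖ ^ 2) := by field_simp
      rw [mul_add (a / L)]
      linarith
    · have h1 := growth_le hγ (s + 1)
      have h2 : a / L * (growth γ (s + 1) * (L * R ^ 2 + Δ) - Δ)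
          ≤ a / L * (growthBound γ * (L * R ^ 2 + Δ)) := by
        gcongr
        nlinarith
      refine (add_le_add_right h2 _).trans (le_of_eq ?_)
      field_simp
      ring

/-- Catalyst with accurate rounds, convex case. -/
theorem catalyst_convex (hp : p.Standing L σ σ₂) (hM : 0 < M)
    (hL : 0 < L) (hγ : 0 < γ) (hc : ∀ m, ConvexOn ℝ Set.univ (p.F m)) (hΔ : 0 ≤ Δ)
    (hR : p.InitDistBound R) {G : ℝ} (hG : p.InitGradBound G)
    (hacc : ∀ s, InnerAccurate P p ξ L (par (s + 1))
      (40 * (G ^ 2 / L ^ 2) + 1600 * (17 * (growthBound γ * (L * R ^ 2 + Δ) / L)))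
      (Δ / (9 * L * (((s + 1 : ℕ) : ℝ) + 1) ^ (4 + γ))) (s + 1)) :
    (∀ s, 1 ≤ s → p.expSubGap P L .convex par ξ s ≤
      ENNReal.ofReal (2 * Δ / (9 * ((s : ℝ) + 1) ^ (4 + γ)))) ∧
    ∀ s, 1 ≤ s → p.expGap P L .convex par ξ s
      ≤ ENNReal.ofReal (4 * (growthBound γ * (L * R ^ 2 + Δ)) / ((s : ℝ) + 1) ^ 2) := by
  have hMpos : (0 : ℝ) < M := by exact_mod_cast hM
  have hF := hp.smooth
  obtain ⟨xs, hxs, hR⟩ := hR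
  set D := growthBound γ * (L * R ^ 2 + Δ) with hD
  have hR0 : 0 ≤ L * R ^ 2 := by positivity
  have hD1 : L * R ^ 2 + Δ ≤ D :=
    le_mul_of_one_le_left (by positivity) ((one_le_growth γ 0).trans (growth_le hγ 0))
  have hD0 : 0 ≤ D := le_trans (by positivity) hD1
  have hX := upperMean_norm_sub_minimizer_convex (P := P) (par := par) (ξ := ξ) hM hL hF hγ hc hΔ
    hxs hR
  have hW := upperMean_potential_convex (P := P) (par := par) (ξ := ξ) hM hL hF hγ hc hΔ hxs hR
  rw [← hD] at hX
  have herr : ∀ s, UpperMean P (p.errSq L .convex par ξ (s + 1))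
      (M * (Δ / (9 * L * (((s + 1 : ℕ) : ℝ) + 1) ^ (4 + γ)))) := by
    intro s
    -- In units of D/L the deviation is at most 6/9 + 4 · 4, below 17.
    refine upperMean_errSq (B := 17 * (D / L))
      (ε := fun s => Δ / (9 * L * ((s : ℝ) + 1) ^ (4 + γ))) (r := .convex) (par := par) hp hM hL hG
      (by positivity) betaSeq_convex_bounds ⟨zero_le_one, le_rfl⟩ hacc
      (S := s + 1) (fun k _ hk => ?_) s (by omega)
    have h1 := hX (k + 1) fun s' hs' => hk s' (by omega)
    have h2 : UpperMean P (fun ω => ‖p.xbar L .convex par ξ (k + 1) ω - p.x0‖ ^ 2)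
        (4 * (D / L)) := by
      refine ((h1.const_mul zero_le_two).add (UpperMean.const (2 * R ^ 2))
        (by positivity) (by positivity)).mono (fun ω => ?_) ?_
      · set X := p.xbar L .convex par ξ (k + 1) ω
        have h5 : ‖X - p.x0‖ ^ 2 ≤ 2 * (‖X - xs‖ ^ 2 + ‖p.x0 - xs‖ ^ 2) :=
          sq_le_two_mul (norm_nonneg _) (by
            rw [norm_sub_rev p.x0]; exact norm_sub_le_norm_sub_add_norm_sub _ _ _)
        have h6 := pow_le_pow_left₀ (norm_nonneg _) hR 2
        linarith
      · have : R ^ 2 ≤ D / L := by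
          rw [le_div_iff₀ hL]
          linarith
        linarith
    refine (upperMean_dev hM ?_ ?_ (hk k le_rfl) h2).mono (fun _ => le_rfl) ?_
    · positivity
    · positivity
    · refine mul_le_mul_of_nonneg_left ?_ hMpos.le
      have h10 : Δ / (9 * L * (((k + 1 : ℕ) : ℝ) + 1) ^ (4 + γ)) ≤ D / (9 * L) := by
        refine div_le_div₀ hD0 (by linarith) (by positivity) ?_
        refine le_mul_of_one_le_right (by positivity) (Real.one_le_rpow ?_ (by linarith))
        have : (0 : ℝ) ≤ (k + 1 : ℕ) := Nat.cast_nonneg _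
        linarith
      have e : D / (9 * L) = 1 / 9 * (D / L) := by field_simp
      have : 0 ≤ D / L := by positivity
      rw [e] at h10
      linarith
  constructor
  · intro s hs
    obtain ⟨s, rfl⟩ := Nat.exists_eq_add_of_le' hs
    refine (expSubGap_le hM hL hF (herr s)).trans (ENNReal.ofReal_le_ofReal ?_)
    have e : 3 * L / 2 * (Δ / (9 * L * (((s + 1 : ℕ) : ℝ) + 1) ^ (4 + γ)))
        = 3 / 4 * (2 * Δ / (9 * (((s + 1 : ℕ) : ℝ) + 1) ^ (4 + γ))) := by
      field_simp
      ring
    have : 0 ≤ 2 * Δ / (9 * (((s + 1 : ℕ) : ℝ) + 1) ^ (4 + γ)) := by positivity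
    rw [e]
    linarith
  · intro s hs
    obtain ⟨s, rfl⟩ := Nat.exists_eq_add_of_le' hs
    refine (((hW (s + 1) fun s' _ => herr s').const_mul
      (by positivity : 0 ≤ 4 / (((s + 1 : ℕ) : ℝ) + 1) ^ 2)).mono (fun ω => ?_) ?_).lintegral_le
    · have h1 : p.obj xs ≤ ⨅ z, p.obj z := le_ciInf hxs
      set X := p.xbar L .convex par ξ (s + 1) ω
      have h2 : 0 ≤ p.obj X - p.obj xs := sub_nonneg.2 (hxs _)
      have h0 := alphaSeq_convex_pos s
      have h0' := alphaSeq_convex_pos (s + 1)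
      have hA : (1 - alphaSeq 0 1 (s + 1)) / alphaSeq 0 1 (s + 1) ^ 2
          = (1 / alphaSeq 0 1 s) ^ 2 := by
        rw [one_div_pow, div_eq_div_iff (by positivity) (by positivity), one_mul,
          alphaSeq_convex_eq s]
      have h3 := (inv_alphaSeq_convex_bounds s).1
      have h4 : 1 ≤ 4 / (((s + 1 : ℕ) : ℝ) + 1) ^ 2 * (1 / alphaSeq 0 1 s) ^ 2 := by
        have h5 : (((s : ℝ) + 2) / 2) ^ 2 ≤ (1 / alphaSeq 0 1 s) ^ 2 := by gcongr
        have h6 : 4 / (((s + 1 : ℕ) : ℝ) + 1) ^ 2 * (((s : ℝ) + 2) / 2) ^ 2 = 1 := by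
          push_cast
          rw [show (s : ℝ) + 1 + 1 = s + 2 by ring]
          field_simp
          norm_num
        exact h6.symm.le.trans (mul_le_mul_of_nonneg_left h5 (by positivity))
      rw [hA, mul_add, ← mul_assoc]
      have h7 := mul_le_mul_of_nonneg_right h4 h2
      have h8 : 0 ≤ 4 / (((s + 1 : ℕ) : ℝ) + 1) ^ 2 * (L * ‖extrapolated (alphaSeq 0 1)
        (fun k => p.xbar L .convex par ξ k ω) (s + 1) - xs‖ ^ 2) := by positivity
      linarith
    · rw [mul_comm 4 D, mul_div_assoc, mul_comm]
      gcongr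
      have h1 := growth_le hγ (s + 1)
      rw [hD]
      nlinarith [mul_le_mul_of_nonneg_right h1 (by positivity : 0 ≤ L * R ^ 2 + Δ)]

end Convex

end DecOpt

namespace DecOpt

/-! ### Nonconvex objectives -/

section Nonconvex
variable {M n : ℕ} {Ξ Ω : Type*} [MeasurableSpace Ξ] {p : Problem M n Ξ} {L σ σ₂ Δ : ℝ}
  {par : ℕ → AccParams} {ξ : ℕ → ℕ → ℕ → Fin M → Ω → Ξ}

theorem avg_y_nonconvex (hM : 0 < M) (s : ℕ) (ω : Ω) :
    avg (p.run L .nonconvex par ξ (s + 1) ω).y = p.xbar L .nonconvex par ξ s ω := by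
  cases s with
  | zero => rw [avg_y_one hM, xbar_zero hM]
  | succ s =>
    rw [avg_y_succ, Regime.beta, zero_smul, add_zero]

/-- Comparing the inexact prox point with its own centre, in `prox_inequality` with μ = −L, gives a
descent inequality that telescopes. -/
theorem sum_norm_step_sq_le (hM : 0 < M) (hL : 0 < L) (hF : ∀ m, SmoothWith L (p.F m))
    (hgap : p.InitGapBound Δ) (s : ℕ) (ω : Ω) :
    L * ∑ k ∈ Finset.range s,
        ‖p.xbar L .nonconvex par ξ (k + 1) ω - p.xbar L .nonconvex par ξ k ω‖ ^ 2
      ≤ Δ + 3 * L / 2 * ∑ k ∈ Finset.range s, ‖p.xbar L .nonconvex par ξ (k + 1) ω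
          - p.proxPoint L .nonconvex par ξ (k + 1) ω‖ ^ 2 := by
  have hs := smoothWith_obj hM hF
  have hsc : ∀ x u, p.obj x + inner ℝ (gradient p.obj x) (u - x) + -L / 2 * ‖u - x‖ ^ 2
      ≤ p.obj u := fun x u => by
    have := hs.ge x u
    linarith
  have key : ∀ s, p.obj (p.xbar L .nonconvex par ξ s ω) + L * ∑ k ∈ Finset.range s,
        ‖p.xbar L .nonconvex par ξ (k + 1) ω - p.xbar L .nonconvex par ξ k ω‖ ^ 2
      ≤ p.obj p.x0 + 3 * L / 2 * ∑ k ∈ Finset.range s, ‖p.xbar L .nonconvex par ξ (k + 1) ω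
          - p.proxPoint L .nonconvex par ξ (k + 1) ω‖ ^ 2 := by
    intro s
    induction s with
    | zero => rw [xbar_zero hM]; simp
    | succ s ih =>
      rw [Finset.sum_range_succ, Finset.sum_range_succ]
      have hz := proxPoint_eq (r := .nonconvex) (par := par) (ξ := ξ) hM hL hF (s + 1) ω
      rw [avg_y_nonconvex hM] at hz
      have h1 := prox_inequality hs hsc hz (p.xbar L .nonconvex par ξ (s + 1) ω)
        (p.xbar L .nonconvex par ξ s ω)
      rw [sub_self, norm_zero, zero_pow two_ne_zero, mul_zero, add_zero] at h1
      have h2 : 0 ≤ (-L + 2 * L) / 2 * ‖p.xbar L .nonconvex par ξ s ω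
          - p.proxPoint L .nonconvex par ξ (s + 1) ω‖ ^ 2 :=
        mul_nonneg (by linarith) (sq_nonneg _)
      linarith
  have h1 := key s
  have h2 := hgap (p.xbar L .nonconvex par ξ s ω)
  linarith

/-- At the exact prox point the gradient equals 2L times the displacement from the centre;
smoothness transfers this to the inexact iterate. -/
theorem norm_gradient_sq_le (hM : 0 < M) (hL : 0 < L) (hF : ∀ m, SmoothWith L (p.F m)) (s : ℕ)
    (ω : Ω) : ‖gradient p.obj (p.xbar L .nonconvex par ξ (s + 1) ω)‖ ^ 2
      ≤ 18 * L ^ 2 * ‖p.xbar L .nonconvex par ξ (s + 1) ω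
          - p.proxPoint L .nonconvex par ξ (s + 1) ω‖ ^ 2
        + 8 * L ^ 2 * ‖p.xbar L .nonconvex par ξ (s + 1) ω - p.xbar L .nonconvex par ξ s ω‖ ^ 2 := by
  have hz := proxPoint_eq (r := .nonconvex) (par := par) (ξ := ξ) hM hL hF (s + 1) ω
  rw [avg_y_nonconvex hM] at hz
  set X := p.xbar L .nonconvex par ξ s ω
  set X' := p.xbar L .nonconvex par ξ (s + 1) ω
  set z := p.proxPoint L .nonconvex par ξ (s + 1) ω
  have h1 := (smoothWith_obj hM hF).2 X' z
  have h2 : gradient p.obj X' = (gradient p.obj X' - gradient p.obj z)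
      + (2 * L) • (X' - z) - (2 * L) • (X' - X) := by
    rw [eq_sub_of_add_eq hz]
    module
  have h3 : ‖gradient p.obj X'‖ ≤ 3 * L * ‖X' - z‖ + 2 * L * ‖X' - X‖ := by
    rw [h2]
    refine (norm_sub_le _ _).trans (add_le_add ((norm_add_le _ _).trans ?_) ?_)
    · rw [norm_smul, Real.norm_of_nonneg (by positivity)]
      linarith
    · rw [norm_smul, Real.norm_of_nonneg (by positivity)]
  refine (sq_le_two_mul (norm_nonneg _) h3).trans (le_of_eq ?_)
  ring

variable [MeasurableSpace Ω] {P : Measure Ω} [IsProbabilityMeasure P]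

/-- In this direction additivity of the lower integral requires no measurability of the summands. -/
theorem sum_lintegral_le {ι : Type*} (t : Finset ι) (f : ι → Ω → ENNReal) :
    ∑ i ∈ t, ∫⁻ ω, f i ω ∂P ≤ ∫⁻ ω, ∑ i ∈ t, f i ω ∂P := by
  classical
  induction t using Finset.induction_on with
  | empty => simp
  | insert i t hi ih =>
    simp only [Finset.sum_insert hi]
    exact (add_le_add_right ih _).trans (le_lintegral_add _ _)

theorem norm_sub_sq_le_mul_sum {X : ℕ → Vec n} (s : ℕ) :
    ‖X s - X 0‖ ^ 2 ≤ s * ∑ k ∈ Finset.range s, ‖X (k + 1) - X k‖ ^ 2 := by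
  rw [← Finset.sum_range_sub]
  refine (pow_le_pow_left₀ (norm_nonneg _) (norm_sum_le _ _) 2).trans ?_
  simpa using sq_sum_le_card_mul_sum_sq (s := Finset.range s) (f := fun k => ‖X (k + 1) - X k‖)

/-- Catalyst with accurate rounds, nonconvex case. -/
theorem catalyst_nonconvex (hp : p.Standing L σ σ₂) (hM : 0 < M)
    (hL : 0 < L) (hΔ : 0 ≤ Δ) (hgap : p.InitGapBound Δ) {G : ℝ} (hG : p.InitGradBound G)
    {S : ℕ} (hS : 1 ≤ S)
    (hacc : ∀ s, InnerAccurate P p ξ L (par (s + 1))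
      (40 * (G ^ 2 / L ^ 2) + 1600 * (12 * (S * (Δ / L)))) (2 / 3 * (Δ / L) / S) (s + 1)) :
    (∀ s ∈ Finset.Icc 1 S, p.expSubGap P L .nonconvex par ξ s ≤ ENNReal.ofReal (Δ / S)) ∧
    ∑ s ∈ Finset.Icc 1 S, p.expGradSq P L .nonconvex par ξ s
      ≤ ENNReal.ofReal (28 * (L * Δ)) := by
  have hMpos : (0 : ℝ) < M := by exact_mod_cast hM
  have hSpos : (0 : ℝ) < S := by exact_mod_cast hS
  have hS1 : (1 : ℝ) ≤ S := by exact_mod_cast hS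
  have hF := hp.smooth
  set ε := 2 / 3 * (Δ / L) / S with hε
  have hε0 : 0 ≤ ε := by positivity
  have hSε : S * ε = 2 / 3 * (Δ / L) := by rw [hε]; field_simp
  have hΔL : 0 ≤ Δ / L := by positivity
  have hr : ∀ s ≤ S, (∀ k < s, UpperMean P (p.errSq L .nonconvex par ξ (k + 1)) (M * ε)) →
      UpperMean P (fun ω => ∑ k ∈ Finset.range s, ‖p.xbar L .nonconvex par ξ (k + 1) ω
          - p.proxPoint L .nonconvex par ξ (k + 1) ω‖ ^ 2) (2 / 3 * (Δ / L)) := by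
    intro s hs h
    have h1 : ∀ k ∈ Finset.range s, UpperMean P (fun ω => ‖p.xbar L .nonconvex par ξ (k + 1) ω
          - p.proxPoint L .nonconvex par ξ (k + 1) ω‖ ^ 2) ε := fun k hk =>
      ((h k (Finset.mem_range.1 hk)).const_mul (by positivity : 0 ≤ 1 / (M : ℝ))).mono
        (fun ω => norm_xbar_sub_proxPoint_sq_le hM _ _) (le_of_eq (by field_simp))
    refine (UpperMean.sum _ h1 fun _ _ => hε0).mono (fun _ => le_rfl) ?_
    rw [Finset.sum_const, Finset.card_range, nsmul_eq_mul, ← hSε]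
    gcongr
  have hd : ∀ s ≤ S, (∀ k < s, UpperMean P (p.errSq L .nonconvex par ξ (k + 1)) (M * ε)) →
      UpperMean P (fun ω => ∑ k ∈ Finset.range s, ‖p.xbar L .nonconvex par ξ (k + 1) ω
          - p.xbar L .nonconvex par ξ k ω‖ ^ 2) (2 * (Δ / L)) := by
    intro s hs h
    refine ((UpperMean.const (Δ / L)).add ((hr s hs h).const_mul
      (by norm_num : (0 : ℝ) ≤ 3 / 2)) hΔL (by positivity)).mono (fun ω => ?_)
      (le_of_eq (by ring))
    have h1 := sum_norm_step_sq_le (par := par) (ξ := ξ) hM hL hF hgap s ω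
    refine le_of_mul_le_mul_left (h1.trans (le_of_eq ?_)) hL
    field_simp
  have herr : ∀ s < S, UpperMean P (p.errSq L .nonconvex par ξ (s + 1)) (M * ε) := by
    -- Here 6ε ≤ 4SΔ/L, and Cauchy–Schwarz over at most S steps bounds the squared displacement by
    -- 2SΔ/L, which counts four times.
    refine upperMean_errSq (B := 12 * (S * (Δ / L)))
      (ε := fun _ => ε) (par := par) hp hM hL hG
      (by positivity) (fun _ => ⟨le_rfl, zero_le_one⟩) ⟨le_rfl, zero_le_one⟩ hacc
      (S := S) (fun k hkS hk => ?_)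
    have h1 := hd (k + 1) hkS fun s' hs' => hk s' (by omega)
    have h2 : UpperMean P (fun ω => ‖p.xbar L .nonconvex par ξ (k + 1) ω - p.x0‖ ^ 2)
        (2 * (S * (Δ / L))) := by
      refine (h1.const_mul hSpos.le).mono (fun ω => ?_) (le_of_eq (by ring))
      have h3 := norm_sub_sq_le_mul_sum (X := fun k => p.xbar L .nonconvex par ξ k ω) (k + 1)
      simp only [xbar_zero hM] at h3
      refine h3.trans (mul_le_mul_of_nonneg_right ?_ (Finset.sum_nonneg fun _ _ => sq_nonneg _))
      exact_mod_cast hkS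
    refine (upperMean_dev hM hε0 (by positivity) (hk k le_rfl) h2).mono (fun _ => le_rfl) ?_
    refine mul_le_mul_of_nonneg_left ?_ hMpos.le
    have h4 : ε ≤ S * ε := le_mul_of_one_le_left hε0 hS1
    have h5 : Δ / L ≤ S * (Δ / L) := le_mul_of_one_le_left hΔL hS1
    linarith
  constructor
  · intro s hs
    obtain ⟨hs1, hs2⟩ := Finset.mem_Icc.1 hs
    obtain ⟨s, rfl⟩ := Nat.exists_eq_add_of_le' hs1
    refine (expSubGap_le hM hL hF (herr s hs2)).trans (ENNReal.ofReal_le_ofReal (le_of_eq ?_))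
    rw [hε]
    field_simp
  · have e : Finset.Icc 1 S = (Finset.range S).image (· + 1) := by
      ext s
      simp only [Finset.mem_Icc, Finset.mem_image, Finset.mem_range]
      exact ⟨fun h => ⟨s - 1, by omega, by omega⟩, fun ⟨k, hk, hks⟩ => by omega⟩
    rw [e, Finset.sum_image fun _ _ _ _ h => Nat.succ_injective h]
    refine (sum_lintegral_le _ _).trans ?_
    have hsq : ∀ v : Vec n, ‖v‖ₑ ^ 2 = ENNReal.ofReal (‖v‖ ^ 2) := fun v => by
      rw [ENNReal.ofReal_pow (norm_nonneg _), ofReal_norm]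
    simp only [hsq]
    simp only [← ENNReal.ofReal_sum_of_nonneg fun _ _ => sq_nonneg _]
    -- 18L² · (2/3)Δ/L + 8L² · 2Δ/L = 28LΔ.
    refine ((((hr S le_rfl herr).const_mul (by positivity : 0 ≤ 18 * L ^ 2)).add
      ((hd S le_rfl herr).const_mul (by positivity : 0 ≤ 8 * L ^ 2)) (by positivity)
      (by positivity)).mono (fun ω => ?_) (le_of_eq ?_)).lintegral_le
    · rw [Finset.mul_sum, Finset.mul_sum, ← Finset.sum_add_distrib]
      exact Finset.sum_le_sum fun k _ => norm_gradient_sq_le hM hL hF k ω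
    · field_simp
      ring

end Nonconvex

end DecOpt

namespace DecOpt

/-! ### Parameters and costs -/

/-- Parameters for which every round of Catalyst is accurate, and their total cost. -/
theorem exists_catalystParams : ∃ C₀ > (0 : ℝ), ∀ (M : ℕ) (L σ σ₂ A η X l : ℝ) (tgt : ℕ → ℝ)
    (S : ℕ), 0 < M → 0 < L → 0 ≤ σ₂ → σ₂ < 1 → 0 ≤ A → 0 < η → (∀ s, 0 < tgt s) →
    (∀ s, 1 ≤ s → s ≤ S → η ≤ tgt s) →
    Real.log (2 + A / η + 1 / (1 - σ₂)) ≤ l * Real.log X →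
    ∃ par : ℕ → AccParams,
      (commCost S par : ℝ) ≤ C₀ * (S * √(1 / (1 - σ₂))) * (l * Real.log X) ∧
      (sampleCost S par : ℝ) ≤ C₀ * (S * √(1 / (1 - σ₂))
        + S * (σ ^ 2 / (L ^ 2 * (1 - σ₂) ^ 3 * η))) * (l * Real.log X) ^ 2 ∧
      ∀ (n : ℕ) (Ξ Ω : Type*) [MeasurableSpace Ξ] [MeasurableSpace Ω]
        (P : Measure Ω) [IsProbabilityMeasure P] (p : Problem M n Ξ)
        (ξ : ℕ → ℕ → ℕ → Fin M → Ω → Ξ), p.Standing L σ σ₂ → IsSampling P p.D ξ →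
        ∀ s, InnerAccurate P p ξ L (par (s + 1)) A (tgt (s + 1)) (s + 1) := by
  obtain ⟨C₀, hC₀, h⟩ := exists_accParams
  refine ⟨C₀, hC₀, fun M L σ σ₂ A η X l tgt S hM hL hσ₂ hσ₂' hA hη htgt hηt hlog => ?_⟩
  choose par hcomm hsamp hacc using fun s => h M L σ σ₂ A (tgt s) hM hL hσ₂ hσ₂' hA (htgt s)
  have hq : 0 < 1 - σ₂ := by linarith
  have hlog0 : ∀ s, 0 ≤ Real.log (2 + A / tgt s + 1 / (1 - σ₂)) := fun s => by
    have := htgt s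
    refine Real.log_nonneg ?_
    have h1 : 0 ≤ A / tgt s := by positivity
    have h2 : 0 ≤ 1 / (1 - σ₂) := by positivity
    linarith
  have hlogs : ∀ s, 1 ≤ s → s ≤ S →
      Real.log (2 + A / tgt s + 1 / (1 - σ₂)) ≤ l * Real.log X := fun s h1 h2 => by
    refine le_trans ?_ hlog
    have := htgt s
    refine Real.log_le_log (by positivity) ?_
    gcongr
    exact hηt s h1 h2
  refine ⟨par, ?_, ?_, fun n Ξ Ω _ _ P _ p ξ hp hξ s => hacc (s + 1) n Ξ Ω P p ξ hp hξ (s + 1)⟩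
  · have h1 : ∀ s ∈ Finset.Icc 1 S,
        ((par s).comm : ℝ) ≤ C₀ * √(1 / (1 - σ₂)) * (l * Real.log X) := fun s hs => by
      obtain ⟨hs1, hs2⟩ := Finset.mem_Icc.1 hs
      exact (hcomm s).trans (mul_le_mul_of_nonneg_left (hlogs s hs1 hs2) (by positivity))
    have h2 := Finset.sum_le_card_nsmul _ _ _ h1
    rw [Nat.card_Icc, Nat.add_sub_cancel, nsmul_eq_mul] at h2
    rw [commCost, Nat.cast_sum]
    refine h2.trans (le_of_eq (by ring))
  · have h1 : ∀ s ∈ Finset.Icc 1 S, ((par s).samples : ℝ) ≤ C₀ * (√(1 / (1 - σ₂))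
        + σ ^ 2 / (L ^ 2 * (1 - σ₂) ^ 3 * η)) * (l * Real.log X) ^ 2 := fun s hs => by
      obtain ⟨hs1, hs2⟩ := Finset.mem_Icc.1 hs
      have h3 := hηt s hs1 hs2
      have h4 := htgt s
      refine (hsamp s).trans ?_
      have h5 := pow_le_pow_left₀ (hlog0 s) (hlogs s hs1 hs2) 2
      gcongr
    have h2 := Finset.sum_le_card_nsmul _ _ _ h1
    rw [Nat.card_Icc, Nat.add_sub_cancel, nsmul_eq_mul] at h2
    rw [sampleCost, Nat.cast_sum]
    refine h2.trans (le_of_eq (by ring))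

/-- For Δ ≤ ε the starting point is already accurate enough and no round is run. -/
theorem exists_params_zero (L : ℝ) (r : Regime) : ∃ par : ℕ → AccParams,
    commCost 0 par = 0 ∧ sampleCost 0 par = 0 ∧
    ∀ (M n : ℕ) (Ξ Ω : Type*) [MeasurableSpace Ξ] [MeasurableSpace Ω] (P : Measure Ω)
      [IsProbabilityMeasure P] (p : Problem M n Ξ) (ξ : ℕ → ℕ → ℕ → Fin M → Ω → Ξ) (Δ : ℝ),
      0 < M → p.InitGapBound Δ → p.expGap P L r par ξ 0 ≤ ENNReal.ofReal Δ := by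
  refine ⟨fun _ => ⟨0, 0, fun _ => 1, 1, 0, fun _ => one_pos, one_pos, le_rfl⟩, rfl, rfl,
    fun M n Ξ Ω _ _ P _ p ξ Δ hM hΔ => ?_⟩
  refine ((UpperMean.const (P := P) Δ).mono (fun ω => ?_) le_rfl).lintegral_le
  rw [xbar_zero hM]
  have : p.obj p.x0 - Δ ≤ ⨅ z, p.obj z := le_ciInf fun z => by
    have := hΔ z
    linarith
  linarith

/-- The number of rounds in the strongly convex case. -/
theorem exists_rounds_stronglyConvex {a Δ ε : ℝ} (ha : 0 < a) (ha1 : a ≤ 1) (hε : 0 < ε)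
    (hΔ : ε < Δ) : ∃ S : ℕ, 20 / a ^ 2 * Δ * (1 - 0.9 * a) ^ S ≤ ε ∧
      (S : ℝ) ≤ Real.log (20 / a ^ 2 * Δ / ε) / (0.9 * a) + 1 ∧
      ∀ s ≤ S, a ^ 2 * ε / 200 ≤ (1 - 0.9 * a) ^ s * Δ := by
  have hΔ0 : 0 < Δ := hε.trans hΔ
  have hB : 0 < 20 / a ^ 2 * Δ / ε := by positivity
  have hr : 0 < 0.9 * a := by positivity
  have hr1 : 0.9 * a ≤ 1 := by linarith
  have key : ∀ N : ℕ, Real.log (20 / a ^ 2 * Δ / ε) / (0.9 * a) ≤ N →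
      20 / a ^ 2 * Δ * (1 - 0.9 * a) ^ N ≤ ε := fun N hN => by
    have h1 := one_sub_pow_le hr hr1 hB hN
    calc 20 / a ^ 2 * Δ * (1 - 0.9 * a) ^ N ≤ 20 / a ^ 2 * Δ * (1 / (20 / a ^ 2 * Δ / ε)) := by
          gcongr
      _ = ε := by field_simp
  -- The least admissible number of rounds is taken: minimality prevents the tolerances from
  -- dropping far below the target, on which the sample bound relies. The last round can lose at
  -- most the factor 1 − 0.9a ≥ 0.1.
  have hex : ∃ N : ℕ, 20 / a ^ 2 * Δ * (1 - 0.9 * a) ^ N ≤ ε := ⟨_, key _ (Nat.le_ceil _)⟩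
  classical
  have h1 := Nat.find_spec hex
  have h2 : Nat.find hex ≤ ⌈Real.log (20 / a ^ 2 * Δ / ε) / (0.9 * a)⌉₊ :=
    Nat.find_min' hex (key _ (Nat.le_ceil _))
  have hlog : 0 ≤ Real.log (20 / a ^ 2 * Δ / ε) := by
    refine Real.log_nonneg ?_
    rw [le_div_iff₀ hε, one_mul]
    have : 1 ≤ 20 / a ^ 2 := by
      rw [le_div_iff₀ (by positivity)]
      nlinarith
    nlinarith
  refine ⟨Nat.find hex, h1, ?_, fun s hs => ?_⟩
  · refine (Nat.cast_le.2 h2).trans (Nat.ceil_lt_add_one (by positivity)).le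
  · cases s with
    | zero =>
      rw [pow_zero, one_mul]
      have : a ^ 2 * ε ≤ ε := mul_le_of_le_one_left hε.le (pow_le_one₀ ha.le ha1)
      linarith
    | succ s =>
      have h3 := Nat.find_min hex (m := s) (by omega)
      rw [not_le] at h3
      have h4 : 0.1 ≤ 1 - 0.9 * a := by linarith
      have h5 : a ^ 2 * ε / 20 ≤ (1 - 0.9 * a) ^ s * Δ := by
        have e : 20 / a ^ 2 * Δ * (1 - 0.9 * a) ^ s = ((1 - 0.9 * a) ^ s * Δ) * 20 / a ^ 2 := by
          ring
        rw [e, lt_div_iff₀ (by positivity)] at h3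
        linarith
      have h6 : 0 ≤ (1 - 0.9 * a) ^ s * Δ := le_trans (by positivity) h5
      rw [pow_succ (1 - 0.9 * a), mul_right_comm]
      have h7 := mul_le_mul_of_nonneg_left h4 h6
      linarith

-- There are of order √κ log X rounds, and the smallest tolerance is of order a²ε/L with 1/a² ≤ 3κ.
-- The noise part per round is then of order κσ²/(Lε) = σ²/(με), up to logarithms and powers of 1 −
-- σ₂.
set_option maxHeartbeats 1000000 in
theorem catalyst_complexity_stronglyConvex :
    ∃ C > (0 : ℝ), ∃ e : ℕ, ∀ (M : ℕ) (L μ σ σ₂ Δ G ε : ℝ), 0 < M → 0 < μ → μ ≤ L → 0 ≤ σ →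
      0 ≤ σ₂ → σ₂ < 1 → 0 ≤ Δ → 0 ≤ G → 0 < ε →
      ∃ (S : ℕ) (par : ℕ → AccParams),
        (commCost S par : ℝ) ≤ C * √((L / μ) / (1 - σ₂))
          * Real.log (2 + M + L / μ + 1 / (1 - σ₂) + (Δ + G ^ 2 / L) / ε) ^ e ∧
        (sampleCost S par : ℝ) ≤ C * (√((L / μ) / (1 - σ₂))
            + √(L / μ) * σ ^ 2 / (μ * (1 - σ₂) ^ 3 * ε))
          * Real.log (2 + M + L / μ + 1 / (1 - σ₂) + (Δ + G ^ 2 / L) / ε) ^ e ∧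
        ∀ (n : ℕ) (Ξ Ω : Type*) [MeasurableSpace Ξ] [MeasurableSpace Ω]
          (P : Measure Ω) [IsProbabilityMeasure P] (p : Problem M n Ξ)
          (ξ : ℕ → ℕ → ℕ → Fin M → Ω → Ξ),
          p.Standing L σ σ₂ → IsSampling P p.D ξ → (∀ m, StronglyConvexWith μ (p.F m)) →
          p.InitGapBound Δ → p.InitGradBound G →
          (∀ s ∈ Finset.Icc 1 S, p.expSubGap P L (.stronglyConvex μ) par ξ s ≤
            ENNReal.ofReal (2 * (1 - 0.9 * √(μ / (μ + 2 * L))) ^ s * Δ / 9)) ∧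
          p.expGap P L (.stronglyConvex μ) par ξ S ≤ ENNReal.ofReal ε := by
  obtain ⟨C₀, hC₀, hpar⟩ := exists_catalystParams
  refine ⟨10 ^ 9 * C₀, by positivity, 3,
    fun M L μ σ σ₂ Δ G ε hM hμ hμL hσ hσ₂ hσ₂' hΔ hG hε => ?_⟩
  have hL : 0 < L := hμ.trans_le hμL
  have hq : 0 < 1 - σ₂ := by linarith
  obtain ⟨X, hX⟩ : ∃ X, X = 2 + M + L / μ + 1 / (1 - σ₂) + (Δ + G ^ 2 / L) / ε := ⟨_, rfl⟩
  have hM0 : (0 : ℝ) ≤ M := Nat.cast_nonneg M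
  have hκ0 : 0 ≤ L / μ := by positivity
  have hu0 : 0 ≤ 1 / (1 - σ₂) := by positivity
  have hΔε : 0 ≤ Δ / ε := by positivity
  have hGε : 0 ≤ G ^ 2 / L / ε := by positivity
  rw [← hX]
  rw [add_div] at hX
  have hX2 : 2 ≤ X := by linarith
  have hlogX := half_le_log hX2
  rcases le_or_gt Δ ε with hΔle | hΔlt
  · obtain ⟨par, h1, h2, h3⟩ := exists_params_zero L (.stronglyConvex μ)
    refine ⟨0, par, ?_, ?_, fun n Ξ Ω _ _ P _ p ξ _ _ _ hgap _ => ⟨fun s hs => ?_, ?_⟩⟩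
    · rw [h1, Nat.cast_zero]
      positivity
    · rw [h2, Nat.cast_zero]
      positivity
    · simp at hs
    · exact (h3 M n Ξ Ω P p ξ Δ hM hgap).trans (ENNReal.ofReal_le_ofReal hΔle)
  obtain ⟨a, ha⟩ : ∃ a, a = √(μ / (μ + 2 * L)) := ⟨_, rfl⟩
  have hqa : 0 < μ / (μ + 2 * L) := by positivity
  have ha0 : 0 < a := by rw [ha]; exact Real.sqrt_pos.2 hqa
  have ha2 : a ^ 2 = μ / (μ + 2 * L) := by rw [ha, Real.sq_sqrt hqa.le]
  have ha1 : a ≤ 1 := by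
    rw [ha]
    refine Real.sqrt_le_iff.2 ⟨zero_le_one, ?_⟩
    rw [one_pow, div_le_one (by positivity)]
    linarith
  have hinv : 1 / a ^ 2 ≤ 3 * (L / μ) := by
    rw [ha2, one_div_div, ← mul_div_assoc, div_le_div_iff_of_pos_right hμ]
    linarith
  have hinv1 : 1 / a ≤ 2 * √(L / μ) := by
    refine abs_le_of_sq_le_sq' ?_ (by positivity) |>.2
    rw [mul_pow, Real.sq_sqrt hκ0, one_div_pow]
    linarith
  have hinv0 : 0 < 1 / a ^ 2 := by positivity
  have hκX : L / μ ≤ X := by linarith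
  have hΔX : Δ / ε ≤ X := by linarith
  have hGX : G ^ 2 / L / ε ≤ X := by linarith
  have hX0 : 0 ≤ X := by linarith
  obtain ⟨S, hS1, hS2, hS3⟩ := exists_rounds_stronglyConvex ha0 ha1 hε hΔlt
  have hΔ0 : 0 < Δ := hε.trans hΔlt
  have hS : (S : ℝ) ≤ 24 * √(L / μ) * Real.log X := by
    have h1 : Real.log (20 / a ^ 2 * Δ / ε) ≤ ((6 : ℕ) + (2 : ℕ)) * Real.log X := by
      refine log_le_mul_log (c := 60) hX2 (by positivity) ?_ (by norm_num)
      calc 20 / a ^ 2 * Δ / ε = 20 * (1 / a ^ 2) * (Δ / ε) := by ring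
        _ ≤ 20 * (3 * X) * X := by gcongr; exact hinv.trans (by gcongr)
        _ = 60 * X ^ 2 := by ring
    have h2 : Real.log (20 / a ^ 2 * Δ / ε) / (0.9 * a) ≤ 9 * Real.log X * (1 / a) := by
      rw [div_le_iff₀ (by positivity)]
      have : 9 * Real.log X * (1 / a) * (0.9 * a) = 8.1 * Real.log X := by
        field_simp
        norm_num
      rw [this]
      norm_num at h1
      linarith
    have h3 : 1 ≤ 1 / a := by rw [le_div_iff₀ ha0]; linarith
    have h4 : 12 * Real.log X * (1 / a) ≤ 12 * Real.log X * (2 * √(L / μ)) := by gcongr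
    have h5 : 1 ≤ 2 * Real.log X * (1 / a) := one_le_mul_of_one_le_of_one_le (by linarith) h3
    have h6 : 0 ≤ Real.log X * (1 / a) := by positivity
    linarith
  have hρ : 0 < 1 - 0.9 * a := by linarith
  -- The lower bound a²ε/200 on (1 − 0.9a)^s Δ, divided by the 34L of the tolerance.
  have hη : 0 < a ^ 2 * ε / (6800 * L) := by positivity
  have hlog : Real.log (2 + (40 * (G ^ 2 / L ^ 2) + 1600 * (400 * Δ / (μ * a ^ 2)))
      / (a ^ 2 * ε / (6800 * L)) + 1 / (1 - σ₂)) ≤ 40 * Real.log X := by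
    refine (log_le_mul_log (c := 2 ^ 36) (a := 36) (k := 4) hX2 (by positivity) ?_ le_rfl).trans_eq
      (by norm_num)
    have e : (40 * (G ^ 2 / L ^ 2) + 1600 * (400 * Δ / (μ * a ^ 2))) / (a ^ 2 * ε / (6800 * L))
        = 272000 * ((1 / a ^ 2) * (G ^ 2 / L / ε))
          + 4352000000 * ((1 / a ^ 2) ^ 2 * (L / μ) * (Δ / ε)) := by
      field_simp
      ring
    have hia : 1 / a ^ 2 ≤ 3 * X := hinv.trans (by gcongr)
    have h1 : (1 / a ^ 2) * (G ^ 2 / L / ε) ≤ 3 * X * X := by gcongr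
    have h2 : (1 / a ^ 2) ^ 2 * (L / μ) * (Δ / ε) ≤ (3 * X) ^ 2 * X * X := by gcongr
    have h3 : X ≤ X ^ 4 := le_self_pow₀ (by linarith) (by norm_num)
    have h4 : X ^ 2 ≤ X ^ 4 := pow_le_pow_right₀ (by linarith) (by norm_num)
    have h5 : 1 / (1 - σ₂) ≤ X := by linarith
    rw [e]
    linarith
  obtain ⟨par, hcomm, hsamp, hacc⟩ := hpar M L σ σ₂
    (40 * (G ^ 2 / L ^ 2) + 1600 * (400 * Δ / (μ * a ^ 2))) (a ^ 2 * ε / (6800 * L)) X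
    40 (fun s => (1 - 0.9 * a) ^ s * Δ / (34 * L)) S hM hL hσ₂ hσ₂'
    (by positivity) hη (fun s => by positivity) (fun s _ hs => by
      have h1 := hS3 s hs
      rw [div_le_div_iff₀ (by positivity) (by positivity)]
      have := mul_le_mul_of_nonneg_right h1 (by positivity : 0 ≤ 6800 * L)
      linarith) hlog
  rw [← ha]
  have hsq : √((L / μ) / (1 - σ₂)) = √(L / μ) * √(1 / (1 - σ₂)) := by
    rw [← Real.sqrt_mul hκ0, mul_one_div]
  have hlog2 : Real.log X ^ 2 ≤ 2 * Real.log X ^ 3 := by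
    have := mul_le_mul_of_nonneg_left hlogX (sq_nonneg (Real.log X))
    rw [pow_succ _ 2]
    linarith
  have hlog0 : 0 ≤ Real.log X := by linarith
  have hSu : S * √(1 / (1 - σ₂)) ≤ 24 * √((L / μ) / (1 - σ₂)) * Real.log X := by
    rw [hsq]
    calc S * √(1 / (1 - σ₂)) ≤ 24 * √(L / μ) * Real.log X * √(1 / (1 - σ₂)) := by gcongr
      _ = _ := by ring
  refine ⟨S, par, ?_, ?_, fun n Ξ Ω _ _ P _ p ξ hp hξ hsc hgap hgrad => ?_⟩
  · calc (commCost S par : ℝ) ≤ C₀ * (24 * √((L / μ) / (1 - σ₂)) * Real.log X)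
          * (40 * Real.log X) := hcomm.trans (by gcongr)
      _ = 960 * C₀ * √((L / μ) / (1 - σ₂)) * Real.log X ^ 2 := by ring
      _ ≤ 960 * C₀ * √((L / μ) / (1 - σ₂)) * (2 * Real.log X ^ 3) := by gcongr
      _ = 1920 * (C₀ * √((L / μ) / (1 - σ₂)) * Real.log X ^ 3) := by ring
      _ ≤ 10 ^ 9 * (C₀ * √((L / μ) / (1 - σ₂)) * Real.log X ^ 3) := by gcongr; norm_num
      _ = _ := by ring
  · have h1 : S * (σ ^ 2 / (L ^ 2 * (1 - σ₂) ^ 3 * (a ^ 2 * ε / (6800 * L))))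
        ≤ 489600 * (√(L / μ) * σ ^ 2 / (μ * (1 - σ₂) ^ 3 * ε)) * Real.log X := by
      calc S * (σ ^ 2 / (L ^ 2 * (1 - σ₂) ^ 3 * (a ^ 2 * ε / (6800 * L))))
          = S * (6800 * (1 / a ^ 2) * (σ ^ 2 / (L * (1 - σ₂) ^ 3 * ε))) := by field_simp
        _ ≤ 24 * √(L / μ) * Real.log X
            * (6800 * (3 * (L / μ)) * (σ ^ 2 / (L * (1 - σ₂) ^ 3 * ε))) := by gcongr
        _ = _ := by field_simp; ring
    calc (sampleCost S par : ℝ) ≤ C₀ * (24 * √((L / μ) / (1 - σ₂)) * Real.log X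
          + 489600 * (√(L / μ) * σ ^ 2 / (μ * (1 - σ₂) ^ 3 * ε)) * Real.log X)
          * (40 * Real.log X) ^ 2 := hsamp.trans (by gcongr)
      _ = C₀ * Real.log X ^ 3 * (38400 * √((L / μ) / (1 - σ₂))
          + 783360000 * (√(L / μ) * σ ^ 2 / (μ * (1 - σ₂) ^ 3 * ε))) := by ring
      _ ≤ C₀ * Real.log X ^ 3 * (10 ^ 9 * √((L / μ) / (1 - σ₂))
          + 10 ^ 9 * (√(L / μ) * σ ^ 2 / (μ * (1 - σ₂) ^ 3 * ε))) := by
        gcongr <;> norm_num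
      _ = _ := by ring
  · obtain ⟨h1, h2⟩ := catalyst_stronglyConvex hp hM hμ hμL hsc hΔ hgap hgrad ha
      (hacc n Ξ Ω P p ξ hp hξ)
    exact ⟨fun s hs => h1 s (Finset.mem_Icc.1 hs).1,
      (h2 S).trans (ENNReal.ofReal_le_ofReal hS1)⟩

end DecOpt

/-! ### Total complexity in the nonconvex and convex cases -/

namespace DecOpt

set_option maxHeartbeats 1000000 in
theorem catalyst_complexity_nonconvex :
    ∃ C > (0 : ℝ), ∃ e : ℕ, ∀ (M : ℕ) (L σ σ₂ Δ G ε : ℝ), 0 < M → 0 < L → 0 ≤ σ →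
      0 ≤ σ₂ → σ₂ < 1 → 0 ≤ Δ → 0 ≤ G → 0 < ε → ε ^ 2 ≤ 2 * L * Δ →
      ∃ (S : ℕ) (par : ℕ → AccParams), 1 ≤ S ∧
        (commCost S par : ℝ) ≤ C * (L * Δ / (√(1 - σ₂) * ε ^ 2))
          * Real.log (2 + M + 1 / (1 - σ₂) + (L * Δ + G ^ 2) / ε ^ 2) ^ e ∧
        (sampleCost S par : ℝ) ≤ C * (L * Δ / (√(1 - σ₂) * ε ^ 2)
            + L * Δ * σ ^ 2 / ((1 - σ₂) ^ 3 * ε ^ 4))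
          * Real.log (2 + M + 1 / (1 - σ₂) + (L * Δ + G ^ 2) / ε ^ 2) ^ e ∧
        ∀ (n : ℕ) (Ξ Ω : Type*) [MeasurableSpace Ξ] [MeasurableSpace Ω]
          (P : Measure Ω) [IsProbabilityMeasure P] (p : Problem M n Ξ)
          (ξ : ℕ → ℕ → ℕ → Fin M → Ω → Ξ),
          p.Standing L σ σ₂ → IsSampling P p.D ξ → p.InitGapBound Δ → p.InitGradBound G →
          (∀ s ∈ Finset.Icc 1 S, p.expSubGap P L .nonconvex par ξ s ≤
            ENNReal.ofReal (Δ / S)) ∧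
          (∑ s ∈ Finset.Icc 1 S, p.expGradSq P L .nonconvex par ξ s) / S
            ≤ ENNReal.ofReal (ε ^ 2) := by
  obtain ⟨C₀, hC₀, hpar⟩ := exists_catalystParams
  refine ⟨10 ^ 7 * C₀, by positivity, 2,
    fun M L σ σ₂ Δ G ε hM hL hσ hσ₂ hσ₂' hΔ hG hε hεΔ => ?_⟩
  have hq : 0 < 1 - σ₂ := by linarith
  obtain ⟨X, hX⟩ : ∃ X, X = 2 + M + 1 / (1 - σ₂) + (L * Δ + G ^ 2) / ε ^ 2 := ⟨_, rfl⟩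
  have hM0 : (0 : ℝ) ≤ M := Nat.cast_nonneg M
  have hu0 : 0 ≤ 1 / (1 - σ₂) := by positivity
  have hΔε : 0 ≤ L * Δ / ε ^ 2 := by positivity
  have hGε : 0 ≤ G ^ 2 / ε ^ 2 := by positivity
  rw [← hX]
  rw [add_div] at hX
  have hX2 : 2 ≤ X := by linarith
  have hlogX := half_le_log hX2
  have hlog0 : 0 ≤ Real.log X := by linarith
  have hΔ0 : 0 < Δ := by
    rcases hΔ.eq_or_lt with h | h
    · rw [← h, mul_zero] at hεΔ
      exact absurd hεΔ (not_le.2 (by positivity))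
    · exact h
  have hΔX : L * Δ / ε ^ 2 ≤ X := by linarith
  have hGX : G ^ 2 / ε ^ 2 ≤ X := by linarith
  have hΔ1 : 1 ≤ 2 * (L * Δ / ε ^ 2) := by
    rw [← mul_div_assoc, le_div_iff₀ (by positivity)]
    linarith
  obtain ⟨S, hSd⟩ : ∃ S : ℕ, S = ⌈28 * (L * Δ / ε ^ 2)⌉₊ := ⟨_, rfl⟩
  have hS1 : 28 * (L * Δ / ε ^ 2) ≤ S := by rw [hSd]; exact Nat.le_ceil _
  -- Rounding up costs 1, which is at most 2LΔ/ε² by the hypothesis on ε.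
  have hS2 : (S : ℝ) ≤ 30 * (L * Δ / ε ^ 2) := by
    have := (Nat.ceil_lt_add_one (by positivity : 0 ≤ 28 * (L * Δ / ε ^ 2))).le
    rw [← hSd] at this
    linarith
  have hSpos : (0 : ℝ) < S := lt_of_lt_of_le (by positivity) hS1
  have hS : 1 ≤ S := by exact_mod_cast hSpos
  have hη : 0 < 2 / 3 * (Δ / L) / S := by positivity
  have hlog : Real.log (2 + (40 * (G ^ 2 / L ^ 2) + 1600 * (12 * (S * (Δ / L))))
      / (2 / 3 * (Δ / L) / S) + 1 / (1 - σ₂)) ≤ 27 * Real.log X := by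
    refine (log_le_mul_log (c := 2 ^ 25) (a := 25) (k := 2) hX2 (by positivity) ?_ le_rfl).trans_eq
      (by norm_num)
    have e : (40 * (G ^ 2 / L ^ 2) + 1600 * (12 * (S * (Δ / L)))) / (2 / 3 * (Δ / L) / S)
        = 60 * (S * (G ^ 2 / (L * Δ))) + 28800 * (S : ℝ) ^ 2 := by
      field_simp
      ring
    have h1 : S * (G ^ 2 / (L * Δ)) ≤ 30 * X := by
      calc S * (G ^ 2 / (L * Δ)) ≤ 30 * (L * Δ / ε ^ 2) * (G ^ 2 / (L * Δ)) := by gcongr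
        _ = 30 * (G ^ 2 / ε ^ 2) := by field_simp
        _ ≤ 30 * X := by gcongr
    have h2 : (S : ℝ) ^ 2 ≤ (30 * X) ^ 2 := by
      gcongr
      exact hS2.trans (by gcongr)
    have h3 : X ≤ X ^ 2 := le_self_pow₀ (by linarith) (by norm_num)
    have h5 : 1 / (1 - σ₂) ≤ X := by linarith
    rw [e]
    linarith
  obtain ⟨par, hcomm, hsamp, hacc⟩ := hpar M L σ σ₂
    (40 * (G ^ 2 / L ^ 2) + 1600 * (12 * (S * (Δ / L)))) (2 / 3 * (Δ / L) / S) X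
    27 (fun _ => 2 / 3 * (Δ / L) / S) S hM hL hσ₂ hσ₂'
    (by positivity) hη (fun s => hη) (fun s _ _ => le_rfl) hlog
  have hSu : S * √(1 / (1 - σ₂)) ≤ 30 * (L * Δ / (√(1 - σ₂) * ε ^ 2)) := by
    have hq' : 0 < √(1 - σ₂) := Real.sqrt_pos.2 hq
    rw [Real.sqrt_div zero_le_one, Real.sqrt_one]
    calc S * (1 / √(1 - σ₂)) ≤ 30 * (L * Δ / ε ^ 2) * (1 / √(1 - σ₂)) := by gcongr
      _ = _ := by field_simp
  refine ⟨S, par, hS, ?_, ?_, fun n Ξ Ω _ _ P _ p ξ hp hξ hgap hgrad => ?_⟩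
  · calc (commCost S par : ℝ) ≤ C₀ * (30 * (L * Δ / (√(1 - σ₂) * ε ^ 2))) * (27 * Real.log X) :=
        hcomm.trans (by gcongr)
      _ = 810 * C₀ * (L * Δ / (√(1 - σ₂) * ε ^ 2)) * (Real.log X * 1) := by ring
      _ ≤ 810 * C₀ * (L * Δ / (√(1 - σ₂) * ε ^ 2)) * (Real.log X * (2 * Real.log X)) := by
        gcongr
        linarith
      _ = 1620 * (C₀ * (L * Δ / (√(1 - σ₂) * ε ^ 2)) * Real.log X ^ 2) := by ring
      _ ≤ 10 ^ 7 * (C₀ * (L * Δ / (√(1 - σ₂) * ε ^ 2)) * Real.log X ^ 2) := by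
        gcongr
        norm_num
      _ = _ := by ring
  -- The common tolerance is proportional to 1/S, so the noise cost grows like S², hence like ε⁻⁴.
  · have h1 : S * (σ ^ 2 / (L ^ 2 * (1 - σ₂) ^ 3 * (2 / 3 * (Δ / L) / S)))
        ≤ 1350 * (L * Δ * σ ^ 2 / ((1 - σ₂) ^ 3 * ε ^ 4)) := by
      calc S * (σ ^ 2 / (L ^ 2 * (1 - σ₂) ^ 3 * (2 / 3 * (Δ / L) / S)))
          = 3 / 2 * (S : ℝ) ^ 2 * (σ ^ 2 / (L * Δ * (1 - σ₂) ^ 3)) := by field_simp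
        _ ≤ 3 / 2 * (30 * (L * Δ / ε ^ 2)) ^ 2 * (σ ^ 2 / (L * Δ * (1 - σ₂) ^ 3)) := by gcongr
        _ = _ := by field_simp; ring
    calc (sampleCost S par : ℝ) ≤ C₀ * (30 * (L * Δ / (√(1 - σ₂) * ε ^ 2))
          + 1350 * (L * Δ * σ ^ 2 / ((1 - σ₂) ^ 3 * ε ^ 4))) * (27 * Real.log X) ^ 2 :=
        hsamp.trans (by gcongr)
      _ = C₀ * Real.log X ^ 2 * (21870 * (L * Δ / (√(1 - σ₂) * ε ^ 2))
          + 984150 * (L * Δ * σ ^ 2 / ((1 - σ₂) ^ 3 * ε ^ 4))) := by ring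
      _ ≤ C₀ * Real.log X ^ 2 * (10 ^ 7 * (L * Δ / (√(1 - σ₂) * ε ^ 2))
          + 10 ^ 7 * (L * Δ * σ ^ 2 / ((1 - σ₂) ^ 3 * ε ^ 4))) := by
        gcongr <;> norm_num
      _ = _ := by ring
  · obtain ⟨h1, h2⟩ := catalyst_nonconvex hp hM hL hΔ hgap hgrad hS (hacc n Ξ Ω P p ξ hp hξ)
    refine ⟨h1, ENNReal.div_le_of_le_mul (h2.trans ?_)⟩
    rw [← ENNReal.ofReal_natCast, ← ENNReal.ofReal_mul (by positivity)]
    refine ENNReal.ofReal_le_ofReal ?_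
    have := mul_le_mul_of_nonneg_left hS1 (by positivity : 0 ≤ ε ^ 2)
    refine le_trans (le_of_eq ?_) this
    field_simp

set_option maxHeartbeats 1000000 in
theorem catalyst_complexity_convex :
    ∀ γ : ℝ, 0 < γ → γ ≤ 1 →
      ∃ C > (0 : ℝ), ∃ e : ℕ, ∀ (M : ℕ) (L σ σ₂ Δ R G ε : ℝ), 0 < M → 0 < L → 0 ≤ σ →
      0 ≤ σ₂ → σ₂ < 1 → 0 ≤ Δ → 0 ≤ R → 0 ≤ G → 0 < ε →
      ∃ (S : ℕ) (par : ℕ → AccParams),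
        (commCost S par : ℝ) ≤ C * √((L * R ^ 2 + Δ) / ((1 - σ₂) * ε))
          * Real.log (2 + M + 1 / (1 - σ₂) + (L * R ^ 2 + Δ + G ^ 2 / L) / ε) ^ e ∧
        (sampleCost S par : ℝ) ≤ C * (√((L * R ^ 2 + Δ) / ((1 - σ₂) * ε))
            + (L * R ^ 2 + Δ) ^ (2.5 + γ / 2) * σ ^ 2
              / (L * Δ * (1 - σ₂) ^ 3 * ε ^ (2.5 + γ / 2)))
          * Real.log (2 + M + 1 / (1 - σ₂) + (L * R ^ 2 + Δ + G ^ 2 / L) / ε) ^ e ∧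
        ∀ (n : ℕ) (Ξ Ω : Type*) [MeasurableSpace Ξ] [MeasurableSpace Ω]
          (P : Measure Ω) [IsProbabilityMeasure P] (p : Problem M n Ξ)
          (ξ : ℕ → ℕ → ℕ → Fin M → Ω → Ξ),
          p.Standing L σ σ₂ → IsSampling P p.D ξ → (∀ m, ConvexOn ℝ Set.univ (p.F m)) →
          p.InitGapBound Δ → p.InitDistBound R → p.InitGradBound G →
          (∀ s ∈ Finset.Icc 1 S, p.expSubGap P L .convex par ξ s ≤
            ENNReal.ofReal (2 * Δ / (9 * ((s : ℝ) + 1) ^ (4 + γ)))) ∧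
          p.expGap P L .convex par ξ S ≤ ENNReal.ofReal ε := by
  intro γ hγ hγ1
  obtain ⟨C₀, hC₀, hpar⟩ := exists_catalystParams
  obtain ⟨D, hD⟩ : ∃ D, D = growthBound γ := ⟨_, rfl⟩
  have hD1 : 1 ≤ D := hD ▸ (one_le_growth γ 0).trans (growth_le hγ 0)
  -- S is 2√D·w rounded up, with w = √(B/ε) ≥ 1, so S + 1 ≤ d·w.
  obtain ⟨d, hd⟩ : ∃ d, d = 2 * √D + 2 := ⟨_, rfl⟩
  have hd1 : 1 ≤ d := by
    rw [hd]
    have := Real.sqrt_nonneg D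
    linarith
  have hd0 : 0 < d := by linarith
  -- All constants depending on γ inside the logarithm are absorbed into a power 2^k.
  obtain ⟨k, hk⟩ := pow_unbounded_of_one_lt (2 + 9 * d ^ 5 * (40 + 27200 * D))
    (one_lt_two : (1 : ℝ) < 2)
  obtain ⟨l, hl⟩ : ∃ l : ℝ, l = k + 6 := ⟨_, rfl⟩
  have hl1 : 1 ≤ l := by
    have : (0 : ℝ) ≤ k := Nat.cast_nonneg k
    linarith
  have hl0 : 0 < l := by linarith
  have hd6 : d ≤ d ^ 6 := le_self_pow₀ hd1 (by norm_num)
  have hd60 : 1 ≤ d ^ 6 := one_le_pow₀ hd1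
  refine ⟨C₀ * (9 * d ^ 6 * l ^ 2), by positivity, 2,
    fun M L σ σ₂ Δ R G ε hM hL hσ hσ₂ hσ₂' hΔ hR hG hε => ?_⟩
  have hq : 0 < 1 - σ₂ := by linarith
  obtain ⟨B, hB⟩ : ∃ B, B = L * R ^ 2 + Δ := ⟨_, rfl⟩
  have hB0 : 0 ≤ B := by rw [hB]; positivity
  have hΔB : Δ ≤ B := by
    rw [hB]
    have : 0 ≤ L * R ^ 2 := by positivity
    linarith
  rw [← hB]
  obtain ⟨X, hX⟩ : ∃ X, X = 2 + M + 1 / (1 - σ₂) + (B + G ^ 2 / L) / ε := ⟨_, rfl⟩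
  have hM0 : (0 : ℝ) ≤ M := Nat.cast_nonneg M
  have hu0 : 0 ≤ 1 / (1 - σ₂) := by positivity
  have hBε : 0 ≤ B / ε := by positivity
  have hGε : 0 ≤ G ^ 2 / L / ε := by positivity
  rw [← hX]
  rw [add_div] at hX
  have hX2 : 2 ≤ X := by linarith
  have hlogX := half_le_log hX2
  have hlog0 : 0 ≤ Real.log X := by linarith
  rcases le_or_gt Δ ε with hΔle | hΔlt
  · obtain ⟨par, h1, h2, h3⟩ := exists_params_zero L .convex
    refine ⟨0, par, ?_, ?_, fun n Ξ Ω _ _ P _ p ξ _ _ _ hgap _ _ => ⟨fun s hs => ?_, ?_⟩⟩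
    · rw [h1, Nat.cast_zero]
      positivity
    · rw [h2, Nat.cast_zero]
      positivity
    · simp at hs
    · exact (h3 M n Ξ Ω P p ξ Δ hM hgap).trans (ENNReal.ofReal_le_ofReal hΔle)
  have hΔ0 : 0 < Δ := hε.trans hΔlt
  have hBpos : 0 < B := hΔ0.trans_le hΔB
  have hBX : B / ε ≤ X := by linarith
  have hGX : G ^ 2 / L / ε ≤ X := by linarith
  have hBε1 : 1 ≤ B / ε := by
    rw [le_div_iff₀ hε]
    linarith
  obtain ⟨w, hw⟩ : ∃ w, w = √(B / ε) := ⟨_, rfl⟩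
  have hw2 : w ^ 2 = B / ε := by rw [hw, Real.sq_sqrt hBε]
  have hw1 : 1 ≤ w := by rw [hw]; exact Real.one_le_sqrt.2 hBε1
  have hw0 : 0 < w := by linarith
  have hsD : √D ^ 2 = D := Real.sq_sqrt (by linarith)
  have hsD0 : 0 < √D := Real.sqrt_pos.2 (by linarith)
  obtain ⟨S, hSd⟩ : ∃ S : ℕ, S = ⌈2 * √D * w⌉₊ := ⟨_, rfl⟩
  have hS1 : 2 * √D * w ≤ S := by rw [hSd]; exact Nat.le_ceil _
  have hS2 : (S : ℝ) + 1 ≤ d * w := by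
    have := (Nat.ceil_lt_add_one (by positivity : 0 ≤ 2 * √D * w)).le
    rw [← hSd] at this
    rw [hd]
    linarith
  have hSpos : (0 : ℝ) < S := lt_of_lt_of_le (by positivity) hS1
  have hS : 1 ≤ S := by exact_mod_cast hSpos
  have hSS : (0 : ℝ) < (S : ℝ) + 1 := by linarith
  obtain ⟨η, hη⟩ : ∃ η, η = Δ / (9 * L * ((S : ℝ) + 1) ^ (4 + γ)) := ⟨_, rfl⟩
  have hη0 : 0 < η := by rw [hη]; positivity
  have hlog : Real.log (2 + (40 * (G ^ 2 / L ^ 2)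
      + 1600 * (17 * (growthBound γ * (L * R ^ 2 + Δ) / L))) / η + 1 / (1 - σ₂))
      ≤ l * Real.log X := by
    rw [← hD, ← hB]
    refine (log_le_mul_log (c := 2 ^ k) (a := k) (k := 6) hX2 (by positivity) ?_ le_rfl).trans_eq
      (by rw [hl]; norm_num)
    have e : (40 * (G ^ 2 / L ^ 2) + 1600 * (17 * (D * B / L))) / η
        = 9 * ((S : ℝ) + 1) ^ (4 + γ) * (40 * (G ^ 2 / L / Δ) + 27200 * D * (B / Δ)) := by
      rw [hη]
      field_simp
      ring
    have h1 : ((S : ℝ) + 1) ^ (4 + γ) ≤ d ^ 5 * X ^ 5 := by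
      calc ((S : ℝ) + 1) ^ (4 + γ) ≤ ((S : ℝ) + 1) ^ (5 : ℝ) :=
            Real.rpow_le_rpow_of_exponent_le (by linarith) (by linarith)
        _ = ((S : ℝ) + 1) ^ 5 := by rw [← Real.rpow_natCast]; norm_num
        _ ≤ (d * X) ^ 5 := by
            gcongr
            refine hS2.trans ?_
            gcongr
            have : w ≤ w ^ 2 := le_self_pow₀ hw1 (by norm_num)
            linarith
        _ = _ := by ring
    have h2 : G ^ 2 / L / Δ ≤ X := le_trans (by gcongr) hGX
    have h3 : B / Δ ≤ X := le_trans (by gcongr) hBX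
    have h4 : X ≤ X ^ 6 := le_self_pow₀ (by linarith) (by norm_num)
    have h5 : 1 / (1 - σ₂) ≤ X := by linarith
    have h6 : (2 + 9 * d ^ 5 * (40 + 27200 * D)) * X ^ 6 ≤ 2 ^ k * X ^ 6 := by gcongr
    refine le_trans ?_ h6
    rw [e]
    calc 2 + 9 * ((S : ℝ) + 1) ^ (4 + γ) * (40 * (G ^ 2 / L / Δ) + 27200 * D * (B / Δ))
        + 1 / (1 - σ₂) ≤ X ^ 6 + 9 * (d ^ 5 * X ^ 5) * (40 * X + 27200 * D * X) + X ^ 6 := by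
          gcongr
          · linarith
          · linarith
      _ = _ := by ring
  obtain ⟨par, hcomm, hsamp, hacc⟩ := hpar M L σ σ₂
    (40 * (G ^ 2 / L ^ 2) + 1600 * (17 * (growthBound γ * (L * R ^ 2 + Δ) / L))) η X
    l (fun s => Δ / (9 * L * ((s : ℝ) + 1) ^ (4 + γ))) S hM hL hσ₂ hσ₂'
    (by rw [← hD, ← hB]; positivity) hη0 (fun s => by positivity) (fun s _ hs => by
      rw [hη]
      have : (s : ℝ) ≤ S := by exact_mod_cast hs
      gcongr) hlog
  have hsq : √(B / ((1 - σ₂) * ε)) = w * √(1 / (1 - σ₂)) := by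
    rw [hw, ← Real.sqrt_mul hBε]
    congr 1
    field_simp
  have hSw : (S : ℝ) ≤ d ^ 6 * w := by
    have : d * w ≤ d ^ 6 * w := by gcongr
    linarith
  have hSu : S * √(1 / (1 - σ₂)) ≤ d ^ 6 * √(B / ((1 - σ₂) * ε)) := by
    rw [hsq, ← mul_assoc]
    gcongr
  have hl2 : l ≤ l ^ 2 := le_self_pow₀ hl1 (by norm_num)
  refine ⟨S, par, ?_, ?_, fun n Ξ Ω _ _ P _ p ξ hp hξ hc hgap hdist hgrad => ?_⟩
  · calc (commCost S par : ℝ) ≤ C₀ * (d ^ 6 * √(B / ((1 - σ₂) * ε))) * (l * (Real.log X * 1)) := by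
          rw [mul_one]
          exact hcomm.trans (by gcongr)
      _ ≤ C₀ * (d ^ 6 * √(B / ((1 - σ₂) * ε))) * (l ^ 2 * (Real.log X * (2 * Real.log X))) := by
        gcongr
        linarith
      _ = 2 * (C₀ * (d ^ 6 * √(B / ((1 - σ₂) * ε))) * (l ^ 2 * Real.log X ^ 2)) := by ring
      _ ≤ 9 * (C₀ * (d ^ 6 * √(B / ((1 - σ₂) * ε))) * (l ^ 2 * Real.log X ^ 2)) := by
        gcongr
        norm_num
      _ = _ := by ring
  -- S rounds at the smallest tolerance, of order (S + 1)^(-(4 + γ)), with S of order √(B/ε), yield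
  -- the exponent (5 + γ)/2 = 2.5 + γ/2.
  · have hpow : S * ((S : ℝ) + 1) ^ (4 + γ)
        ≤ d ^ 6 * (B ^ (2.5 + γ / 2) / ε ^ (2.5 + γ / 2)) := by
      calc S * ((S : ℝ) + 1) ^ (4 + γ) ≤ ((S : ℝ) + 1) * ((S : ℝ) + 1) ^ (4 + γ) := by
            gcongr
            linarith
        _ = ((S : ℝ) + 1) ^ (5 + γ) := by
            rw [show 5 + γ = 1 + (4 + γ) by ring, Real.rpow_add hSS 1, Real.rpow_one]
        _ ≤ (d * w) ^ (5 + γ) := Real.rpow_le_rpow hSS.le hS2 (by linarith)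
        _ = d ^ (5 + γ) * w ^ (5 + γ) := Real.mul_rpow hd0.le hw0.le
        _ ≤ d ^ 6 * (B ^ (2.5 + γ / 2) / ε ^ (2.5 + γ / 2)) := by
            have h1 : d ^ (5 + γ) ≤ d ^ 6 := by
              rw [← Real.rpow_natCast d 6]
              exact Real.rpow_le_rpow_of_exponent_le hd1 (by push_cast; linarith)
            have h2 : w ^ (5 + γ) = B ^ (2.5 + γ / 2) / ε ^ (2.5 + γ / 2) := by
              rw [← Real.div_rpow hB0 hε.le, ← hw2, ← Real.rpow_natCast w 2,
                ← Real.rpow_mul hw0.le]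
              congr 1
              push_cast
              ring
            rw [h2]
            gcongr
    have h1 : S * (σ ^ 2 / (L ^ 2 * (1 - σ₂) ^ 3 * η))
        ≤ 9 * d ^ 6 * (B ^ (2.5 + γ / 2) * σ ^ 2
              / (L * Δ * (1 - σ₂) ^ 3 * ε ^ (2.5 + γ / 2))) := by
      calc S * (σ ^ 2 / (L ^ 2 * (1 - σ₂) ^ 3 * η))
          = 9 * (S * ((S : ℝ) + 1) ^ (4 + γ)) * (σ ^ 2 / (L * Δ * (1 - σ₂) ^ 3)) := by
            rw [hη]
            field_simp
        _ ≤ 9 * (d ^ 6 * (B ^ (2.5 + γ / 2) / ε ^ (2.5 + γ / 2)))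
            * (σ ^ 2 / (L * Δ * (1 - σ₂) ^ 3)) := by gcongr
        _ = _ := by field_simp
    have hsq0 := Real.sqrt_nonneg (B / ((1 - σ₂) * ε))
    have h2 : S * √(1 / (1 - σ₂)) ≤ 9 * d ^ 6 * √(B / ((1 - σ₂) * ε)) := by
      refine hSu.trans ?_
      have : 0 ≤ d ^ 6 * √(B / ((1 - σ₂) * ε)) := by positivity
      linarith
    refine hsamp.trans ((mul_le_mul_of_nonneg_right (mul_le_mul_of_nonneg_left (add_le_add h2 h1)
      hC₀.le) (by positivity)).trans (le_of_eq (by ring)))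
  · obtain ⟨h1, h2⟩ := catalyst_convex hp hM hL hγ hc hΔ hdist hgrad (hacc n Ξ Ω P p ξ hp hξ)
    refine ⟨fun s hs => h1 s (Finset.mem_Icc.1 hs).1,
      (h2 S hS).trans (ENNReal.ofReal_le_ofReal ?_)⟩
    rw [← hD, ← hB, div_le_iff₀ (by positivity)]
    have h3 : (2 * √D * w) ^ 2 ≤ ((S : ℝ) + 1) ^ 2 := by
      gcongr
      linarith
    have h4 : (2 * √D * w) ^ 2 = 4 * (D * (B / ε)) := by rw [mul_pow, mul_pow, hsD, hw2]; ring
    rw [h4] at h3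
    refine le_trans (le_of_eq ?_) (mul_le_mul_of_nonneg_left h3 hε.le)
    field_simp

end DecOpt

open DecOpt in
theorem mainTheorem2 :
    -- strongly convex
    (∃ C > (0 : ℝ), ∃ e : ℕ, ∀ (M : ℕ) (L μ σ σ₂ Δ G ε : ℝ), 0 < M → 0 < μ → μ ≤ L → 0 ≤ σ →
      0 ≤ σ₂ → σ₂ < 1 → 0 ≤ Δ → 0 ≤ G → 0 < ε →
      ∃ (S : ℕ) (par : ℕ → AccParams),
        (commCost S par : ℝ) ≤ C * √((L / μ) / (1 - σ₂))
          * Real.log (2 + M + L / μ + 1 / (1 - σ₂) + (Δ + G ^ 2 / L) / ε) ^ e ∧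
        (sampleCost S par : ℝ) ≤ C * (√((L / μ) / (1 - σ₂))
            + √(L / μ) * σ ^ 2 / (μ * (1 - σ₂) ^ 3 * ε))
          * Real.log (2 + M + L / μ + 1 / (1 - σ₂) + (Δ + G ^ 2 / L) / ε) ^ e ∧
        ∀ (n : ℕ) (Ξ Ω : Type*) [MeasurableSpace Ξ] [MeasurableSpace Ω]
          (P : Measure Ω) [IsProbabilityMeasure P] (p : Problem M n Ξ)
          (ξ : ℕ → ℕ → ℕ → Fin M → Ω → Ξ),
          p.Standing L σ σ₂ → IsSampling P p.D ξ → (∀ m, StronglyConvexWith μ (p.F m)) →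
          p.InitGapBound Δ → p.InitGradBound G →
          (∀ s ∈ Finset.Icc 1 S, p.expSubGap P L (.stronglyConvex μ) par ξ s ≤
            ENNReal.ofReal (2 * (1 - 0.9 * √(μ / (μ + 2 * L))) ^ s * Δ / 9)) ∧
          p.expGap P L (.stronglyConvex μ) par ξ S ≤ ENNReal.ofReal ε) ∧
    -- convex
    (∀ γ : ℝ, 0 < γ → γ ≤ 1 →
      ∃ C > (0 : ℝ), ∃ e : ℕ, ∀ (M : ℕ) (L σ σ₂ Δ R G ε : ℝ), 0 < M → 0 < L → 0 ≤ σ →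
      0 ≤ σ₂ → σ₂ < 1 → 0 ≤ Δ → 0 ≤ R → 0 ≤ G → 0 < ε →
      ∃ (S : ℕ) (par : ℕ → AccParams),
        (commCost S par : ℝ) ≤ C * √((L * R ^ 2 + Δ) / ((1 - σ₂) * ε))
          * Real.log (2 + M + 1 / (1 - σ₂) + (L * R ^ 2 + Δ + G ^ 2 / L) / ε) ^ e ∧
        (sampleCost S par : ℝ) ≤ C * (√((L * R ^ 2 + Δ) / ((1 - σ₂) * ε))
            + (L * R ^ 2 + Δ) ^ (2.5 + γ / 2) * σ ^ 2
              / (L * Δ * (1 - σ₂) ^ 3 * ε ^ (2.5 + γ / 2)))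
          * Real.log (2 + M + 1 / (1 - σ₂) + (L * R ^ 2 + Δ + G ^ 2 / L) / ε) ^ e ∧
        ∀ (n : ℕ) (Ξ Ω : Type*) [MeasurableSpace Ξ] [MeasurableSpace Ω]
          (P : Measure Ω) [IsProbabilityMeasure P] (p : Problem M n Ξ)
          (ξ : ℕ → ℕ → ℕ → Fin M → Ω → Ξ),
          p.Standing L σ σ₂ → IsSampling P p.D ξ → (∀ m, ConvexOn ℝ Set.univ (p.F m)) →
          p.InitGapBound Δ → p.InitDistBound R → p.InitGradBound G →
          (∀ s ∈ Finset.Icc 1 S, p.expSubGap P L .convex par ξ s ≤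
            ENNReal.ofReal (2 * Δ / (9 * ((s : ℝ) + 1) ^ (4 + γ)))) ∧
          p.expGap P L .convex par ξ S ≤ ENNReal.ofReal ε) ∧
    -- nonconvex
    (∃ C > (0 : ℝ), ∃ e : ℕ, ∀ (M : ℕ) (L σ σ₂ Δ G ε : ℝ), 0 < M → 0 < L → 0 ≤ σ →
      0 ≤ σ₂ → σ₂ < 1 → 0 ≤ Δ → 0 ≤ G → 0 < ε → ε ^ 2 ≤ 2 * L * Δ →
      ∃ (S : ℕ) (par : ℕ → AccParams), 1 ≤ S ∧
        (commCost S par : ℝ) ≤ C * (L * Δ / (√(1 - σ₂) * ε ^ 2))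
          * Real.log (2 + M + 1 / (1 - σ₂) + (L * Δ + G ^ 2) / ε ^ 2) ^ e ∧
        (sampleCost S par : ℝ) ≤ C * (L * Δ / (√(1 - σ₂) * ε ^ 2)
            + L * Δ * σ ^ 2 / ((1 - σ₂) ^ 3 * ε ^ 4))
          * Real.log (2 + M + 1 / (1 - σ₂) + (L * Δ + G ^ 2) / ε ^ 2) ^ e ∧
        ∀ (n : ℕ) (Ξ Ω : Type*) [MeasurableSpace Ξ] [MeasurableSpace Ω]
          (P : Measure Ω) [IsProbabilityMeasure P] (p : Problem M n Ξ)
          (ξ : ℕ → ℕ → ℕ → Fin M → Ω → Ξ),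
          p.Standing L σ σ₂ → IsSampling P p.D ξ → p.InitGapBound Δ → p.InitGradBound G →
          (∀ s ∈ Finset.Icc 1 S, p.expSubGap P L .nonconvex par ξ s ≤
            ENNReal.ofReal (Δ / S)) ∧
          (∑ s ∈ Finset.Icc 1 S, p.expGradSq P L .nonconvex par ξ s) / S
            ≤ ENNReal.ofReal (ε ^ 2)) :=
  ⟨catalyst_complexity_stronglyConvex, catalyst_complexity_convex, catalyst_complexity_nonconvex⟩
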